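/- Let $\mathcal C$ be an extensive, locally cartesian closed category (with finite limits and finite coproducts) having dependent $\mathcal W$- and $\mathcal M$-types, i.e. for every object $I$ and every diagram $I \xleftarrow{t} A \xrightarrow{P} S \xrightarrow{u} I$ the functor $\Sigma_u \Pi_P t^* : \mathcal C/I \to \mathcal C/I$ has an initial algebra and a terminal coalgebra. Let $\mathrm{Container}(\mathcal C)$ be the category whose objects are the morphisms $P : A \to I$ of $\mathcal C$ ($I$ is the shape of $P$), a morphism from $P : A \to I$ to $Q : B \to J$ being a pair $(\varphi,\psi)$ with $\varphi : I \to J$ and $\psi : \varphi^*B \to A$ a morphism over $I$; it is cartesian if $\psi$ is an isomorphism. Let $\mathrm{shape} : \mathrm{Container}(\mathcal C) \to \mathcal C$, $(\varphi,\psi)\mapsto\varphi$; its fibre over $I$ is $(\mathcal C/I)^{\mathrm{op}}$. A functor between slices $\mathcal C/T \to \mathcal C/U$ is polynomial if it is isomorphic to $\Sigma_u\Pi_P t^*$ for some $T \xleftarrow{t} A \xrightarrow{P} S \xrightarrow{u} U$. A functor $F : \mathrm{Container}(\mathcal C)^n \to \mathrm{Container}(\mathcal C)$ is fibred polynomial if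 (1) $\mathrm{shape}\circ F = F_0 \circ \mathrm{shape}^n$ for some $F_0 : \mathcal C^n \to \mathcal C$, and $F$ sends $n$-tuples of cartesian morphisms to cartesian morphisms; (2) $F_0$ is polynomial, under $\mathcal C^n \simeq \mathcal C/(1+\dots+1)$ and $\mathcal C \simeq \mathcal C/1$; (3) for all $I = (I_1,\dots,I_n)$, the functor $F_I : \mathcal C/(I_1+\dots+I_n) \simeq \prod_i \mathcal C/I_i \to \mathcal C/F_0(I)$ induced by $F$ on fibres is polynomial. For an endofunctor $H$ of $\mathrm{Container}(\mathcal C)$ lying over $H_0 : \mathcal C \to \mathcal C$, and an object $X$ with an isomorphism $a : H(X) \cong X$, say that $(X,a)$ is a $\mu$-fixpoint of $H$ if $(X,a)$ is an initial $H$-algebra; a $\nu$-fixpoint if $(X,a^{-1})$ is a terminal $H$-coalgebra; and a $\zeta$-fixpoint if, with $M = \mathrm{shape}(X)$ and $c = \mathrm{shape}(a^{-1}) : M \to H_0(M)$, the pair $(M,c)$ is a terminal $H_0$-coalgebra and $X$, with the structure induced by the backward part of $a$, is a terminal coalgebra for the endofunctor $c^*\circ H_M$ of $\mathcal C/M$.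 Theorem. Let $k \ge 0$, let $F : \mathrm{Container}(\mathcal C)^{k+1} \to \mathrm{Container}(\mathcal C)$ be fibred polynomial and let $\gamma \in \{\mu,\nu,\zeta\}$. Then the parametric fixpoint $(f_0,\dots,f_{k-1}) \mapsto \gamma F(f_0,\dots,f_{k-1},-)$ exists and extends to a fibred polynomial functor: there are a fibred polynomial functor $G : \mathrm{Container}(\mathcal C)^k \to \mathrm{Container}(\mathcal C)$ and isomorphisms $a_f : F(f_0,\dots,f_{k-1},G(f)) \cong G(f)$, natural in $f = (f_0,\dots,f_{k-1})$, such that for every $f$ the pair $(G(f),a_f)$ is a $\gamma$-fixpoint of $F(f_0,\dots,f_{k-1},-)$. -/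

import Mathlib

open CategoryTheory CategoryTheory.Limits Opposite

universe v u v₁ u₁

namespace FibCont

noncomputable section

/-! ### Locally cartesian closed categories and polynomial functors -/

/-- A category with pullbacks is locally cartesian closed when every pullback functor
`f^* : C/J ⥤ C/I` has a right adjoint. -/
class LocallyCartesianClosed (C : Type u) [Category.{v} C] [HasPullbacks C] : Prop where
  pullback_isLeftAdjoint : ∀ {I J : C} (f : I ⟶ J), (Over.pullback f).IsLeftAdjoint

attribute [instance] LocallyCartesianClosed.pullback_isLeftAdjoint

/-- The internal product `Π_f`, right adjoint to pullback along `f`. -/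
def internalPi {C : Type u} [Category.{v} C] [HasPullbacks C] [LocallyCartesianClosed C]
    {I J : C} (f : I ⟶ J) : Over I ⥤ Over J :=
  (Over.pullback f).rightAdjoint

/-- A container with arity `T` and dimension `U`: a diagram `T ⟵ A ⟶ I ⟶ U`. -/
structure DepContainer (C : Type u) [Category.{v} C] (T U : C) where
  dir : C
  shape : C
  arity : dir ⟶ T
  hom : dir ⟶ shape
  dim : shape ⟶ U

/-- The functor `Σ_u ∘ Π_P ∘ t^* : C/T ⥤ C/U` induced by a container `(P, t, u)`. -/
def DepContainer.functor {C : Type u} [Category.{v} C] [HasPullbacks C]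
    [LocallyCartesianClosed C] {T U : C} (D : DepContainer C T U) : Over T ⥤ Over U :=
  Over.pullback D.arity ⋙ internalPi D.hom ⋙ Over.map D.dim

/-- Dependent W-types: initial algebras for all functors `C/I ⥤ C/I` induced by containers. -/
class HasDependentWTypes (C : Type u) [Category.{v} C] [HasPullbacks C]
    [LocallyCartesianClosed C] : Prop where
  hasInitial : ∀ (I : C) (D : DepContainer C I I), HasInitial (Endofunctor.Algebra D.functor)

/-- Dependent M-types: terminal coalgebras for all functors `C/I ⥤ C/I` induced by containers. -/
class HasDependentMTypes (C : Type u) [Category.{v} C] [HasPullbacks C]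
    [LocallyCartesianClosed C] : Prop where
  hasTerminal : ∀ (I : C) (D : DepContainer C I I), HasTerminal (Endofunctor.Coalgebra D.functor)

/-- The comparison functor `∏ i, C/(I i) ⥤ C/(∐ I)` sending `(X i ⟶ I i)` to `∐ X ⟶ ∐ I`
(an equivalence when `C` is extensive). -/
@[simps]
def overSigma {C : Type u} [Category.{v} C] [HasFiniteCoproducts C] {ι : Type} [Finite ι]
    (I : ι → C) : (∀ i, Over (I i)) ⥤ Over (∐ I) where
  obj X := Over.mk (Limits.Sigma.map (fun i => (X i).hom))
  map {X Y} g := Over.homMk (Limits.Sigma.map (fun i => (g i).left))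

/-- The comparison functor `C^ι ⥤ C/(∐ 1)` sending `X` to `∐ X ⟶ ∐ 1`. -/
@[simps]
def powSigma (C : Type u) [Category.{v} C] [HasFiniteCoproducts C] [HasTerminal C] (ι : Type)
    [Finite ι] : (ι → C) ⥤ Over (∐ fun _ : ι => (⊤_ C)) where
  obj X := Over.mk (Limits.Sigma.map (fun i => terminal.from (X i)))
  map {X Y} g := Over.homMk (Limits.Sigma.map (fun i => g i))

section

variable {C : Type u} [Category.{v} C] [HasFiniteLimits C] [HasFiniteCoproducts C]
  [LocallyCartesianClosed C] {ι : Type} [Finite ι]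

/-- `G : C^ι ⥤ C` is polynomial: under `C^ι ≃ C/(∐ 1)` and `C ≃ C/1` it is isomorphic to the
functor induced by a container. -/
def IsPolynomialBase (G : (ι → C) ⥤ C) : Prop :=
  ∃ D : DepContainer C (∐ fun _ : ι => (⊤_ C)) (⊤_ C),
    Nonempty (G ≅ powSigma C ι ⋙ D.functor ⋙ Over.forget (⊤_ C))

/-- `G : ∏ i, C/(I i) ⥤ C/J` is polynomial: under `∏ i, C/(I i) ≃ C/(∐ I)` it is isomorphic to
the functor induced by a container. -/
def IsPolynomialFibre {I : ι → C} {J : C} (G : (∀ i, Over (I i)) ⥤ Over J) : Prop :=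
  ∃ D : DepContainer C (∐ I) J, Nonempty (G ≅ overSigma I ⋙ D.functor)

end

/-! ### The category of containers -/

/-- A (unary, one-dimensional) container: a morphism `hom : dir ⟶ shape`. -/
structure Container (C : Type u) [Category.{v} C] where
  dir : C
  shape : C
  hom : dir ⟶ shape

variable {C : Type u} [Category.{v} C] [HasPullbacks C]

attribute [local simp] pullback.lift_fst pullback.lift_snd pullback.lift_fst_assoc
  pullback.lift_snd_assoc

/-- A morphism of containers: a forward map on shapes, and a backward map
`fwd^* Q ⟶ P` over `P.shape`. -/
@[ext]
structure Container.Hom (P Q : Container C) where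
  fwd : P.shape ⟶ Q.shape
  back : pullback Q.hom fwd ⟶ P.dir
  w : back ≫ P.hom = pullback.snd Q.hom fwd

theorem Container.Hom.ext_lift {P Q : Container C} {f g : Container.Hom P Q}
    (h₁ : f.fwd = g.fwd)
    (h₂ : pullback.lift (pullback.fst Q.hom f.fwd) (pullback.snd Q.hom f.fwd)
      (by rw [← h₁]; exact pullback.condition) ≫ g.back = f.back) : f = g := by
  obtain ⟨f₁, f₂, hf⟩ := f
  obtain ⟨g₁, g₂, hg⟩ := g
  dsimp at h₁
  subst h₁
  simpa using h₂.symm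

/-- The identity container morphism. -/
def Container.Hom.id (P : Container C) : Container.Hom P P where
  fwd := 𝟙 _
  back := pullback.fst _ _
  w := by simpa using pullback.condition (f := P.hom) (g := 𝟙 P.shape)

/-- Composition: forward maps compose; backward, the answer to `R` is turned into one to `Q`
and then into one to `P`. -/
def Container.Hom.comp {P Q R : Container C} (f : Container.Hom P Q) (g : Container.Hom Q R) :
    Container.Hom P R where
  fwd := f.fwd ≫ g.fwd
  back := pullback.lift
      (pullback.lift (pullback.fst R.hom (f.fwd ≫ g.fwd)) (pullback.snd _ _ ≫ f.fwd)
        (by simpa using pullback.condition) ≫ g.back)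
      (pullback.snd _ _) (by simp [g.w]) ≫ f.back
  w := by simp [f.w]

instance : Category (Container C) where
  Hom := Container.Hom
  id := Container.Hom.id
  comp := Container.Hom.comp
  id_comp f := by
    refine Container.Hom.ext_lift (by simp [Container.Hom.comp, Container.Hom.id]) ?_
    simp only [Container.Hom.comp, Container.Hom.id, pullback.lift_fst]
    congr 1
    ext <;> simp
  comp_id f := by
    refine Container.Hom.ext_lift (by simp [Container.Hom.comp, Container.Hom.id]) ?_
    simp only [Container.Hom.comp, Container.Hom.id, pullback.lift_fst]
  assoc f g h := by
    refine Container.Hom.ext_lift (by simp [Container.Hom.comp]) ?_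
    simp only [Container.Hom.comp, ← Category.assoc]
    congr 1
    ext
    · simp only [Category.assoc, pullback.lift_fst]
      simp only [← Category.assoc]
      congr 1
      ext
      · simp only [Category.assoc, pullback.lift_fst]
        simp only [← Category.assoc]
        congr 1
        ext
        · simp only [Category.assoc, pullback.lift_fst]
          exact pullback.lift_fst _ _ _
        · simp only [Category.assoc, pullback.lift_snd, pullback.lift_snd_assoc]
          exact pullback.lift_snd_assoc _ _ _ _
      · simp only [Category.assoc, pullback.lift_snd, pullback.lift_snd_assoc]
        exact pullback.lift_snd_assoc _ _ _ _
    · simp only [Category.assoc, pullback.lift_snd]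
      exact pullback.lift_snd _ _ _

@[simp] theorem id_fwd (P : Container C) : Container.Hom.fwd (𝟙 P) = 𝟙 P.shape := rfl

@[simp] theorem comp_fwd {P Q R : Container C} (f : P ⟶ Q) (g : Q ⟶ R) :
    (f ≫ g).fwd = f.fwd ≫ g.fwd := rfl

/-- The shape functor, a Grothendieck fibration: the fibrewise opposite of the codomain
fibration. -/
@[simps]
def shapeFunctor (C : Type u) [Category.{v} C] [HasPullbacks C] : Container C ⥤ C where
  obj P := P.shape
  map f := f.fwd

/-- The `ι`-fold power `Container(C)^ι ⥤ C^ι` of the shape functor. -/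
abbrev shapePow (C : Type u) [Category.{v} C] [HasPullbacks C] (ι : Type) :
    (ι → Container C) ⥤ (ι → C) :=
  Functor.pi (fun _ : ι => shapeFunctor C)

/-- A container morphism is cartesian when its backward map is an isomorphism. -/
def IsCartesian {P Q : Container C} (f : P ⟶ Q) : Prop := IsIso f.back

/-! ### Fibres -/

/-- The inclusion `(C/I)ᵒᵖ ⥤ Container(C)` of the fibre of the shape functor over `I`. -/
@[simps]
def fibreIncl (I : C) : (Over I)ᵒᵖ ⥤ Container C where
  obj X := ⟨X.unop.left, I, X.unop.hom⟩
  map {X Y} g :=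
    { fwd := 𝟙 I
      back := pullback.fst Y.unop.hom (𝟙 I) ≫ g.unop.left
      w := by simpa using pullback.condition (f := Y.unop.hom) (g := 𝟙 I) }
  map_id X := by
    refine Container.Hom.ext_lift rfl ?_
    exact (pullback.lift_fst _ _ _).trans (Category.comp_id _).symm
  map_comp {X Y Z} f g := by
    refine Container.Hom.ext_lift (by simp) ?_
    refine (congrArg _ (pullback.lift_fst_assoc (f := Y.unop.hom) (g := 𝟙 I) _ _ _ _)).trans ?_
    refine (congrArg _ (Category.assoc _ _ _)).trans ?_
    refine (congrArg _ (congrArg _ (Category.assoc _ _ _))).trans ?_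
    refine (congrArg _ (pullback.lift_fst_assoc (f := Z.unop.hom) (g := 𝟙 I) _ _ _ _)).trans ?_
    exact pullback.lift_fst_assoc (f := Z.unop.hom) (g := 𝟙 I ≫ 𝟙 I) _ _ _ _

/-- The inclusion of the fibre of `shapePow` over the family `I`. -/
abbrev fibreInclPow {ι : Type} (I : ι → C) : (∀ i, Over (I i))ᵒᵖ ⥤ (ι → Container C) :=
  Functor.pi' (fun i => (Pi.eval (fun i => Over (I i)) i).op ⋙ fibreIncl (I i))

/-- If the forward map of `f : P ⟶ Q` has a section `s`, the backward map of `f` yields a map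
`Q.dir ⟶ P.dir` over `s`. -/
def backAlong {P Q : Container C} (f : P ⟶ Q) (s : Q.shape ⟶ P.shape) (hs : s ≫ f.fwd = 𝟙 _) :
    Q.dir ⟶ P.dir :=
  pullback.lift (𝟙 _) (Q.hom ≫ s) (by simp [hs]) ≫ f.back

theorem backAlong_hom {P Q : Container C} (f : P ⟶ Q) (s : Q.shape ⟶ P.shape)
    (hs : s ≫ f.fwd = 𝟙 _) : backAlong f s hs ≫ P.hom = Q.hom ≫ s := by
  simp [backAlong, f.w]

theorem backAlong_id (P : Container C) (s : P.shape ⟶ P.shape)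
    (hs : s ≫ Container.Hom.fwd (𝟙 P) = 𝟙 _) : backAlong (𝟙 P) s hs = 𝟙 _ := by
  exact pullback.lift_fst _ _ _

theorem backAlong_comp {P Q R : Container C} (f : P ⟶ Q) (g : Q ⟶ R)
    (s : Q.shape ⟶ P.shape) (hs : s ≫ f.fwd = 𝟙 _) (t : R.shape ⟶ Q.shape)
    (ht : t ≫ g.fwd = 𝟙 _) (r : R.shape ⟶ P.shape) (hr : r ≫ (f ≫ g).fwd = 𝟙 _)
    (h : r = t ≫ s) :
    backAlong (f ≫ g) r hr = backAlong g t ht ≫ backAlong f s hs := by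
  subst h
  have hr' : 𝟙 R.dir ≫ R.hom = (R.hom ≫ t ≫ s) ≫ f.fwd ≫ g.fwd := by
    simp [reassoc_of% hs, ht]
  change pullback.lift (f := R.hom) (g := f.fwd ≫ g.fwd) (𝟙 _) (R.hom ≫ t ≫ s) hr' ≫
    (pullback.lift _ _ _ ≫ f.back) = _
  simp only [backAlong, ← Category.assoc]
  congr 1
  ext
  · simp only [Category.assoc, pullback.lift_fst, Category.comp_id]
    simp only [← Category.assoc]
    congr 1
    apply pullback.hom_ext
    · simp
    · simp [hs]
  · simp [reassoc_of% g.w]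

theorem backAlong_congr {P Q : Container C} {f g : P ⟶ Q} (h : f = g) (s : Q.shape ⟶ P.shape)
    (hs : s ≫ f.fwd = 𝟙 _) : backAlong f s hs = backAlong g s (by rw [← h]; exact hs) := by
  subst h
  rfl

theorem toFibre_aux {D : Type u₁} [Category.{v₁} D] (K : Dᵒᵖ ⥤ Container C) {B : C}
    (e : ∀ X, (K.obj X).shape ≅ B)
    (he : ∀ {X Y : Dᵒᵖ} (g : X ⟶ Y), (K.map g).fwd ≫ (e Y).hom = (e X).hom)
    {X Y : Dᵒᵖ} (g : X ⟶ Y) : ((e Y).hom ≫ (e X).inv) ≫ (K.map g).fwd = 𝟙 _ := by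
  rw [(Iso.eq_comp_inv _).mpr (he g)]
  simp

/-- A functor `K` into `Container(C)` whose shape is constantly `B` (via `e`) amounts to a functor
into the fibre over `B`, that is, contravariantly, into `C/B`. -/
@[simps]
def toFibre {D : Type u₁} [Category.{v₁} D] (K : Dᵒᵖ ⥤ Container C) (B : C)
    (e : ∀ X, (K.obj X).shape ≅ B)
    (he : ∀ {X Y : Dᵒᵖ} (g : X ⟶ Y), (K.map g).fwd ≫ (e Y).hom = (e X).hom) : D ⥤ Over B where
  obj X := Over.mk ((K.obj (op X)).hom ≫ (e (op X)).hom)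
  map {X Y} g := Over.homMk
    (backAlong (K.map g.op) ((e (op X)).hom ≫ (e (op Y)).inv)
      (toFibre_aux K e he g.op))
    (by
      dsimp
      rw [← Category.assoc, backAlong_hom]
      simp)
  map_id X := by
    ext
    exact (backAlong_congr (K.map_id _) _ (toFibre_aux K e he (𝟙 (op X)))).trans
      (backAlong_id _ _ (by simp))
  map_comp {X Y Z} f g := by
    ext
    have h := toFibre_aux K e he (g.op ≫ f.op)
    exact (backAlong_congr (K.map_comp g.op f.op) _ h).trans
      (backAlong_comp _ _ _ (toFibre_aux K e he g.op) _ (toFibre_aux K e he f.op) _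
        (by rw [← K.map_comp]; exact h) (by simp))

/-! ### Fibred polynomial functors -/

/-- For `F` over `F₀`, the functor `∏ i, C/(I i) ⥤ C/(F₀ I)` induced by `F` on fibres. -/
def fibreFunctor {ι : Type} {F : (ι → Container C) ⥤ Container C} {F₀ : (ι → C) ⥤ C}
    (e : F ⋙ shapeFunctor C ≅ shapePow C ι ⋙ F₀) (I : ι → C) :
    (∀ i, Over (I i)) ⥤ Over (F₀.obj I) :=
  toFibre (fibreInclPow I ⋙ F) (F₀.obj I)
    (fun X => e.app ((fibreInclPow I).obj X))
    (fun {X Y} g => by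
      refine (e.hom.naturality ((fibreInclPow I).map g)).trans ?_
      refine Eq.trans ?_ (Category.comp_id _)
      exact congrArg _ (F₀.map_id I))

/-- `F : Container(C)^ι ⥤ Container(C)` is a fibred polynomial functor: it lies over some
`F₀ : C^ι ⥤ C` and preserves cartesian morphisms, and `F₀` as well as all functors induced on
fibres are polynomial. -/
def IsFibredPolynomial {C : Type u} [Category.{v} C] [HasFiniteLimits C]
    [HasFiniteCoproducts C] [LocallyCartesianClosed C] {ι : Type} [Finite ι]
    (F : (ι → Container C) ⥤ Container C) : Prop :=
  ∃ (F₀ : (ι → C) ⥤ C) (h : F ⋙ shapeFunctor C = shapePow C ι ⋙ F₀),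
    (∀ {P Q : ι → Container C} (f : P ⟶ Q), (∀ i, IsCartesian (f i)) → IsCartesian (F.map f)) ∧
    IsPolynomialBase F₀ ∧
    ∀ I : ι → C, IsPolynomialFibre (fibreFunctor (eqToIso h) I)

/-! ### Fixpoints -/

/-- For an endofunctor `H` of `Container(C)` over `H₀` and `b : M ⟶ H₀ M`, the endofunctor
`b^* ∘ H_M` of `C/M`. -/
def fibreEndofunctor {H : Container C ⥤ Container C} {H₀ : C ⥤ C}
    (e : H ⋙ shapeFunctor C ≅ shapeFunctor C ⋙ H₀) {M : C} (b : M ⟶ H₀.obj M) :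
    Over M ⥤ Over M :=
  toFibre (fibreIncl M ⋙ H) (H₀.obj M)
    (fun X => e.app ((fibreIncl M).obj X))
    (fun {X Y} g => by
      refine (e.hom.naturality ((fibreIncl M).map g)).trans ?_
      refine Eq.trans ?_ (Category.comp_id _)
      exact congrArg _ (H₀.map_id M)) ⋙ Over.pullback b

/-- The `H₀`-coalgebra structure on the shape of `X` induced by `a : H X ≅ X`. -/
def baseStr {H : Container C ⥤ Container C} {H₀ : C ⥤ C}
    (e : H ⋙ shapeFunctor C ≅ shapeFunctor C ⋙ H₀) {X : Container C} (a : H.obj X ≅ X) :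
    X.shape ⟶ H₀.obj X.shape :=
  a.inv.fwd ≫ e.hom.app X

/-- The coalgebra structure on `X`, as an object of `C/X.shape`, induced by the backward map of
`a : H X ≅ X`. -/
def fibreStr {H : Container C ⥤ Container C} {H₀ : C ⥤ C}
    (e : H ⋙ shapeFunctor C ≅ shapeFunctor C ⋙ H₀) {X : Container C} (a : H.obj X ≅ X) :
    Over.mk X.hom ⟶ (fibreEndofunctor e (baseStr e a)).obj (Over.mk X.hom) :=
  Over.homMk
    (pullback.lift (f := (H.obj X).hom ≫ (e.app X).hom) (g := baseStr e a)
      (backAlong a.hom a.inv.fwd (by rw [← comp_fwd, a.inv_hom_id, id_fwd])) X.hom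
      ((reassoc_of% backAlong_hom a.hom a.inv.fwd
        (by rw [← comp_fwd, a.inv_hom_id, id_fwd])) _))
    (pullback.lift_snd _ _ _)

/-- The three kinds of fixpoints: initial algebras `μ`, terminal coalgebras `ν`, and `ζ`. -/
inductive FixKind
  | mu
  | nu
  | zeta

/-- `(X, a : H X ≅ X)` is a fixpoint of the given kind of the endofunctor `H`. For `ζ`, the shape
of `X` is a terminal `H₀`-coalgebra and `X` itself a terminal coalgebra, over its shape, for the
endofunctor induced by `H` on `C/X.shape`. -/
def IsFixpoint (γ : FixKind) (H : Container C ⥤ Container C) (X : Container C)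
    (a : H.obj X ≅ X) : Prop :=
  match γ with
  | .mu => Nonempty (IsInitial (⟨X, a.hom⟩ : Endofunctor.Algebra H))
  | .nu => Nonempty (IsTerminal (⟨X, a.inv⟩ : Endofunctor.Coalgebra H))
  | .zeta =>
      ∃ (H₀ : C ⥤ C) (h : H ⋙ shapeFunctor C = shapeFunctor C ⋙ H₀),
        Nonempty (IsTerminal
          (⟨X.shape, baseStr (eqToIso h) a⟩ : Endofunctor.Coalgebra H₀)) ∧
        Nonempty (IsTerminal
          (⟨Over.mk X.hom, fibreStr (eqToIso h) a⟩ :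
            Endofunctor.Coalgebra (fibreEndofunctor (eqToIso h) (baseStr (eqToIso h) a))))

/-- `((f₀, …, f_{k-1}), X) ↦ (f₀, …, f_{k-1}, X)`. -/
def snocFunctor (D : Type u₁) [Category.{v₁} D] (k : ℕ) :
    (Fin k → D) × D ⥤ (Fin (k + 1) → D) :=
  Functor.pi' (Fin.lastCases (CategoryTheory.Prod.snd (Fin k → D) D)
    (fun j => CategoryTheory.Prod.fst (Fin k → D) D ⋙ Pi.eval (fun _ : Fin k => D) j))

/-- The endofunctor `F(f₀, …, f_{k-1}, -)`. -/
abbrev partialApp {D : Type u₁} [Category.{v₁} D] {k : ℕ} (F : (Fin (k + 1) → D) ⥤ D)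
    (f : Fin k → D) : D ⥤ D :=
  (Functor.curry.obj (snocFunctor D k ⋙ F)).obj f

/-- The functor `f ↦ F(f₀, …, f_{k-1}, G f)`. -/
abbrev diagApp {D : Type u₁} [Category.{v₁} D] {k : ℕ} (F : (Fin (k + 1) → D) ⥤ D)
    (G : (Fin k → D) ⥤ D) : (Fin k → D) ⥤ D :=
  Functor.prod' (𝟭 _) G ⋙ snocFunctor D k ⋙ F

end

end FibCont

/-!
A fixed point of `F (f, -)` is glued from a fixed point of the functor on shapes and a fixed point
of the induced endofunctor of the slice over the resulting shape. So there are two things to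
prove: polynomial functors between slices have polynomial parametric fixed points, and the glued
fixed points form a fibred polynomial functor with the required universal property.

**Polynomial functors.** Up to isomorphism, and separating the variable in which the fixed point
is taken from the parameters, a polynomial functor is `H (x, Y) = Σ_u (N x ×_S Π_h t^* Y)` with
`N` polynomial in the parameters; this is `step` applied to `N x`. Let `W` be the W-type (or
M-type) of `Σ_u Π_h t^*`, an object of trees with nodes labelled in `S`. The paths in a tree from
its root to its nodes are the elements of a further W-type `Q` over `W` (`Paths.nonempty`, which
uses extensivity), and every path leads to a label, by `lab : Q ⟶ S`. A tree whose every node is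
decorated by an element of `N x` over its label is an element of `Σ_W Π_Q lab^* (N x)`, which is
polynomial in `N x`. This object, `Trees.dec`, is the initial algebra (or terminal coalgebra) of
`H (x, -)`:

* A coalgebra for `H (x, -)` is in particular a coalgebra for `Σ_u Π_h t^*`. Given a map of the
  latter to `W`, the coalgebra maps to decorated trees above it correspond to the ways of
  following paths in the coalgebra, and by recursion over paths there is exactly one
  (`Trees.existsUnique_dec`). If `W` is the M-type this gives terminality
  (`Trees.isTermCoalg_dec`).
* If `W` is the W-type, recursion over `W` extends to objects over `W` (`existsUnique_rec`), which
  gives initiality (`Trees.isInitAlg_dec`).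

That the polynomial functors are closed under the operations used here, and that the last variable
can be split off, is read off from their left adjoints: a functor is polynomial iff up to some
`Σ_u` it is right adjoint to a functor `Y ↦ (Σ_{t i} (h i)^* Y)_i` (`isPolynomialFibre_iff`), and
such functors compose by the Beck–Chevalley isomorphism. The outcome is
`exists_isParamFix_of_isPolynomialFibre` and, for the functor on shapes,
`exists_isParamFix_of_isPolynomialBase`.

**Gluing.** Let `c` be a parametric fixed point `G₀` on shapes. Over every `G₀ I` the functor `F`
induces an endofunctor `fibreEnd` of the slice. The fibres of the shape functor being opposite to
the slices, a terminal coalgebra `X` of `fibreEnd` makes the container `X` initial relative to the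
base: an algebra morphism out of it is determined by its map of shapes, which can be any algebra
morphism (`existsUnique_algHom`). This factors morphisms through cartesian lifts, which are given
by pullback. Dually, an initial algebra of `fibreEnd` is terminal relative to the base
(`existsUnique_coalgHom`), by factoring through opcartesian lifts, which are given by internal
products. Accordingly

* a `μ`-fixpoint is initial in the base and terminal in the slice,
* a `ν`-fixpoint is terminal in the base and initial in the slice,
* a `ζ`-fixpoint is terminal in the base and terminal in the slice

(`isFixpoint_totalIso`). In all three cases the relative universal property lets morphisms of
parameters act uniquely on the glued fixed points (`existsUnique_fixMap`), which gives the functor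
`fixFunctor`. It preserves cartesian morphisms (`isCartesian_fixFunctor_map`) since pullback
functors have adjoints on both sides and therefore preserve terminal coalgebras as well as initial
algebras. On the fibre over `I` it is the parametric fixed point of a polynomial functor between
slices (`nonempty_fibreFunctor_fixFunctor_iso`), hence polynomial.
-/

universe v₂ u₂

namespace FibCont

noncomputable section

attribute [local simp] pullback.lift_fst pullback.lift_snd pullback.lift_fst_assoc
  pullback.lift_snd_assoc coprod.inl_desc coprod.inr_desc coprod.inl_desc_assoc
  coprod.inr_desc_assoc

/-! ### Dependent products through generalized elements -/

/-- `R`, with the evaluation map `ev`, is the dependent product over `S` of the family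
`a^* X` along `f`: a map `Z ⟶ R` over `z : Z ⟶ S` amounts to a map `z^* A ⟶ X` over `a`. -/
structure DepProd {C : Type u} [Category.{v} C] [HasPullbacks C] {A S T : C} (f : A ⟶ S)
    (a : A ⟶ T) (X : Over T) (R : Over S) where
  ev : pullback R.hom f ⟶ X.left
  ev_hom : ev ≫ X.hom = pullback.snd _ _ ≫ a
  lam : ∀ {Z : C} (z : Z ⟶ S) (κ : pullback z f ⟶ X.left)
    (_ : κ ≫ X.hom = pullback.snd z f ≫ a), Z ⟶ R.left
  lam_hom : ∀ {Z : C} (z : Z ⟶ S) (κ : pullback z f ⟶ X.left)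
    (h : κ ≫ X.hom = pullback.snd z f ≫ a), lam z κ h ≫ R.hom = z
  lam_ev : ∀ {Z : C} (z : Z ⟶ S) (κ : pullback z f ⟶ X.left)
    (h : κ ≫ X.hom = pullback.snd z f ≫ a),
    pullback.lift (pullback.fst z f ≫ lam z κ h) (pullback.snd z f)
      (by rw [Category.assoc, lam_hom, pullback.condition]) ≫ ev = κ
  uniq : ∀ {Z : C} (x y : Z ⟶ R.left) (h : x ≫ R.hom = y ≫ R.hom)
    (_ : pullback.lift (f := R.hom) (g := f) (pullback.fst (x ≫ R.hom) f ≫ x)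
      (pullback.snd (x ≫ R.hom) f) (by rw [Category.assoc, pullback.condition]) ≫ ev =
      pullback.lift (f := R.hom) (g := f) (pullback.fst (x ≫ R.hom) f ≫ y)
      (pullback.snd (x ≫ R.hom) f) (by rw [Category.assoc, ← h, pullback.condition]) ≫ ev),
    x = y

namespace DepProd

variable {C : Type u} [Category.{v} C] [HasPullbacks C] {A S T : C} {f : A ⟶ S} {a : A ⟶ T}
  {X : Over T} {R : Over S}

/-- The value of `x : Z ⟶ R` at the argument `α : Z ⟶ A`. -/
def app (d : DepProd f a X R) {Z : C} (x : Z ⟶ R.left) (α : Z ⟶ A) (h : x ≫ R.hom = α ≫ f) :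
    Z ⟶ X.left :=
  pullback.lift x α h ≫ d.ev

variable (d : DepProd f a X R)

theorem app_hom {Z : C} (x : Z ⟶ R.left) (α : Z ⟶ A) (h : x ≫ R.hom = α ≫ f) :
    d.app x α h ≫ X.hom = α ≫ a := by
  simp [app, d.ev_hom]

theorem comp_app {Y Z : C} (w : Y ⟶ Z) (x : Z ⟶ R.left) (α : Z ⟶ A) (h : x ≫ R.hom = α ≫ f) :
    w ≫ d.app x α h = d.app (w ≫ x) (w ≫ α) (by simp [h]) := by
  unfold app
  rw [← Category.assoc]
  congr 1
  ext <;> simp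

theorem app_congr {Z : C} {x y : Z ⟶ R.left} {α β : Z ⟶ A} (hx : x = y) (hα : α = β)
    (h : x ≫ R.hom = α ≫ f) : d.app x α h = d.app y β (by rw [← hx, ← hα, h]) := by
  subst hx hα
  rfl

theorem app_lam {Y Z : C} (w : Y ⟶ Z) (z : Z ⟶ S) (κ : pullback z f ⟶ X.left)
    (hκ : κ ≫ X.hom = pullback.snd z f ≫ a) (α : Y ⟶ A)
    (h : (w ≫ d.lam z κ hκ) ≫ R.hom = α ≫ f) :
    d.app (w ≫ d.lam z κ hκ) α h =
      pullback.lift w α (by rw [← h, Category.assoc, d.lam_hom]) ≫ κ := by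
  refine Eq.trans ?_ (congrArg (pullback.lift w α _ ≫ ·) (d.lam_ev z κ hκ))
  unfold app
  rw [← Category.assoc]
  congr 1
  ext <;> simp

theorem hom_ext {Z : C} {x y : Z ⟶ R.left} (h : x ≫ R.hom = y ≫ R.hom)
    (h' : ∀ {Y : C} (w : Y ⟶ Z) (α : Y ⟶ A) (hx : (w ≫ x) ≫ R.hom = α ≫ f)
      (hy : (w ≫ y) ≫ R.hom = α ≫ f), d.app (w ≫ x) α hx = d.app (w ≫ y) α hy) : x = y :=
  d.uniq x y h (h' _ _ _ _)

/-- A right adjoint of `Σ_a ∘ f^*` computes dependent products. -/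
def ofAdj {G : Over T ⥤ Over S} (adj : Over.pullback f ⋙ Over.map a ⊣ G) (X : Over T) :
    DepProd f a X (G.obj X) where
  ev := (adj.counit.app X).left
  ev_hom := Over.w (adj.counit.app X)
  lam z κ h := (adj.homEquiv (Over.mk z) X (Over.homMk κ h)).left
  lam_hom z κ h := Over.w (adj.homEquiv (Over.mk z) X (Over.homMk κ h))
  lam_ev z κ h := by
    have := congrArg Over.Hom.left
      ((adj.homEquiv (Over.mk z) X).symm_apply_apply (Over.homMk κ h))
    rw [adj.homEquiv_counit] at this
    exact this
  uniq x y h h' := by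
    let x' : Over.mk (x ≫ (G.obj X).hom) ⟶ G.obj X := Over.homMk x rfl
    let y' : Over.mk (x ≫ (G.obj X).hom) ⟶ G.obj X := Over.homMk y h.symm
    suffices x' = y' from congrArg Over.Hom.left this
    apply (adj.homEquiv _ _).symm.injective
    rw [adj.homEquiv_counit, adj.homEquiv_counit]
    ext
    exact h'

theorem ofAdj_map {G : Over T ⥤ Over S} (adj : Over.pullback f ⋙ Over.map a ⊣ G) {X Y : Over T}
    (g : X ⟶ Y) {Z : C} (x : Z ⟶ (G.obj X).left) (α : Z ⟶ A)
    (h : (x ≫ (G.map g).left) ≫ (G.obj Y).hom = α ≫ f) :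
    (ofAdj adj Y).app (x ≫ (G.map g).left) α h =
      (ofAdj adj X).app x α (by rw [← h, Category.assoc, Over.w]) ≫ g.left := by
  have := congrArg Over.Hom.left (adj.counit.naturality g)
  unfold app
  rw [Category.assoc]
  refine Eq.trans ?_ (congrArg _ this)
  change pullback.lift _ _ _ ≫ (adj.counit.app Y).left =
    pullback.lift _ _ _ ≫ pullback.lift (pullback.fst _ _ ≫ (G.map g).left) (pullback.snd _ _) _ ≫
      (adj.counit.app Y).left
  rw [← Category.assoc]
  congr 1
  ext <;> simp

end DepProd

section Adj

variable {C : Type u} [Category.{v} C] [HasPullbacks C] [LocallyCartesianClosed C]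

/-- The functor `Π_f ∘ a^*`. -/
def piPullback {A S T : C} (f : A ⟶ S) (a : A ⟶ T) : Over T ⥤ Over S :=
  Over.pullback a ⋙ internalPi f

/-- The adjunction `Σ_a ∘ f^* ⊣ Π_f ∘ a^*`. -/
def piPullbackAdj {A S T : C} (f : A ⟶ S) (a : A ⟶ T) :
    Over.pullback f ⋙ Over.map a ⊣ piPullback f a :=
  (Adjunction.ofIsLeftAdjoint (Over.pullback f)).comp (Over.mapPullbackAdj a)

end Adj

/-! ### Paths in a graph -/

/-- The object of paths in the internal graph `p, t : E ⟶ W`, fibred over the starting vertex: the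
initial object with empty paths `root` and with `cons`, which puts an edge in front of a path. -/
structure Paths {C : Type u} [Category.{v} C] [HasPullbacks C] {E W : C} (p t : E ⟶ W) where
  Q : Over W
  root : W ⟶ Q.left
  root_hom : root ≫ Q.hom = 𝟙 W
  cons : pullback t Q.hom ⟶ Q.left
  cons_hom : cons ≫ Q.hom = pullback.fst _ _ ≫ p
  exists_fold : ∀ {Z : C} (z : Z ⟶ W) (r : W ⟶ Z) (c : pullback t z ⟶ Z) (_ : r ≫ z = 𝟙 W)
    (_ : c ≫ z = pullback.fst _ _ ≫ p), ∃ (k : Q.left ⟶ Z) (hk : k ≫ z = Q.hom),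
      root ≫ k = r ∧ cons ≫ k = pullback.lift (pullback.fst _ _) (pullback.snd _ _ ≫ k)
        (by rw [Category.assoc, hk, pullback.condition]) ≫ c
  fold_unique : ∀ {Z : C} (z : Z ⟶ W) (r : W ⟶ Z) (c : pullback t z ⟶ Z) (_ : r ≫ z = 𝟙 W)
    (_ : c ≫ z = pullback.fst _ _ ≫ p) (k k' : Q.left ⟶ Z)
    (hk : k ≫ z = Q.hom) (hk' : k' ≫ z = Q.hom) (_ : root ≫ k = r) (_ : root ≫ k' = r)
    (_ : cons ≫ k = pullback.lift (pullback.fst _ _) (pullback.snd _ _ ≫ k)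
      (by rw [Category.assoc, hk, pullback.condition]) ≫ c)
    (_ : cons ≫ k' = pullback.lift (pullback.fst _ _) (pullback.snd _ _ ≫ k')
      (by rw [Category.assoc, hk', pullback.condition]) ≫ c), k = k'

namespace Paths

section

variable {C : Type u} [Category.{v} C] [HasPullbacks C] {E W : C} {p t : E ⟶ W}

/-- `cons` on generalized elements. -/
def consAt (𝒬 : Paths p t) {Z : C} (e : Z ⟶ E) (q : Z ⟶ 𝒬.Q.left) (h : e ≫ t = q ≫ 𝒬.Q.hom) :
    Z ⟶ 𝒬.Q.left :=
  pullback.lift e q h ≫ 𝒬.cons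

variable (𝒬 : Paths p t)

@[simp]
theorem consAt_hom {Z : C} (e : Z ⟶ E) (q : Z ⟶ 𝒬.Q.left) (h : e ≫ t = q ≫ 𝒬.Q.hom) :
    𝒬.consAt e q h ≫ 𝒬.Q.hom = e ≫ p := by
  simp [consAt, 𝒬.cons_hom]

theorem comp_consAt {Y Z : C} (w : Y ⟶ Z) (e : Z ⟶ E) (q : Z ⟶ 𝒬.Q.left)
    (h : e ≫ t = q ≫ 𝒬.Q.hom) :
    w ≫ 𝒬.consAt e q h = 𝒬.consAt (w ≫ e) (w ≫ q) (by simp [h]) := by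
  unfold consAt
  rw [← Category.assoc]
  congr 1
  ext <;> simp

theorem consAt_congr {Z : C} {e e' : Z ⟶ E} {q q' : Z ⟶ 𝒬.Q.left} (he : e = e') (hq : q = q')
    (h : e ≫ t = q ≫ 𝒬.Q.hom) : 𝒬.consAt e q h = 𝒬.consAt e' q' (by rw [← he, ← hq, h]) := by
  subst he hq
  rfl

/-- The object `V`, over `W` by `v`, follows edges: `ch` moves an element of `V` along any edge
starting at the vertex below it. A map `κ` from pairs of an element of `V` and a path starting
there is the *iteration* of `n : V ⟶ N` if it moves along the path and then applies `n`. -/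
structure IsIter {V EV N : C} (v : V ⟶ W) (pV : EV ⟶ V) (eV : EV ⟶ E)
    (hV : eV ≫ p = pV ≫ v) (ch : EV ⟶ V) (hch : ch ≫ v = eV ≫ t) (n : V ⟶ N)
    (κ : pullback v 𝒬.Q.hom ⟶ N) : Prop where
  root : ∀ {Z : C} (x : Z ⟶ V) (q : Z ⟶ 𝒬.Q.left) (h : x ≫ v = q ≫ 𝒬.Q.hom)
    (_ : q = x ≫ v ≫ 𝒬.root), pullback.lift x q h ≫ κ = x ≫ n
  cons : ∀ {Z : C} (e : Z ⟶ EV) (q : Z ⟶ 𝒬.Q.left) (h : (e ≫ eV) ≫ t = q ≫ 𝒬.Q.hom),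
    pullback.lift (e ≫ pV) (𝒬.consAt (e ≫ eV) q h) (by simp [← hV]) ≫ κ =
      pullback.lift (e ≫ ch) q (by simp [hch, ← h]) ≫ κ

variable {𝒬}

theorem IsIter.comp {V EV N N' : C} {v : V ⟶ W} {pV : EV ⟶ V} {eV : EV ⟶ E}
    {hV : eV ≫ p = pV ≫ v} {ch : EV ⟶ V} {hch : ch ≫ v = eV ≫ t} {n : V ⟶ N}
    {κ : pullback v 𝒬.Q.hom ⟶ N} (hκ : 𝒬.IsIter v pV eV hV ch hch n κ) (g : N ⟶ N') :
    𝒬.IsIter v pV eV hV ch hch (n ≫ g) (κ ≫ g) where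
  root x q h hq := by rw [← Category.assoc, hκ.root x q h hq, Category.assoc]
  cons e q h := by rw [← Category.assoc, hκ.cons e q h, Category.assoc]

end

variable {C : Type u} [Category.{v} C] [HasFiniteLimits C] [LocallyCartesianClosed C]
  {E W : C} {p t : E ⟶ W}

/-- Iteration exists and is unique. Transposed along the exponential `V ⇒ N` over `W`, it is a
map out of the paths, and the conditions say that it is a homomorphism. -/
theorem existsUnique_iter (𝒬 : Paths p t) {V EV N : C} {v : V ⟶ W} {pV : EV ⟶ V} {eV : EV ⟶ E}
    (hEV : IsPullback eV pV p v) {ch : EV ⟶ V} (hch : ch ≫ v = eV ≫ t) (n : V ⟶ N) :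
    ∃! κ : pullback v 𝒬.Q.hom ⟶ N, 𝒬.IsIter v pV eV hEV.w ch hch n κ := by
  let T : C := ⊤_ C
  let X : Over T := Over.mk (terminal.from N)
  let d := DepProd.ofAdj (piPullbackAdj v (terminal.from V)) X
  set R := (piPullback v (terminal.from V)).obj X
  -- the homomorphism structure on the exponential
  let r : W ⟶ R.left := d.lam (𝟙 W) (pullback.snd _ _ ≫ n) (Subsingleton.elim _ _)
  have hr : r ≫ R.hom = 𝟙 W := d.lam_hom _ _ _
  let z : pullback t R.hom ⟶ W := pullback.fst t R.hom ≫ p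
  have hz : (pullback.fst z v ≫ pullback.fst t R.hom) ≫ p = pullback.snd z v ≫ v := by
    rw [Category.assoc]; exact pullback.condition
  let κc : pullback z v ⟶ N :=
    d.app (pullback.fst z v ≫ pullback.snd t R.hom)
      (hEV.lift (pullback.fst z v ≫ pullback.fst t R.hom) (pullback.snd z v) hz ≫ ch) (by
        simp [hch, pullback.condition])
  let c : pullback t R.hom ⟶ R.left := d.lam z κc (Subsingleton.elim _ _)
  have hc : c ≫ R.hom = pullback.fst _ _ ≫ p := d.lam_hom _ _ _
  have key : ∀ {Z : C} (w : Z ⟶ pullback t R.hom) (α : Z ⟶ V) (h : (w ≫ c) ≫ R.hom = α ≫ v)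
      (e : Z ⟶ EV) (_ : e ≫ eV = w ≫ pullback.fst _ _) (_ : e ≫ pV = α)
      (h' : (w ≫ pullback.snd _ _) ≫ R.hom = (e ≫ ch) ≫ v),
      d.app (w ≫ c) α h = d.app (w ≫ pullback.snd _ _) (e ≫ ch) h' := by
    intro Z w α h e he₁ he₂ h'
    refine (d.app_lam w z κc _ α h).trans ?_
    refine (d.comp_app _ _ _ _).trans ?_
    refine d.app_congr (by simp) ?_ _
    rw [← Category.assoc]
    congr 1
    apply hEV.hom_ext <;> simp [he₁, he₂]
  obtain ⟨k, hk, hk₁, hk₂⟩ := 𝒬.exists_fold R.hom r c hr hc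
  refine ⟨d.app (pullback.snd _ _ ≫ k) (pullback.fst v 𝒬.Q.hom)
    (by rw [Category.assoc, hk, pullback.condition]), ⟨?_, ?_⟩, ?_⟩
  · intro Z x q h hq
    subst hq
    refine (d.comp_app _ _ _ _).trans ((d.app_congr (y := (x ≫ v) ≫ r) (β := x) (by
      simp [hk₁]) (by simp) _).trans ((d.app_lam _ _ _ _ _ _).trans (by simp)))
  · intro Z e q h
    refine (d.comp_app _ _ _ _).trans (Eq.trans ?_ (d.comp_app _ _ _ _).symm)
    refine (d.app_congr (y := pullback.lift (e ≫ eV) (q ≫ k) (by simp [hk, ← h]) ≫ c)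
      (β := e ≫ pV) ?_ (by simp) _).trans
      ((key _ _ _ e (by simp) rfl (by simp [hk, ← h, hch])).trans
        (d.app_congr (by simp) (by simp) _))
    rw [pullback.lift_snd_assoc, consAt, Category.assoc, hk₂, ← Category.assoc]
    congr 1
    ext <;> simp
  · intro κ hκ
    let k' : 𝒬.Q.left ⟶ R.left := d.lam 𝒬.Q.hom
      (pullback.lift (pullback.snd 𝒬.Q.hom v) (pullback.fst _ _) pullback.condition.symm ≫ κ)
      (Subsingleton.elim _ _)
    have hk' : k' ≫ R.hom = 𝒬.Q.hom := d.lam_hom _ _ _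
    have app_k' : ∀ {Z : C} (q : Z ⟶ 𝒬.Q.left) (α : Z ⟶ V) (h : (q ≫ k') ≫ R.hom = α ≫ v),
        d.app (q ≫ k') α h =
          pullback.lift α q (by rw [← h, Category.assoc, hk']) ≫ κ := by
      intro Z q α h
      refine (d.app_lam _ _ _ _ _ _).trans ?_
      rw [← Category.assoc]
      congr 1
      ext <;> simp
    have : k' = k := by
      refine 𝒬.fold_unique R.hom r c hr hc k' k hk' hk ?_ hk₁ ?_ hk₂
      · refine d.hom_ext (by rw [Category.assoc, hk', 𝒬.root_hom, hr]) ?_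
        intro Y w α hx hy
        have hw : w = α ≫ v := by
          rw [Category.assoc, hr, Category.comp_id] at hy
          exact hy
        refine (d.app_congr (y := (w ≫ 𝒬.root) ≫ k') (Category.assoc _ _ _).symm rfl _).trans
          ((app_k' _ _ _).trans ?_)
        refine (hκ.root _ _ _ (by rw [hw, Category.assoc])).trans ?_
        refine Eq.trans ?_ (d.app_lam _ _ _ _ _ _).symm
        simp
      · refine d.hom_ext ?_ ?_
        · refine (Category.assoc _ _ _).trans ((congrArg (𝒬.cons ≫ ·) hk').trans ?_)
          simp [hc, 𝒬.cons_hom]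
        intro Y w α hx hy
        have hwα : (w ≫ pullback.fst _ _) ≫ p = α ≫ v := by
          rw [← hx]
          simp [hk', 𝒬.cons_hom]
        let e : Y ⟶ EV := hEV.lift (w ≫ pullback.fst _ _) α hwα
        have he₁ : e ≫ eV = w ≫ pullback.fst _ _ := hEV.lift_fst _ _ _
        have he₂ : e ≫ pV = α := hEV.lift_snd _ _ _
        have hq : (e ≫ eV) ≫ t = (w ≫ pullback.snd _ _) ≫ 𝒬.Q.hom := by
          rw [he₁, Category.assoc, pullback.condition, Category.assoc]
        have hq' : w ≫ pullback.snd t 𝒬.Q.hom ≫ 𝒬.Q.hom = e ≫ eV ≫ t := by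
          simpa using hq.symm
        refine (d.app_congr (y := (𝒬.consAt (e ≫ eV) (w ≫ pullback.snd _ _) hq) ≫ k')
          (β := e ≫ pV) ?_ he₂.symm _).trans ((app_k' _ _ _).trans ((hκ.cons e _ hq).trans ?_))
        · rw [consAt, ← Category.assoc]
          congr 2
          ext <;> simp [he₁]
        · refine (app_k' _ _ (by simp [hk', hq', hch])).symm.trans ?_
          refine Eq.trans ?_ ((d.app_congr (Category.assoc _ _ _).symm rfl hy).trans
            (key _ α _ e (by simp [he₁]) he₂ (by simp [hk', hq', hch]))).symm
          exact d.app_congr (by simp) rfl _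
    subst this
    refine Eq.symm ((app_k' _ _ _).trans (Eq.trans ?_ (Category.id_comp κ)))
    congr 1
    ext <;> simp

end Paths

/-! ### Case distinction in extensive categories -/

section Cases

variable {C : Type u} [Category.{v} C] [HasPullbacks C] [FinitaryExtensive C]

theorem nonempty_isColimit_pullback {A B X : C} (x : X ⟶ A ⨿ B) :
    Nonempty (IsColimit (BinaryCofan.mk (pullback.fst x coprod.inl)
      (pullback.fst x coprod.inr))) :=
  ((BinaryCofan.isVanKampen_iff _).mp
    (FinitaryExtensive.vanKampen (BinaryCofan.mk (coprod.inl : A ⟶ A ⨿ B) coprod.inr)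
      (coprodIsCoprod A B)) (BinaryCofan.mk (pullback.fst x coprod.inl)
        (pullback.fst x coprod.inr)) (pullback.snd _ _) (pullback.snd _ _) x
      pullback.condition.symm pullback.condition.symm).mpr
    ⟨IsPullback.of_hasPullback _ _, IsPullback.of_hasPullback _ _⟩

/-- In an extensive category a map out of an object over a coproduct may be defined by cases. -/
theorem exists_cases {A B X Z : C} (x : X ⟶ A ⨿ B) (g : pullback x coprod.inl ⟶ Z)
    (h : pullback x coprod.inr ⟶ Z) :
    ∃ k : X ⟶ Z, (∀ {Y : C} (y : Y ⟶ X) (a : Y ⟶ A) (ha : y ≫ x = a ≫ coprod.inl),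
        y ≫ k = pullback.lift y a ha ≫ g) ∧
      ∀ {Y : C} (y : Y ⟶ X) (b : Y ⟶ B) (hb : y ≫ x = b ≫ coprod.inr),
        y ≫ k = pullback.lift y b hb ≫ h := by
  obtain ⟨hc⟩ := nonempty_isColimit_pullback x
  obtain ⟨k, hk₁, hk₂⟩ : ∃ k : X ⟶ Z, pullback.fst x coprod.inl ≫ k = g ∧
      pullback.fst x coprod.inr ≫ k = h :=
    ⟨_, (BinaryCofan.IsColimit.desc' hc g h).2⟩
  refine ⟨k, fun y a ha => ?_, fun y b hb => ?_⟩
  · rw [← hk₁]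
    simp
  · rw [← hk₂]
    simp

theorem cases_ext {A B X Z : C} (x : X ⟶ A ⨿ B) {k k' : X ⟶ Z}
    (h₁ : ∀ {Y : C} (y : Y ⟶ X) (a : Y ⟶ A) (_ : y ≫ x = a ≫ coprod.inl), y ≫ k = y ≫ k')
    (h₂ : ∀ {Y : C} (y : Y ⟶ X) (b : Y ⟶ B) (_ : y ≫ x = b ≫ coprod.inr), y ≫ k = y ≫ k') :
    k = k' := by
  obtain ⟨hc⟩ := nonempty_isColimit_pullback x
  exact BinaryCofan.IsColimit.hom_ext hc (h₁ _ _ pullback.condition) (h₂ _ _ pullback.condition)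

/-- Coproduct inclusions are disjoint: an object over both summands is initial. -/
def isInitialOfDisjoint {A B Y : C} (a : Y ⟶ A) (b : Y ⟶ B)
    (h : a ≫ coprod.inl = b ≫ (coprod.inr : B ⟶ A ⨿ B)) : IsInitial Y :=
  have H := FinitaryExtensive.isPullback_initial_to_binaryCofan (coprodIsCoprod A B)
  have := (initialIsInitial (C := C)).isIso_to (H.lift a b h)
  initialIsInitial.ofIso (asIso (H.lift a b h)).symm

end Cases

/-! ### Existence of path objects -/

namespace Paths

variable {C : Type u} [Category.{v} C] [HasFiniteLimits C] [FinitaryExtensive C]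
  [LocallyCartesianClosed C] [HasDependentWTypes C]

/-- Dependent W-types provide path objects: paths in `p, t : E ⟶ W` are the initial algebra of
`Z ↦ W ⨿ (E ×_W Z)`, the functor of the container `W ⟵ E ⟶ W ⨿ E ⟶ W`. -/
theorem nonempty {E W : C} (p t : E ⟶ W) : Nonempty (Paths p t) := by
  let f : E ⟶ W ⨿ E := coprod.inr
  let D : DepContainer C W W := ⟨E, W ⨿ E, t, f, coprod.desc (𝟙 W) p⟩
  obtain ⟨⟨⟨Q, str⟩, hI⟩⟩ : Nonempty (Σ A : Endofunctor.Algebra D.functor, IsInitial A) := by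
    have := HasDependentWTypes.hasInitial W D
    exact ⟨_, initialIsInitial⟩
  have : Mono f := inferInstanceAs (Mono coprod.inr)
  let P : Over W ⥤ Over (W ⨿ E) := piPullback f t
  let d : ∀ X : Over W, DepProd f t X (P.obj X) := DepProd.ofAdj (piPullbackAdj f t)
  let st : (P.obj Q).left ⟶ Q.left := str.left
  have hstr : st ≫ Q.hom = (P.obj Q).hom ≫ coprod.desc (𝟙 W) p := Over.w str
  let root' : W ⟶ (P.obj Q).left := (d Q).lam coprod.inl
    ((isInitialOfDisjoint (pullback.fst _ _) (pullback.snd _ _) pullback.condition).to _)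
    ((isInitialOfDisjoint (pullback.fst _ _) (pullback.snd _ _) pullback.condition).hom_ext _ _)
  have hroot' : root' ≫ (P.obj Q).hom = coprod.inl := (d Q).lam_hom _ _ _
  have hc : pullback.fst (pullback.fst t Q.hom ≫ f) f ≫ pullback.fst t Q.hom =
      pullback.snd (pullback.fst t Q.hom ≫ f) f := by
    rw [← cancel_mono f, Category.assoc, pullback.condition]
  let cons' : pullback t Q.hom ⟶ (P.obj Q).left := (d Q).lam (pullback.fst t Q.hom ≫ f)
    (pullback.fst _ _ ≫ pullback.snd t Q.hom) (by
      rw [Category.assoc, ← pullback.condition, ← hc, Category.assoc])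
  have hcons' : cons' ≫ (P.obj Q).hom = pullback.fst t Q.hom ≫ f := (d Q).lam_hom _ _ _
  -- an algebra consists of a section and an action of the edges
  have alg : ∀ {Z : C} (z : Z ⟶ W) (r : W ⟶ Z) (c : pullback t z ⟶ Z) (_ : r ≫ z = 𝟙 W)
      (_ : c ≫ z = pullback.fst _ _ ≫ p), ∃ a : D.functor.obj (Over.mk z) ⟶ Over.mk z,
      (∀ {Y : C} (y : Y ⟶ (P.obj (Over.mk z)).left) (w : Y ⟶ W)
        (_ : y ≫ (P.obj (Over.mk z)).hom = w ≫ coprod.inl), y ≫ a.left = w ≫ r) ∧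
      ∀ {Y : C} (y : Y ⟶ (P.obj (Over.mk z)).left) (e : Y ⟶ E)
        (h : y ≫ (P.obj (Over.mk z)).hom = e ≫ f),
        y ≫ a.left = pullback.lift e ((d (Over.mk z)).app y e h)
          ((d (Over.mk z)).app_hom _ _ _).symm ≫ c := by
    intro Z z r c hr hc
    obtain ⟨k, hk₁, hk₂⟩ := exists_cases (P.obj (Over.mk z)).hom (pullback.snd _ _ ≫ r)
      (pullback.lift (pullback.snd _ _)
        ((d (Over.mk z)).app (pullback.fst _ _) (pullback.snd _ _) pullback.condition)
        ((d (Over.mk z)).app_hom _ _ _).symm ≫ c)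
    refine ⟨Over.homMk k ?_, fun y w h => ?_, fun y e h => ?_⟩
    · change k ≫ z = (P.obj (Over.mk z)).hom ≫ coprod.desc (𝟙 W) p
      refine cases_ext (P.obj (Over.mk z)).hom (fun y a h => ?_) (fun y e h => ?_)
      · rw [reassoc_of% (hk₁ y a h), reassoc_of% h, hr]
        simp
      · rw [reassoc_of% (hk₂ y e h), reassoc_of% h, hc]
        simp
    · exact (hk₁ y w h).trans (by simp)
    · refine (hk₂ y e h).trans ?_
      rw [← Category.assoc]
      congr 1
      ext
      · simp
      · simp only [Category.assoc, pullback.lift_snd]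
        refine ((d (Over.mk z)).comp_app _ _ _ _).trans ?_
        exact (d (Over.mk z)).app_congr (by simp) (by simp) _
  have fold : ∀ {Z : C} (z : Z ⟶ W) (r : W ⟶ Z) (c : pullback t z ⟶ Z)
      (a : D.functor.obj (Over.mk z) ⟶ Over.mk z)
      (_ : ∀ {Y : C} (y : Y ⟶ (P.obj (Over.mk z)).left) (w : Y ⟶ W)
        (_ : y ≫ (P.obj (Over.mk z)).hom = w ≫ coprod.inl), y ≫ a.left = w ≫ r)
      (_ : ∀ {Y : C} (y : Y ⟶ (P.obj (Over.mk z)).left) (e : Y ⟶ E)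
        (h : y ≫ (P.obj (Over.mk z)).hom = e ≫ f),
        y ≫ a.left = pullback.lift e ((d (Over.mk z)).app y e h)
          ((d (Over.mk z)).app_hom _ _ _).symm ≫ c) (k : Q.left ⟶ Z) (hk : k ≫ z = Q.hom),
      st ≫ k = (P.map (Over.homMk k hk : Q ⟶ Over.mk z)).left ≫ a.left ↔
        (root' ≫ st) ≫ k = r ∧
        (cons' ≫ st) ≫ k = pullback.lift (pullback.fst _ _) (pullback.snd _ _ ≫ k)
          (by rw [Category.assoc, hk]; exact pullback.condition) ≫ c := by
    intro Z z r c a ha₁ ha₂ k hk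
    let k' : Q ⟶ Over.mk z := Over.homMk k hk
    have hPk : (P.map k').left ≫ (P.obj (Over.mk z)).hom = (P.obj Q).hom := Over.w (P.map k')
    have hcons : (cons' ≫ (P.map k').left) ≫ a.left = pullback.lift (pullback.fst _ _)
          (pullback.snd _ _ ≫ k)
          (by rw [Category.assoc, hk]; exact pullback.condition) ≫ c := by
      rw [ha₂ _ (pullback.fst _ _) (by rw [Category.assoc, hPk, hcons'])]
      congr 1
      ext
      · simp
      · simp only [pullback.lift_snd]
        refine (DepProd.ofAdj_map _ _ _ _ _).trans ?_
        refine Eq.trans ?_ (pullback.lift_snd _ _ _).symm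
        refine congrArg (fun g : _ ⟶ Q.left => g ≫ k) ?_
        refine ((d Q).app_congr (Category.id_comp _).symm rfl _).trans
          (((d Q).app_lam (𝟙 _) _ _ _ _ ?_).trans ?_)
        · rw [Category.id_comp]
          exact hcons'
        · simp
    have hroot : (root' ≫ (P.map k').left) ≫ a.left = r := by
      rw [ha₁ _ (𝟙 W) (by rw [Category.assoc, hPk, hroot', Category.id_comp]), Category.id_comp]
    constructor
    · intro h
      constructor
      · rw [Category.assoc, h]
        exact (Category.assoc _ _ _).symm.trans hroot
      · refine (Category.assoc _ _ _).trans ((congrArg (cons' ≫ ·) h).trans ?_)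
        exact (Category.assoc _ _ _).symm.trans hcons
    · rintro ⟨h₁, h₂⟩
      refine cases_ext (P.obj Q).hom (fun y w h => ?_) (fun y e h => ?_)
      · have hy : y = w ≫ root' := by
          refine (d Q).hom_ext (by rw [Category.assoc, hroot', h]) ?_
          intro Y' w' α hx _
          refine (isInitialOfDisjoint (w' ≫ w) α ?_).hom_ext _ _
          exact (Category.assoc _ _ _).trans ((congrArg (w' ≫ ·) h.symm).trans
            ((Category.assoc _ _ _).symm.trans hx))
        rw [hy]
        simp only [Category.assoc] at h₁
        exact (Category.assoc _ _ _).trans ((congrArg (w ≫ ·) (h₁.trans (hroot.symm.trans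
          (Category.assoc _ _ _)))).trans (Category.assoc _ _ _).symm)
      · have hy : y = pullback.lift e ((d Q).app y e h) ((d Q).app_hom _ _ _).symm ≫ cons' := by
          refine (d Q).hom_ext (by rw [Category.assoc, hcons', h]; simp [f]) ?_
          intro Y' w' α hx hy
          have hα : w' ≫ e = α := by
            rw [← cancel_mono f, ← hx, Category.assoc, Category.assoc, h]
          refine Eq.trans ?_ (((d Q).app_congr (Category.assoc _ _ _).symm rfl hy).trans
            ((d Q).app_lam _ _ _ _ _ _)).symm
          simp only [pullback.lift_fst_assoc, Category.assoc, pullback.lift_snd]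
          exact (((d Q).comp_app _ _ _ _).trans ((d Q).app_congr rfl hα _)).symm
        rw [hy]
        exact (Category.assoc _ _ _).trans ((congrArg (pullback.lift e _ _ ≫ ·)
          ((Category.assoc _ _ _).symm.trans (h₂.trans (hcons.symm.trans
          (Category.assoc _ _ _))))).trans (Category.assoc _ _ _).symm)
  exact ⟨{
    Q := Q
    root := root' ≫ st
    root_hom := by
      rw [Category.assoc, hstr, ← Category.assoc, hroot']
      simp
    cons := cons' ≫ st
    cons_hom := by
      rw [Category.assoc, hstr, ← Category.assoc, hcons']
      simp [f]
    exists_fold := by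
      intro Z z r c hr hc
      obtain ⟨a, ha₁, ha₂⟩ := alg z r c hr hc
      let k := hI.to ⟨Over.mk z, a⟩
      obtain ⟨h₁, h₂⟩ := (fold z r c a ha₁ ha₂ k.f.left (Over.w k.f)).mp
        (congrArg Over.Hom.left k.h.symm)
      exact ⟨k.f.left, Over.w k.f, h₁, h₂⟩
    fold_unique := by
      intro Z z r c hr hc k k' hk hk' h₁ h₁' h₂ h₂'
      obtain ⟨a, ha₁, ha₂⟩ := alg z r c hr hc
      have e := (fold z r c a ha₁ ha₂ k hk).mpr ⟨h₁, h₂⟩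
      have e' := (fold z r c a ha₁ ha₂ k' hk').mpr ⟨h₁', h₂'⟩
      let m : (⟨Q, str⟩ : Endofunctor.Algebra D.functor) ⟶ ⟨Over.mk z, a⟩ :=
        ⟨Over.homMk k hk, Over.OverMorphism.ext e.symm⟩
      let m' : (⟨Q, str⟩ : Endofunctor.Algebra D.functor) ⟶ ⟨Over.mk z, a⟩ :=
        ⟨Over.homMk k' hk', Over.OverMorphism.ext e'.symm⟩
      have : m = m' := hI.hom_ext m m'
      exact congrArg (fun g => Over.Hom.left (Endofunctor.Algebra.Hom.f g)) this }⟩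

end Paths

/-! ### Initial algebras and terminal coalgebras -/

/-- `(X, a)` is an initial algebra of the endofunctor `H`. -/
def IsInitAlg {D : Type u₁} [Category.{v₁} D] (H : D ⥤ D) (X : D) (a : H.obj X ⟶ X) : Prop :=
  ∀ (Y : D) (b : H.obj Y ⟶ Y), ∃! f : X ⟶ Y, a ≫ f = H.map f ≫ b

/-- `(X, c)` is a terminal coalgebra of the endofunctor `H`. -/
def IsTermCoalg {D : Type u₁} [Category.{v₁} D] (H : D ⥤ D) (X : D) (c : X ⟶ H.obj X) : Prop :=
  ∀ (Y : D) (b : Y ⟶ H.obj Y), ∃! f : Y ⟶ X, f ≫ c = b ≫ H.map f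

/-! ### Fixed points of polynomial functors with a parameter -/

section Step

variable {C : Type u} [Category.{v} C] [HasPullbacks C] [LocallyCartesianClosed C]

/-- The binary product in a slice category. -/
@[simps]
def sliceProd (S : C) : Over S × Over S ⥤ Over S where
  obj p := Over.mk (pullback.fst p.1.hom p.2.hom ≫ p.1.hom)
  map f := Over.homMk (pullback.map _ _ _ _ f.1.left f.2.left (𝟙 _) (by simp) (by simp))

variable {S U B : C}

/-- The functor `(N, Y) ↦ Σ_u (N ×_S Π_h t^* Y)`. -/
def step (u : S ⟶ U) (h : B ⟶ S) (t : B ⟶ U) : Over S × Over U ⥤ Over U :=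
  (𝟭 _).prod (piPullback h t) ⋙ sliceProd S ⋙ Over.map u

variable (u : S ⟶ U) (h : B ⟶ S) (t : B ⟶ U)

/-- The `N`-component. -/
def stepFst (N : Over S) (Y : Over U) : ((step u h t).obj (N, Y)).left ⟶ N.left :=
  pullback.fst _ _

/-- The `Y`-component. -/
def stepSnd (N : Over S) (Y : Over U) :
    ((step u h t).obj (N, Y)).left ⟶ ((piPullback h t).obj Y).left :=
  pullback.snd _ _

/-- Pairing. -/
def stepMk {N : Over S} {Y : Over U} {Z : C} (n : Z ⟶ N.left)
    (y : Z ⟶ ((piPullback h t).obj Y).left) (w : n ≫ N.hom = y ≫ ((piPullback h t).obj Y).hom) :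
    Z ⟶ ((step u h t).obj (N, Y)).left :=
  pullback.lift n y w

variable {u h t}

@[simp]
theorem stepMk_fst {N : Over S} {Y : Over U} {Z : C} (n : Z ⟶ N.left)
    (y : Z ⟶ ((piPullback h t).obj Y).left) (w : n ≫ N.hom = y ≫ ((piPullback h t).obj Y).hom) :
    stepMk u h t n y w ≫ stepFst u h t N Y = n :=
  pullback.lift_fst _ _ _

@[simp]
theorem stepMk_snd {N : Over S} {Y : Over U} {Z : C} (n : Z ⟶ N.left)
    (y : Z ⟶ ((piPullback h t).obj Y).left) (w : n ≫ N.hom = y ≫ ((piPullback h t).obj Y).hom) :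
    stepMk u h t n y w ≫ stepSnd u h t N Y = y :=
  pullback.lift_snd _ _ _

theorem step_condition (N : Over S) (Y : Over U) :
    stepFst u h t N Y ≫ N.hom = stepSnd u h t N Y ≫ ((piPullback h t).obj Y).hom :=
  pullback.condition

theorem step_hom (N : Over S) (Y : Over U) :
    ((step u h t).obj (N, Y)).hom = (stepFst u h t N Y ≫ N.hom) ≫ u :=
  rfl

theorem step_hom_ext {N : Over S} {Y : Over U} {Z : C}
    {x y : Z ⟶ ((step u h t).obj (N, Y)).left}
    (h₁ : x ≫ stepFst u h t N Y = y ≫ stepFst u h t N Y)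
    (h₂ : x ≫ stepSnd u h t N Y = y ≫ stepSnd u h t N Y) : x = y :=
  pullback.hom_ext h₁ h₂

@[simp]
theorem step_map_fst {N N' : Over S} {Y Y' : Over U} (f : N ⟶ N') (g : Y ⟶ Y') :
    ((step u h t).map ((f, g) : (N, Y) ⟶ (N', Y'))).left ≫ stepFst u h t N' Y' =
      stepFst u h t N Y ≫ f.left :=
  pullback.lift_fst _ _ _

@[simp]
theorem step_map_snd {N N' : Over S} {Y Y' : Over U} (f : N ⟶ N') (g : Y ⟶ Y') :
    ((step u h t).map ((f, g) : (N, Y) ⟶ (N', Y'))).left ≫ stepSnd u h t N' Y' =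
      stepSnd u h t N Y ≫ ((piPullback h t).map g).left :=
  pullback.lift_snd _ _ _

variable (h t) in
/-- The values of `y : Z ⟶ Π_h t^* Y`, as a map over `t`. -/
def children {Y : Over U} {Z : C} (y : Z ⟶ ((piPullback h t).obj Y).left) :
    pullback (y ≫ ((piPullback h t).obj Y).hom) h ⟶ Y.left :=
  (DepProd.ofAdj (piPullbackAdj h t) Y).app (pullback.fst _ _ ≫ y) (pullback.snd _ _)
    (by rw [Category.assoc, pullback.condition])

end Step

/-! ### Trees and decorated trees -/

section Trees

variable {C : Type u} [Category.{v} C] [HasFiniteLimits C] [LocallyCartesianClosed C]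
  {S U B : C}

/-- A coalgebra `(W, w)` of `Σ_u Π_h t^*`, thought of as an object of trees with nodes labelled in
`S`, together with the paths from the root of a tree to its nodes and the map `lab` which sends a
path to the label of the node it leads to. -/
structure Trees (u : S ⟶ U) (h : B ⟶ S) (t : B ⟶ U) where
  W : Over U
  w : W.left ⟶ ((piPullback h t).obj W).left
  w_hom : (w ≫ ((piPullback h t).obj W).hom) ≫ u = W.hom
  paths : Paths (pullback.fst (w ≫ ((piPullback h t).obj W).hom) h) (children h t w)
  lab : paths.Q.left ⟶ S
  root_lab : paths.root ≫ lab = w ≫ ((piPullback h t).obj W).hom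
  cons_lab : ∀ {Z : C} (e : Z ⟶ pullback (w ≫ ((piPullback h t).obj W).hom) h)
    (q : Z ⟶ paths.Q.left) (hq : e ≫ children h t w = q ≫ paths.Q.hom),
    paths.consAt e q hq ≫ lab = q ≫ lab

/-- Every coalgebra `(W, w)` of `Σ_u Π_h t^*` underlies some `Trees`: the label at the end of a path
is the iteration of the map to the label of the root. -/
theorem Trees.exists [FinitaryExtensive C] [HasDependentWTypes C] {u : S ⟶ U} {h : B ⟶ S}
    {t : B ⟶ U} (W : Over U) (w : W.left ⟶ ((piPullback h t).obj W).left)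
    (hw : (w ≫ ((piPullback h t).obj W).hom) ≫ u = W.hom) :
    ∃ τ : Trees u h t, τ.W = W ∧ HEq τ.w w := by
  obtain ⟨𝒬⟩ := Paths.nonempty (pullback.fst (w ≫ ((piPullback h t).obj W).hom) h)
    (children h t w)
  -- iteration in `W` itself, where an edge moves a tree to the corresponding subtree
  have hp : IsPullback (𝟙 _) (pullback.fst (w ≫ ((piPullback h t).obj W).hom) h)
    (pullback.fst (w ≫ ((piPullback h t).obj W).hom) h) (𝟙 _) := IsPullback.of_horiz_isIso ⟨by simp⟩
  obtain ⟨κ, hκ, -⟩ := 𝒬.existsUnique_iter hp (ch := children h t w) (by simp)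
    (w ≫ ((piPullback h t).obj W).hom)
  refine ⟨⟨W, w, hw, 𝒬, pullback.lift 𝒬.Q.hom (𝟙 _) (by simp) ≫ κ, ?_, ?_⟩, rfl, HEq.rfl⟩
  · have := hκ.root (𝟙 _) 𝒬.root (by simp [𝒬.root_hom]) (by simp)
    refine Eq.trans ?_ (this.trans (Category.id_comp _))
    refine (Category.assoc _ _ _).symm.trans (congrArg (· ≫ κ) ?_)
    ext <;> simp [𝒬.root_hom]
  · intro Z e q hq
    have := hκ.cons e q (by simpa using hq)
    refine Eq.trans ?_ (this.trans ?_)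
    · refine (Category.assoc _ _ _).symm.trans (congrArg (· ≫ κ) ?_)
      ext <;> simp
    · refine Eq.trans (congrArg (· ≫ κ) ?_) (Category.assoc _ _ _)
      ext <;> simp [hq]

namespace Trees

variable {u : S ⟶ U} {h : B ⟶ S} {t : B ⟶ U} (τ : Trees u h t)

/-- The label of the root. -/
abbrev label : τ.W.left ⟶ S := τ.w ≫ ((piPullback h t).obj τ.W).hom

/-- The functor `Π_Q lab^*`. Over a given tree, `decFibre N` consists of the choices, for each node of
the tree, of an element of `N` over the label of the node. -/
abbrev decFibre : Over S ⥤ Over τ.W.left := piPullback τ.paths.Q.hom τ.lab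

/-- The polynomial functor which sends `N` to the object `Σ_W Π_Q lab^* N` of trees together with
a choice, for each node, of an element of `N` over its label. -/
abbrev dec : Over S ⥤ Over U := τ.decFibre ⋙ Over.map τ.W.hom

/-- Decorations of a tree as dependent functions on its paths. -/
def decProd (N : Over S) : DepProd τ.paths.Q.hom τ.lab N (τ.decFibre.obj N) :=
  DepProd.ofAdj (piPullbackAdj _ _) N

/-- The tree underlying a decorated tree. -/
abbrev decTree (N : Over S) : (τ.dec.obj N).left ⟶ τ.W.left := (τ.decFibre.obj N).hom

/-- The decoration of the root. -/
def decRoot (N : Over S) : (τ.dec.obj N).left ⟶ N.left :=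
  (τ.decProd N).app (𝟙 _) (τ.decTree N ≫ τ.paths.root) (by
    rw [Category.assoc, τ.paths.root_hom, Category.comp_id]
    exact Category.id_comp _)

theorem decRoot_hom (N : Over S) : τ.decRoot N ≫ N.hom = τ.decTree N ≫ τ.label := by
  refine ((τ.decProd N).app_hom _ _ _).trans ?_
  rw [Category.assoc, τ.root_lab]

/-- The edge of the underlying tree which leads to a child of a decorated tree. -/
def decEdge (N : Over S) : pullback (τ.decTree N ≫ τ.label) h ⟶ pullback τ.label h :=
  pullback.lift (pullback.fst _ _ ≫ τ.decTree N) (pullback.snd _ _)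
    (by rw [Category.assoc, pullback.condition])

theorem decEdge_fst (N : Over S) :
    τ.decEdge N ≫ pullback.fst _ _ = pullback.fst _ _ ≫ τ.decTree N :=
  pullback.lift_fst _ _ _

theorem decEdge_snd (N : Over S) : τ.decEdge N ≫ pullback.snd _ _ = pullback.snd _ _ :=
  pullback.lift_snd _ _ _

/-- The children of a decorated tree, as decorated trees. -/
def decChild (N : Over S) : pullback (τ.decTree N ≫ τ.label) h ⟶ (τ.dec.obj N).left :=
  (τ.decProd N).lam (τ.decEdge N ≫ children h t τ.w)
    ((τ.decProd N).app (pullback.fst _ _ ≫ pullback.fst _ _)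
      (τ.paths.consAt (pullback.fst _ _ ≫ τ.decEdge N) (pullback.snd _ _)
        (by rw [Category.assoc, pullback.condition]))
      (by
        rw [Paths.consAt_hom]
        refine (Category.assoc _ _ _).trans (Eq.trans ?_ (Category.assoc _ _ _).symm)
        exact congrArg _ (τ.decEdge_fst N).symm))
    (by rw [DepProd.app_hom, τ.cons_lab])

theorem decChild_tree (N : Over S) :
    τ.decChild N ≫ τ.decTree N = τ.decEdge N ≫ children h t τ.w :=
  (τ.decProd N).lam_hom _ _ _

/-- The decoration of a child at the path `q` is the decoration of the whole tree at the path which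
consists of the edge to the child followed by `q`. -/
theorem app_decChild (N : Over S) {Z : C} (z : Z ⟶ pullback (τ.decTree N ≫ τ.label) h)
    (q : Z ⟶ τ.paths.Q.left) (hq : (z ≫ τ.decChild N) ≫ τ.decTree N = q ≫ τ.paths.Q.hom) :
    (τ.decProd N).app (z ≫ τ.decChild N) q hq =
      (τ.decProd N).app (z ≫ pullback.fst _ _)
        (τ.paths.consAt (z ≫ τ.decEdge N) q (by
          rw [← hq, Category.assoc, Category.assoc, decChild_tree]))
        (by
          rw [Paths.consAt_hom]
          refine (Category.assoc _ _ _).trans (Eq.trans ?_ (Category.assoc _ _ _).symm)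
          exact congrArg _ (τ.decEdge_fst N).symm) := by
  refine ((τ.decProd N).app_lam _ _ _ _ _ _).trans (((τ.decProd N).comp_app _ _ _ _).trans ?_)
  refine (τ.decProd N).app_congr (by simp) ?_ _
  rw [Paths.comp_consAt]
  exact τ.paths.consAt_congr (by simp) (by simp) _

/-- The children of a decorated tree, as a family. -/
def decFamily (N : Over S) :
    (τ.dec.obj N).left ⟶ ((piPullback h t).obj (τ.dec.obj N)).left :=
  (DepProd.ofAdj (piPullbackAdj h t) (τ.dec.obj N)).lam (τ.decTree N ≫ τ.label) (τ.decChild N) (by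
    have h₁ : (τ.dec.obj N).hom = τ.decTree N ≫ τ.W.hom := rfl
    rw [h₁]
    refine (Category.assoc _ _ _).symm.trans ((congrArg (· ≫ τ.W.hom)
      (τ.decChild_tree N)).trans ((Category.assoc _ _ _).trans ?_))
    refine (congrArg (τ.decEdge N ≫ ·) (DepProd.app_hom _ _ _ _)).trans ?_
    exact (Category.assoc _ _ _).symm.trans (congrArg (· ≫ t) (τ.decEdge_snd N)))

theorem decFamily_hom (N : Over S) :
    τ.decFamily N ≫ ((piPullback h t).obj (τ.dec.obj N)).hom = τ.decTree N ≫ τ.label :=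
  (DepProd.ofAdj (piPullbackAdj h t) (τ.dec.obj N)).lam_hom _ _ _

/-- A decorated tree consists of the decoration of its root and the family of its children. -/
def decStr (N : Over S) : τ.dec.obj N ⟶ (step u h t).obj (N, τ.dec.obj N) :=
  Over.homMk (stepMk u h t (τ.decRoot N) (τ.decFamily N)
    ((τ.decRoot_hom N).trans (τ.decFamily_hom N).symm)) (by
      rw [step_hom, ← Category.assoc, ← Category.assoc, stepMk_fst, decRoot_hom, Category.assoc]
      exact congrArg (τ.decTree N ≫ ·) τ.w_hom)

theorem decStr_fst (N : Over S) : (τ.decStr N).left ≫ stepFst u h t _ _ = τ.decRoot N :=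
  stepMk_fst _ _ _

theorem decStr_snd (N : Over S) : (τ.decStr N).left ≫ stepSnd u h t _ _ = τ.decFamily N :=
  stepMk_snd _ _ _

end Trees

end Trees

namespace Trees

variable {C : Type u} [Category.{v} C] [HasFiniteLimits C] [LocallyCartesianClosed C]
  {S U B : C} {u : S ⟶ U} {h : B ⟶ S} {t : B ⟶ U} (τ : Trees u h t)

section Coalgebra

variable {V : Over U} (y : V.left ⟶ ((piPullback h t).obj V).left) (v : V ⟶ τ.W)

theorem label_eq (hv : v.left ≫ τ.w = y ≫ ((piPullback h t).map v).left) :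
    v.left ≫ τ.label = y ≫ ((piPullback h t).obj V).hom := by
  rw [← Category.assoc, hv, Category.assoc, Over.w]

/-- The edges of the trees below a coalgebra over trees. -/
def edge (hv : v.left ≫ τ.w = y ≫ ((piPullback h t).map v).left) :
    pullback (y ≫ ((piPullback h t).obj V).hom) h ⟶ pullback τ.label h :=
  pullback.lift (pullback.fst _ _ ≫ v.left) (pullback.snd _ _)
    (by rw [Category.assoc, τ.label_eq y v hv, pullback.condition])

theorem edge_fst (hv : v.left ≫ τ.w = y ≫ ((piPullback h t).map v).left) :
    τ.edge y v hv ≫ pullback.fst _ _ = pullback.fst _ _ ≫ v.left :=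
  pullback.lift_fst _ _ _

theorem edge_snd (hv : v.left ≫ τ.w = y ≫ ((piPullback h t).map v).left) :
    τ.edge y v hv ≫ pullback.snd _ _ = pullback.snd _ _ :=
  pullback.lift_snd _ _ _

theorem isPullback_edge (hv : v.left ≫ τ.w = y ≫ ((piPullback h t).map v).left) :
    IsPullback (τ.edge y v hv) (pullback.fst _ _) (pullback.fst τ.label h) v.left := by
  refine IsPullback.flip (IsPullback.of_bot (h₃₁ := h) (v₂₁ := pullback.snd _ _)
    (v₂₂ := τ.label) ?_ (τ.edge_fst y v hv).symm
      (IsPullback.of_hasPullback τ.label h))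
  rw [edge_snd, label_eq (hv := hv)]
  exact IsPullback.of_hasPullback _ h

theorem children_tree (hv : v.left ≫ τ.w = y ≫ ((piPullback h t).map v).left) :
    children h t y ≫ v.left = τ.edge y v hv ≫ children h t τ.w := by
  unfold children
  refine (DepProd.ofAdj_map (piPullbackAdj h t) v (pullback.fst _ _ ≫ y) (pullback.snd _ _)
    (by rw [Category.assoc, Category.assoc, Over.w, pullback.condition])).symm.trans ?_
  refine Eq.trans ?_ (DepProd.comp_app _ _ _ _ _).symm
  refine DepProd.app_congr _ ?_ (τ.edge_snd y v hv).symm _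
  rw [← Category.assoc, edge_fst, Category.assoc, Category.assoc, hv]

end Coalgebra

/-- Decorated trees are terminal among the coalgebras of `step u h t (N, -)` over trees. -/
theorem existsUnique_dec {N : Over S} {V : Over U} (γ : V ⟶ (step u h t).obj (N, V)) (v : V ⟶ τ.W)
    (hv : v.left ≫ τ.w = (γ.left ≫ stepSnd u h t N V) ≫ ((piPullback h t).map v).left) :
    ∃! k : V ⟶ τ.dec.obj N, k.left ≫ τ.decTree N = v.left ∧
      k ≫ τ.decStr N = γ ≫ (step u h t).map ((𝟙 N, k) : (N, V) ⟶ (N, τ.dec.obj N)) := by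
  obtain ⟨y, hy⟩ : ∃ y, y = γ.left ≫ stepSnd u h t N V := ⟨_, rfl⟩
  obtain ⟨n, hn⟩ : ∃ n, n = γ.left ≫ stepFst u h t N V := ⟨_, rfl⟩
  rw [← hy] at hv
  let dN := DepProd.ofAdj (piPullbackAdj h t) (τ.dec.obj N)
  have hnN : n ≫ N.hom = v.left ≫ τ.label := by
    rw [τ.label_eq y v hv, hn, hy, Category.assoc, Category.assoc, step_condition]
  -- a map into decorated trees is a coalgebra map iff its transpose is the iteration of `n`
  have key : ∀ (k : V.left ⟶ (τ.decFibre.obj N).left) (κ : pullback v.left τ.paths.Q.hom ⟶ N.left)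
      (hk : k ≫ τ.decTree N = v.left) (hk' : k ≫ τ.decTree N ≫ τ.W.hom = V.hom)
      (_ : ∀ {Z : C} (x : Z ⟶ V.left) (q : Z ⟶ τ.paths.Q.left)
        (hq : x ≫ v.left = q ≫ τ.paths.Q.hom), (τ.decProd N).app (x ≫ k) q
          (by rw [Category.assoc, hk, hq]) = pullback.lift x q hq ≫ κ),
      (Over.homMk k hk' : V ⟶ τ.dec.obj N) ≫ τ.decStr N = γ ≫ (step u h t).map
        ((𝟙 N, (Over.homMk k hk' : V ⟶ τ.dec.obj N)) : (N, V) ⟶ (N, τ.dec.obj N)) ↔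
      τ.paths.IsIter v.left (pullback.fst _ _) (τ.edge y v hv)
        (τ.isPullback_edge y v hv).w (children h t y) (τ.children_tree y v hv) n κ := by
    intro k κ hk hk' hκ
    set k' : V ⟶ τ.dec.obj N := Over.homMk k hk' with hk'_def
    have e₁ : ((k' ≫ τ.decStr N).left ≫ stepFst u h t _ _ =
        (γ ≫ (step u h t).map ((𝟙 N, k') : (N, V) ⟶ (N, τ.dec.obj N))).left ≫
          stepFst u h t _ _) ↔ k ≫ τ.decRoot N = n := by
      rw [Over.comp_left, Category.assoc, decStr_fst, Over.comp_left, Category.assoc, step_map_fst,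
        Over.id_left, Category.comp_id, ← hn]
      rfl
    have e₂ : ((k' ≫ τ.decStr N).left ≫ stepSnd u h t _ _ =
        (γ ≫ (step u h t).map ((𝟙 N, k') : (N, V) ⟶ (N, τ.dec.obj N))).left ≫
          stepSnd u h t _ _) ↔
        k ≫ τ.decFamily N = y ≫ ((piPullback h t).map k').left := by
      rw [Over.comp_left, Category.assoc, decStr_snd, Over.comp_left, Category.assoc, step_map_snd,
        ← Category.assoc γ.left, ← hy]
      rfl
    have root_eq : k ≫ τ.decRoot N = pullback.lift (𝟙 _) (v.left ≫ τ.paths.root) (by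
        rw [Category.assoc, τ.paths.root_hom]; simp) ≫ κ := by
      rw [← hκ]
      refine ((τ.decProd N).comp_app _ _ _ _).trans ((τ.decProd N).app_congr ?_ ?_ _)
      · rw [Category.id_comp]
        exact Category.comp_id _
      · rw [← Category.assoc, hk]
    have cons_eq : ∀ {Z : C} (e : Z ⟶ pullback (y ≫ ((piPullback h t).obj V).hom) h)
        (e' : Z ⟶ pullback (τ.decTree N ≫ τ.label) h)
        (_ : e' ≫ pullback.fst _ _ = (e ≫ pullback.fst _ _) ≫ k)
        (_ : e' ≫ pullback.snd _ _ = e ≫ pullback.snd _ _)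
        (q : Z ⟶ τ.paths.Q.left) (hq : (e ≫ τ.edge y v hv) ≫ children h t τ.w =
          q ≫ τ.paths.Q.hom) (hq' : (e' ≫ τ.decChild N) ≫ τ.decTree N = q ≫ τ.paths.Q.hom),
        (τ.decProd N).app (e' ≫ τ.decChild N) q hq' =
        pullback.lift (e ≫ pullback.fst _ _) (τ.paths.consAt (e ≫ τ.edge y v hv) q hq)
          (by rw [Paths.consAt_hom, Category.assoc, Category.assoc, edge_fst]) ≫ κ := by
      intro Z e e' he₁ he₂ q hq hq'
      refine (τ.app_decChild N _ _ _).trans ?_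
      rw [← hκ]
      refine (τ.decProd N).app_congr he₁ (τ.paths.consAt_congr ?_ rfl _) _
      apply pullback.hom_ext
      · rw [Category.assoc, decEdge_fst, ← Category.assoc, he₁, Category.assoc, hk, Category.assoc,
          Category.assoc, edge_fst]
      · rw [Category.assoc, decEdge_snd, he₂, Category.assoc, edge_snd]
    have base : (k ≫ τ.decFamily N) ≫ ((piPullback h t).obj (τ.dec.obj N)).hom =
        (y ≫ ((piPullback h t).map k').left) ≫ ((piPullback h t).obj (τ.dec.obj N)).hom := by
      rw [Category.assoc, decFamily_hom, ← Category.assoc, hk, τ.label_eq y v hv,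
        Category.assoc, Over.w]
    have fam : ∀ {Z : C} (x : Z ⟶ V.left) (b : Z ⟶ B)
        (hb : (x ≫ k ≫ τ.decFamily N) ≫ ((piPullback h t).obj (τ.dec.obj N)).hom = b ≫ h)
        (e' : Z ⟶ pullback (τ.decTree N ≫ τ.label) h)
        (_ : e' ≫ pullback.fst _ _ = x ≫ k) (_ : e' ≫ pullback.snd _ _ = b),
        dN.app (x ≫ k ≫ τ.decFamily N) b hb = e' ≫ τ.decChild N := by
      intro Z x b hb e' he₁ he₂
      refine (dN.app_congr (Category.assoc _ _ _).symm rfl _).trans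
        ((dN.app_lam _ _ _ _ _ _).trans ?_)
      refine congrArg (· ≫ τ.decChild N) ?_
      apply pullback.hom_ext
      · rw [pullback.lift_fst, he₁]
      · rw [pullback.lift_snd, he₂]
    have fam' : ∀ {Z : C} (x : Z ⟶ V.left) (b : Z ⟶ B)
        (hb : (x ≫ y ≫ ((piPullback h t).map k').left) ≫
          ((piPullback h t).obj (τ.dec.obj N)).hom = b ≫ h)
        (e : Z ⟶ pullback (y ≫ ((piPullback h t).obj V).hom) h)
        (_ : e ≫ pullback.fst _ _ = x) (_ : e ≫ pullback.snd _ _ = b),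
        dN.app (x ≫ y ≫ ((piPullback h t).map k').left) b hb = (e ≫ children h t y) ≫ k := by
      intro Z x b hb e he₁ he₂
      subst he₁ he₂
      refine (dN.app_congr (Category.assoc _ _ _).symm rfl _).trans
        ((DepProd.ofAdj_map _ _ _ _ _).trans (congrArg (· ≫ k) ?_))
      exact ((DepProd.comp_app _ _ _ _ _).trans
        (DepProd.app_congr _ (Category.assoc _ _ _).symm rfl _)).symm
    constructor
    · intro hh
      have h₁ := e₁.mp (congrArg (fun f => Over.Hom.left f ≫ stepFst u h t _ _) hh)
      have h₂ := e₂.mp (congrArg (fun f => Over.Hom.left f ≫ stepSnd u h t _ _) hh)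
      refine ⟨?_, ?_⟩
      · intro Z x q hq hq'
        subst hq'
        rw [← h₁, root_eq]
        refine Eq.trans (congrArg (· ≫ κ) ?_) (Category.assoc _ _ _)
        apply pullback.hom_ext <;> simp
      · intro Z e q hq
        let e' : Z ⟶ pullback (τ.decTree N ≫ τ.label) h :=
          pullback.lift ((e ≫ pullback.fst _ _) ≫ k) (e ≫ pullback.snd _ _) (by
            rw [Category.assoc, ← Category.assoc k, hk, τ.label_eq y v hv, Category.assoc,
              pullback.condition, Category.assoc])
        have he₁ : e' ≫ pullback.fst _ _ = (e ≫ pullback.fst _ _) ≫ k := pullback.lift_fst _ _ _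
        have he₂ : e' ≫ pullback.snd _ _ = e ≫ pullback.snd _ _ := pullback.lift_snd _ _ _
        have hb : ((e ≫ pullback.fst _ _) ≫ k ≫ τ.decFamily N) ≫
            ((piPullback h t).obj (τ.dec.obj N)).hom = (e ≫ pullback.snd _ _) ≫ h := by
          rw [Category.assoc, base, Category.assoc y, Over.w, Category.assoc, pullback.condition,
            Category.assoc]
        have hc : e' ≫ τ.decChild N = (e ≫ children h t y) ≫ k := by
          rw [← fam _ _ hb e' he₁ he₂, ← fam' (e ≫ pullback.fst _ _) (e ≫ pullback.snd _ _)
            (by rw [← h₂]; exact hb) e rfl rfl]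
          exact dN.app_congr (by rw [h₂]) rfl _
        rw [← cons_eq e e' he₁ he₂ q hq (by
          rw [hc, Category.assoc, hk, Category.assoc, τ.children_tree y v hv, ← hq,
            Category.assoc])]
        rw [← hκ]
        exact (τ.decProd N).app_congr hc rfl _
    · intro hi
      have h₁ : k ≫ τ.decRoot N = n := by
        rw [root_eq, hi.root _ _ _ (Category.id_comp _).symm, Category.id_comp]
      have h₂ : k ≫ τ.decFamily N = y ≫ ((piPullback h t).map k').left := by
        refine dN.hom_ext base ?_
        intro Z x b hx hy
        have hb : x ≫ y ≫ ((piPullback h t).obj V).hom = b ≫ h := by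
          rw [← hy, Category.assoc, Category.assoc, Over.w]
        let e : Z ⟶ pullback (y ≫ ((piPullback h t).obj V).hom) h := pullback.lift x b hb
        let e' : Z ⟶ pullback (τ.decTree N ≫ τ.label) h := pullback.lift (x ≫ k) b (by
          rw [Category.assoc, ← Category.assoc k, hk, τ.label_eq y v hv, hb])
        have he₁ : e ≫ pullback.fst _ _ = x := pullback.lift_fst _ _ _
        have he₂ : e ≫ pullback.snd _ _ = b := pullback.lift_snd _ _ _
        have he₁' : e' ≫ pullback.fst _ _ = x ≫ k := pullback.lift_fst _ _ _
        have he₂' : e' ≫ pullback.snd _ _ = b := pullback.lift_snd _ _ _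
        have hee : e' ≫ τ.decEdge N = e ≫ τ.edge y v hv := by
          apply pullback.hom_ext
          · rw [Category.assoc, decEdge_fst, ← Category.assoc, he₁', Category.assoc, hk,
              Category.assoc, edge_fst, ← Category.assoc, he₁]
          · rw [Category.assoc, decEdge_snd, he₂', Category.assoc, edge_snd, he₂]
        rw [fam x b hx e' he₁' he₂', fam' x b hy e he₁ he₂]
        have hbase : (e' ≫ τ.decChild N) ≫ τ.decTree N = ((e ≫ children h t y) ≫ k) ≫
            τ.decTree N := by
          rw [Category.assoc, decChild_tree, ← Category.assoc, hee, Category.assoc, Category.assoc,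
            hk, Category.assoc, τ.children_tree y v hv]
        refine (τ.decProd N).hom_ext hbase ?_
        intro Y w q hq hq'
        have hwq : ((w ≫ e) ≫ τ.edge y v hv) ≫ children h t τ.w = q ≫ τ.paths.Q.hom := by
          rw [← hq, Category.assoc w (e' ≫ _), Category.assoc e', decChild_tree, ← Category.assoc e',
            hee, Category.assoc, Category.assoc, Category.assoc]
        refine ((τ.decProd N).app_congr (Category.assoc _ _ _).symm rfl hq).trans
          ((cons_eq (w ≫ e) (w ≫ e') ?_ ?_ q hwq ?_).trans ((hi.cons (w ≫ e) q hwq).trans ?_))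
        · rw [Category.assoc, he₁', Category.assoc w e, he₁]
          exact (Category.assoc _ _ _).symm
        · rw [Category.assoc, he₂', Category.assoc, he₂]
        · rw [← hq, Category.assoc w]
        · rw [← hκ]
          exact (τ.decProd N).app_congr (by simp only [Category.assoc]) rfl _
      ext
      exact step_hom_ext (e₁.mpr h₁) (e₂.mpr h₂)
  obtain ⟨κ, hκ, huniq⟩ := τ.paths.existsUnique_iter (τ.isPullback_edge y v hv)
    (τ.children_tree y v hv) n
  -- the iteration lies over the labels, since labels are an iteration too
  have hκN : κ ≫ N.hom = pullback.snd _ _ ≫ τ.lab := by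
    refine (τ.paths.existsUnique_iter (τ.isPullback_edge y v hv) (τ.children_tree y v hv)
      (n ≫ N.hom)).unique (hκ.comp N.hom) ⟨?_, ?_⟩
    · intro Z x q hq hq'
      subst hq'
      rw [pullback.lift_snd_assoc, Category.assoc, Category.assoc, τ.root_lab, hnN]
    · intro Z e q hq
      rw [pullback.lift_snd_assoc, pullback.lift_snd_assoc, τ.cons_lab]
  let k : V.left ⟶ (τ.decFibre.obj N).left := (τ.decProd N).lam v.left κ hκN
  have hk : k ≫ τ.decTree N = v.left := (τ.decProd N).lam_hom _ _ _
  have hk' : k ≫ τ.decTree N ≫ τ.W.hom = V.hom := by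
    rw [← Category.assoc, hk, Over.w]
  refine ⟨Over.homMk k hk', ⟨hk, (key k κ hk hk' ?_).mpr hκ⟩, ?_⟩
  · intro Z x q hq
    exact (τ.decProd N).app_lam _ _ _ _ _ _
  · rintro f ⟨hf, hf'⟩
    let f' : V.left ⟶ (τ.decFibre.obj N).left := f.left
    have hf₀ : f' ≫ τ.decTree N = v.left := hf
    let κ' : pullback v.left τ.paths.Q.hom ⟶ N.left :=
      (τ.decProd N).app (pullback.fst _ _ ≫ f') (pullback.snd _ _) (by
        rw [Category.assoc, hf₀, pullback.condition])
    have hκ' : ∀ {Z : C} (x : Z ⟶ V.left) (q : Z ⟶ τ.paths.Q.left)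
        (hq : x ≫ v.left = q ≫ τ.paths.Q.hom), (τ.decProd N).app (x ≫ f') q
          (by rw [Category.assoc, hf₀, hq]) = pullback.lift x q hq ≫ κ' := by
      intro Z x q hq
      refine Eq.trans ?_ ((τ.decProd N).comp_app _ _ _ _).symm
      exact (τ.decProd N).app_congr (by simp) (by simp) _
    have := huniq κ' ((key f' κ' hf₀ (Over.w f) hκ').mp hf')
    ext
    refine (τ.decProd N).hom_ext (hf₀.trans hk.symm) ?_
    intro Y x q hx hy
    refine (hκ' x q (by rw [← hx, Category.assoc, hf₀])).trans ?_
    rw [this]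
    exact ((τ.decProd N).app_lam _ _ _ _ _ _).symm

end Trees

/-! ### Decorated trees as a functor and as a fixed point of `step` -/

section

variable {C : Type u} [Category.{v} C] [HasPullbacks C] [LocallyCartesianClosed C]
  {S U B : C} {h : B ⟶ S} {t : B ⟶ U}

theorem app_eq_children {Y : Over U} {Z Z' : C} (x : Z' ⟶ Z)
    (y : Z ⟶ ((piPullback h t).obj Y).left) (b : Z' ⟶ B)
    (hb : (x ≫ y) ≫ ((piPullback h t).obj Y).hom = b ≫ h)
    (e : Z' ⟶ pullback (y ≫ ((piPullback h t).obj Y).hom) h)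
    (he₁ : e ≫ pullback.fst _ _ = x) (he₂ : e ≫ pullback.snd _ _ = b) :
    (DepProd.ofAdj (piPullbackAdj h t) Y).app (x ≫ y) b hb = e ≫ children h t y := by
  subst he₁ he₂
  exact ((DepProd.comp_app _ _ _ _ _).trans
    (DepProd.app_congr _ (Category.assoc _ _ _).symm rfl _)).symm

end

namespace Trees

variable {C : Type u} [Category.{v} C] [HasFiniteLimits C] [LocallyCartesianClosed C]
  {S U B : C} {u : S ⟶ U} {h : B ⟶ S} {t : B ⟶ U} (τ : Trees u h t)

theorem app_decFamily (N : Over S) {Z : C} (x : Z ⟶ (τ.dec.obj N).left) (b : Z ⟶ B)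
    (hb : (x ≫ τ.decFamily N) ≫ ((piPullback h t).obj (τ.dec.obj N)).hom = b ≫ h)
    (e : Z ⟶ pullback (τ.decTree N ≫ τ.label) h)
    (he₁ : e ≫ pullback.fst _ _ = x) (he₂ : e ≫ pullback.snd _ _ = b) :
    (DepProd.ofAdj (piPullbackAdj h t) (τ.dec.obj N)).app (x ≫ τ.decFamily N) b hb =
      e ≫ τ.decChild N := by
  subst he₁ he₂
  refine (DepProd.app_lam _ _ _ _ _ _ _).trans ?_
  refine congrArg (· ≫ τ.decChild N) ?_
  apply pullback.hom_ext <;> simp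

/-- The tree underlying a decorated tree, as a morphism over `U`. -/
def decTreeHom (N : Over S) : τ.dec.obj N ⟶ τ.W := Over.homMk (τ.decTree N) rfl

theorem decFamily_map_decTree (N : Over S) :
    τ.decFamily N ≫ ((piPullback h t).map (τ.decTreeHom N)).left = τ.decTree N ≫ τ.w := by
  refine (DepProd.ofAdj (piPullbackAdj h t) τ.W).hom_ext ?_ ?_
  · rw [Category.assoc, Over.w, decFamily_hom, Category.assoc]
  · intro Z x b hx hy
    have hb : x ≫ τ.decTree N ≫ τ.label = b ≫ h := by
      rw [← hy]; simp only [Category.assoc]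
    let e : Z ⟶ pullback (τ.decTree N ≫ τ.label) h := pullback.lift x b hb
    have he₁ : e ≫ pullback.fst _ _ = x := pullback.lift_fst _ _ _
    have he₂ : e ≫ pullback.snd _ _ = b := pullback.lift_snd _ _ _
    refine (DepProd.app_congr _ (Category.assoc _ _ _).symm rfl hx).trans
      ((DepProd.ofAdj_map _ _ _ _ _).trans ?_)
    refine (congrArg (· ≫ τ.decTree N) (τ.app_decFamily N x b _ e he₁ he₂)).trans ?_
    refine Eq.trans ?_ ((DepProd.app_congr _ (Category.assoc _ _ _).symm rfl hy).trans
      (app_eq_children (x ≫ τ.decTree N) τ.w b _ (e ≫ τ.decEdge N) ?_ ?_)).symm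
    · rw [Category.assoc, decChild_tree, Category.assoc]
    · rw [Category.assoc, decEdge_fst, ← Category.assoc, he₁]
    · rw [Category.assoc, decEdge_snd, he₂]

theorem app_dec_map {N N' : Over S} (g : N ⟶ N') {Z : C} (x : Z ⟶ (τ.dec.obj N).left)
    (q : Z ⟶ τ.paths.Q.left) (hq : (x ≫ (τ.dec.map g).left) ≫ τ.decTree N' = q ≫ τ.paths.Q.hom)
    (hq' : x ≫ τ.decTree N = q ≫ τ.paths.Q.hom) :
    (τ.decProd N').app (x ≫ (τ.dec.map g).left) q hq = (τ.decProd N).app x q hq' ≫ g.left :=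
  DepProd.ofAdj_map (piPullbackAdj τ.paths.Q.hom τ.lab) g x q hq

theorem dec_map_decTree {N N' : Over S} (g : N ⟶ N') :
    (τ.dec.map g).left ≫ τ.decTree N' = τ.decTree N :=
  Over.w (τ.decFibre.map g)

theorem dec_map_decRoot {N N' : Over S} (g : N ⟶ N') :
    (τ.dec.map g).left ≫ τ.decRoot N' = τ.decRoot N ≫ g.left := by
  have h₁ : (𝟙 _ ≫ (τ.dec.map g).left) ≫ τ.decTree N' =
      (τ.decTree N ≫ τ.paths.root) ≫ τ.paths.Q.hom := by
    rw [Category.id_comp, dec_map_decTree, Category.assoc, τ.paths.root_hom, Category.comp_id]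
  refine ((τ.decProd N').comp_app _ _ _ _).trans (Eq.trans ?_ (τ.app_dec_map g _ _ h₁ _))
  refine (τ.decProd N').app_congr (by rw [Category.id_comp]; exact Category.comp_id _) ?_ _
  rw [← Category.assoc, dec_map_decTree]

theorem decChild_dec_map {N N' : Over S} (g : N ⟶ N')
    {Z : C} (e : Z ⟶ pullback (τ.decTree N ≫ τ.label) h)
    (e' : Z ⟶ pullback (τ.decTree N' ≫ τ.label) h)
    (he₁ : e' ≫ pullback.fst _ _ = (e ≫ pullback.fst _ _) ≫ (τ.dec.map g).left)
    (he₂ : e' ≫ pullback.snd _ _ = e ≫ pullback.snd _ _) :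
    (e ≫ τ.decChild N) ≫ (τ.dec.map g).left = e' ≫ τ.decChild N' := by
  have hee : e' ≫ τ.decEdge N' = e ≫ τ.decEdge N := by
    apply pullback.hom_ext
    · rw [Category.assoc, decEdge_fst, ← Category.assoc, he₁, Category.assoc, dec_map_decTree,
        Category.assoc, Category.assoc, decEdge_fst]
    · rw [Category.assoc, decEdge_snd, he₂, Category.assoc, decEdge_snd]
  refine (τ.decProd N').hom_ext ?_ ?_
  · refine (Category.assoc _ _ _).trans ((congrArg ((e ≫ τ.decChild N) ≫ ·)
      (τ.dec_map_decTree g)).trans ?_)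
    refine (Category.assoc _ _ _).trans (Eq.trans ?_ (Category.assoc _ _ _).symm)
    rw [decChild_tree, decChild_tree]
    exact (Category.assoc _ _ _).symm.trans ((congrArg (· ≫ children h t τ.w) hee.symm).trans
      (Category.assoc _ _ _))
  · intro Y w q hx hy
    have hq : (w ≫ e ≫ τ.decChild N) ≫ τ.decTree N = q ≫ τ.paths.Q.hom := by
      rw [← hx]
      refine Eq.trans ?_ (congrArg (· ≫ τ.decTree N') (Category.assoc _ _ _))
      refine Eq.trans ?_ (Category.assoc _ _ _).symm
      exact congrArg ((w ≫ e ≫ τ.decChild N) ≫ ·) (τ.dec_map_decTree g).symm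
    refine ((τ.decProd N').app_congr (Category.assoc _ _ _).symm rfl hx).trans
      ((τ.app_dec_map g _ _ _ hq).trans ?_)
    have h₁ : ((w ≫ e) ≫ τ.decChild N) ≫ τ.decTree N = q ≫ τ.paths.Q.hom := by
      rw [← hq, Category.assoc w]
    have h₂ : ((w ≫ e') ≫ τ.decChild N') ≫ τ.decTree N' = q ≫ τ.paths.Q.hom := by
      rw [← hy, Category.assoc w]
    refine (congrArg (· ≫ g.left) (((τ.decProd N).app_congr (Category.assoc _ _ _).symm rfl
      hq).trans (τ.app_decChild N (w ≫ e) q h₁))).trans ?_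
    refine Eq.trans ?_ (((τ.decProd N').app_congr (Category.assoc _ _ _).symm rfl
      hy).trans (τ.app_decChild N' (w ≫ e') q h₂)).symm
    refine (τ.app_dec_map g _ _ ?_ _).symm.trans ?_
    · rw [Paths.consAt_hom, Category.assoc _ _ (τ.decTree N'), dec_map_decTree, Category.assoc,
        Category.assoc, Category.assoc, decEdge_fst, Category.assoc]
    · refine (τ.decProd N').app_congr ?_ (τ.paths.consAt_congr ?_ rfl _) _
      · rw [Category.assoc w e', he₁, Category.assoc w e, Category.assoc]
      · rw [Category.assoc, Category.assoc, hee]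

theorem dec_map_decFamily {N N' : Over S} (g : N ⟶ N') :
    (τ.dec.map g).left ≫ τ.decFamily N' =
      τ.decFamily N ≫ ((piPullback h t).map (τ.dec.map g)).left := by
  refine (DepProd.ofAdj (piPullbackAdj h t) (τ.dec.obj N')).hom_ext ?_ ?_
  · rw [Category.assoc, decFamily_hom, Category.assoc, Over.w, decFamily_hom, ← Category.assoc,
      dec_map_decTree]
  · intro Z x b hx hy
    have hb : x ≫ τ.decTree N ≫ τ.label = b ≫ h := by
      rw [← hy, Category.assoc, Category.assoc, Over.w, decFamily_hom]
    have hb' : (x ≫ (τ.dec.map g).left) ≫ τ.decTree N' ≫ τ.label = b ≫ h := by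
      rw [← hb, Category.assoc, ← Category.assoc _ (τ.decTree N'), dec_map_decTree]
    let e : Z ⟶ pullback (τ.decTree N ≫ τ.label) h := pullback.lift x b hb
    let e' : Z ⟶ pullback (τ.decTree N' ≫ τ.label) h := pullback.lift _ b hb'
    have he₁ : e ≫ pullback.fst _ _ = x := pullback.lift_fst _ _ _
    have he₂ : e ≫ pullback.snd _ _ = b := pullback.lift_snd _ _ _
    have he₁' : e' ≫ pullback.fst _ _ = x ≫ (τ.dec.map g).left := pullback.lift_fst _ _ _
    have he₂' : e' ≫ pullback.snd _ _ = b := pullback.lift_snd _ _ _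
    refine ((DepProd.app_congr _ (Category.assoc _ _ _).symm rfl hx).trans
      (τ.app_decFamily N' _ b _ e' he₁' he₂')).trans ?_
    refine Eq.trans ?_ ((DepProd.app_congr _ (Category.assoc _ _ _).symm rfl hy).trans
      ((DepProd.ofAdj_map _ _ _ _ _).trans (congrArg (· ≫ (τ.dec.map g).left)
        (τ.app_decFamily N x b _ e he₁ he₂)))).symm
    exact (τ.decChild_dec_map g e e' (by rw [he₁', he₁]) (by rw [he₂', he₂])).symm

theorem decStr_naturality {N N' : Over S} (g : N ⟶ N') :
    τ.dec.map g ≫ τ.decStr N' =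
      τ.decStr N ≫ (step u h t).map ((g, τ.dec.map g) : (N, τ.dec.obj N) ⟶ (N', τ.dec.obj N')) := by
  ext
  refine step_hom_ext ?_ ?_
  · rw [Over.comp_left, Category.assoc, decStr_fst, dec_map_decRoot, Over.comp_left, Category.assoc,
      step_map_fst, ← Category.assoc, decStr_fst]
  · rw [Over.comp_left, Category.assoc, decStr_snd, dec_map_decFamily, Over.comp_left,
      Category.assoc, step_map_snd, ← Category.assoc, decStr_snd]

/-- A coalgebra map from a coalgebra over trees to the decorated trees lies over trees. -/
theorem comp_decTree {N : Over S} {V : Over U} (γ : V ⟶ (step u h t).obj (N, V))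
    (k : V ⟶ τ.dec.obj N)
    (hk : k ≫ τ.decStr N = γ ≫ (step u h t).map ((𝟙 N, k) : (N, V) ⟶ (N, τ.dec.obj N))) :
    (k ≫ τ.decTreeHom N).left ≫ τ.w =
      (γ.left ≫ stepSnd u h t N V) ≫ ((piPullback h t).map (k ≫ τ.decTreeHom N)).left := by
  have := congrArg (fun f => Over.Hom.left f ≫ stepSnd u h t _ _) hk
  dsimp only at this
  rw [Over.comp_left, Category.assoc, decStr_snd, Over.comp_left, Category.assoc, step_map_snd]
    at this
  rw [Functor.map_comp, Over.comp_left, Over.comp_left, Category.assoc, Category.assoc,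
    ← Category.assoc _ _ ((piPullback h t).map (τ.decTreeHom N)).left, ← Category.assoc γ.left,
    ← this, Category.assoc, decFamily_map_decTree]
  rfl

/-- When `w` is invertible, `step (N, decorated trees)` is itself a coalgebra over trees, and the map
from it given by `existsUnique_dec` is inverse to `decStr`, as in the lemma of Lambek. -/
theorem isIso_decStr [IsIso τ.w] (N : Over S) : IsIso (τ.decStr N) := by
  set K := τ.dec.obj N
  let γ : (step u h t).obj (N, K) ⟶ (step u h t).obj (N, (step u h t).obj (N, K)) :=
    (step u h t).map ((𝟙 N, τ.decStr N) : (N, K) ⟶ (N, (step u h t).obj (N, K)))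
  let v₀ : ((step u h t).obj (N, K)).left ⟶ τ.W.left :=
    (stepSnd u h t N K ≫ ((piPullback h t).map (τ.decTreeHom N)).left) ≫ inv τ.w
  have hv₀ : v₀ ≫ τ.w = stepSnd u h t N K ≫ ((piPullback h t).map (τ.decTreeHom N)).left := by
    simp [v₀]
  let v : (step u h t).obj (N, K) ⟶ τ.W := Over.homMk v₀ (by
    rw [← τ.w_hom, ← Category.assoc, ← Category.assoc, hv₀, Category.assoc _ _ (Over.hom _),
      Over.w, ← step_condition]
    rfl)
  have hc : τ.decStr N ≫ v = τ.decTreeHom N := by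
    ext
    refine (cancel_mono τ.w).mp ?_
    refine (Category.assoc _ _ _).trans ((congrArg (_ ≫ ·) hv₀).trans ?_)
    rw [← Category.assoc, decStr_snd, decFamily_map_decTree]
    rfl
  obtain ⟨k, ⟨hk₁, hk₂⟩, -⟩ := τ.existsUnique_dec γ v (by
    refine hv₀.trans ?_
    rw [step_map_snd, Category.assoc, ← Over.comp_left, ← Functor.map_comp, hc])
  have hid : τ.decStr N ≫ k = 𝟙 K := by
    refine (τ.existsUnique_dec (τ.decStr N) (τ.decTreeHom N) ?_).unique ⟨?_, ?_⟩ ⟨?_, ?_⟩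
    · rw [decStr_snd, decFamily_map_decTree]
      rfl
    · rw [Over.comp_left, Category.assoc, hk₁, ← Over.comp_left, hc]
    · rw [Category.assoc, hk₂, ← Functor.map_comp]
      refine congrArg _ (congrArg _ ?_)
      exact Prod.ext (Category.comp_id _) rfl
    · exact Category.id_comp _
    · exact (Category.id_comp _).trans ((Category.comp_id _).symm.trans
        (congrArg _ ((step u h t).map_id _).symm))
  refine ⟨k, hid, ?_⟩
  rw [hk₂, ← Functor.map_comp]
  refine Eq.trans (congrArg _ ?_) ((step u h t).map_id (N, K))
  exact Prod.ext (Category.comp_id _) hid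

end Trees

/-! ### Recursion over an initial algebra -/

section

variable {C : Type u} [Category.{v} C] [HasPullbacks C] [LocallyCartesianClosed C]
  {S U B : C} {u : S ⟶ U} {h : B ⟶ S} {t : B ⟶ U}

/-- Recursion over an initial algebra `W` along a coalgebra `K` over `W`: a map `k` out of `K` is
determined by prescribing its value at `x` in terms of `x` and of the values of `k` at the children
of `x`. Passing to the exponential `K ⇒ Y` over `W` turns such maps into algebra maps out of `W`. -/
theorem existsUnique_rec {W : Over U} {a : (piPullback h t ⋙ Over.map u).obj W ⟶ W}
    (ha : IsInitAlg (piPullback h t ⋙ Over.map u) W a) (w : W.left ⟶ ((piPullback h t).obj W).left)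
    (hwa : w ≫ a.left = 𝟙 _) (haw : a.left ≫ w = 𝟙 _) {K Y : Over U} (v : K ⟶ W)
    (y : K.left ⟶ ((piPullback h t).obj K).left)
    (hv : v.left ≫ w = y ≫ ((piPullback h t).map v).left)
    (β : pullback (y ≫ ((piPullback h t).obj K).hom) ((piPullback h t).obj Y).hom ⟶ Y.left)
    (hβ : β ≫ Y.hom = pullback.fst _ _ ≫ K.hom) :
    ∃! k : K ⟶ Y, k.left = pullback.lift (𝟙 _) (y ≫ ((piPullback h t).map k).left)
      (by rw [Category.assoc, Over.w, Category.id_comp]) ≫ β := by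
  let Ξ : Over W.left := (piPullback v.left (v.left ≫ W.hom)).obj Y
  let d : DepProd v.left (v.left ≫ W.hom) Y Ξ := DepProd.ofAdj (piPullbackAdj _ _) Y
  let X : Over U := (Over.map W.hom).obj Ξ
  let dX := DepProd.ofAdj (piPullbackAdj h t) X
  let dY := DepProd.ofAdj (piPullbackAdj h t) Y
  let dK := DepProd.ofAdj (piPullbackAdj h t) K
  let dW := DepProd.ofAdj (piPullbackAdj h t) W
  let π : X ⟶ W := Over.homMk Ξ.hom rfl
  let z : ((piPullback h t).obj X).left ⟶ W.left := ((piPullback h t).map π).left ≫ a.left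
  let p : pullback z v.left ⟶ ((piPullback h t).obj X).left := pullback.fst z v.left
  let x : pullback z v.left ⟶ K.left := pullback.snd z v.left
  have hpx : p ≫ ((piPullback h t).map π).left = x ≫ y ≫ ((piPullback h t).map v).left := by
    have : p ≫ z = x ≫ v.left := pullback.condition
    rw [← hv, ← Category.assoc, ← this, Category.assoc, Category.assoc, haw]
    exact congrArg (p ≫ ·) (Category.comp_id _).symm
  let s : pullback z v.left ⟶ S := p ≫ ((piPullback h t).obj X).hom
  have hs : s = x ≫ y ≫ ((piPullback h t).obj K).hom := by
    have := congrArg (· ≫ ((piPullback h t).obj W).hom) hpx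
    simpa only [Category.assoc, Over.w] using this
  have hX : ∀ {Z : C} (q : Z ⟶ pullback z v.left) (b : Z ⟶ B) (hq : (q ≫ p) ≫ Over.hom _ = b ≫ h)
      (hq' : (q ≫ x ≫ y) ≫ Over.hom _ = b ≫ h),
      dX.app (q ≫ p) b hq ≫ Ξ.hom = dK.app (q ≫ x ≫ y) b hq' ≫ v.left := by
    intro Z q b hq hq'
    refine (DepProd.ofAdj_map (piPullbackAdj h t) π (q ≫ p) b (by
      rw [Category.assoc _ _ (Over.hom _), Over.w, hq])).symm.trans ?_
    refine Eq.trans (dW.app_congr ?_ rfl _) (DepProd.ofAdj_map (piPullbackAdj h t) v (q ≫ x ≫ y) b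
      (by rw [Category.assoc _ _ (Over.hom _), Over.w, hq']))
    rw [Category.assoc, hpx, Category.assoc, Category.assoc]
  have hsb : (pullback.fst s h ≫ p) ≫ ((piPullback h t).obj X).hom = pullback.snd s h ≫ h := by
    rw [Category.assoc]; exact pullback.condition
  have hsb' : (pullback.fst s h ≫ x ≫ y) ≫ ((piPullback h t).obj K).hom =
      pullback.snd s h ≫ h := by
    rw [Category.assoc, Category.assoc, ← hs]; exact pullback.condition
  let κ : pullback s h ⟶ Y.left := d.app (dX.app (pullback.fst _ _ ≫ p) (pullback.snd _ _) hsb)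
    (dK.app (pullback.fst _ _ ≫ x ≫ y) (pullback.snd _ _) hsb') (hX _ _ _ _)
  have hκ : κ ≫ Y.hom = pullback.snd _ _ ≫ t := by
    refine (d.app_hom _ _ _).trans ?_
    rw [Over.w]
    exact dK.app_hom _ _ _
  let fam : pullback z v.left ⟶ ((piPullback h t).obj Y).left := dY.lam s κ hκ
  have hfam : fam ≫ Over.hom _ = s := dY.lam_hom _ _ _
  let κ' : pullback z v.left ⟶ Y.left := pullback.lift x fam (by rw [hfam, hs]) ≫ β
  have hκ' : κ' ≫ Y.hom = x ≫ v.left ≫ W.hom := by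
    rw [Category.assoc, hβ, pullback.lift_fst_assoc, Over.w]
  let α₀ : ((piPullback h t).obj X).left ⟶ Ξ.left := d.lam z κ' hκ'
  have hα₀ : α₀ ≫ Ξ.hom = z := d.lam_hom _ _ _
  let α : (piPullback h t ⋙ Over.map u).obj X ⟶ X := Over.homMk α₀ (by
    change α₀ ≫ Ξ.hom ≫ W.hom = _
    rw [← Category.assoc, hα₀, Category.assoc, Over.w a]
    change _ ≫ _ ≫ u = _ ≫ u
    rw [← Category.assoc, Over.w])
  -- a section `r` of the exponential is a homomorphism iff its transpose is recursive
  have star : ∀ (r : W ⟶ X) (k : K ⟶ Y) (hr : r.left ≫ Ξ.hom = 𝟙 _)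
      (_ : ∀ {Z : C} (x : Z ⟶ K.left) (ω : Z ⟶ W.left) (hω : ω = x ≫ v.left)
        (hω' : (ω ≫ r.left) ≫ Ξ.hom = x ≫ v.left), d.app (ω ≫ r.left) x hω' = x ≫ k.left)
      {Z : C} (x' : Z ⟶ K.left) (ω : Z ⟶ ((piPullback h t).obj W).left)
      (_ : ω = x' ≫ v.left ≫ w) (hω' : ((ω ≫ ((piPullback h t).map r).left) ≫ α₀) ≫ Ξ.hom =
        x' ≫ v.left), d.app ((ω ≫ ((piPullback h t).map r).left) ≫ α₀) x' hω' =
        x' ≫ pullback.lift (𝟙 _) (y ≫ ((piPullback h t).map k).left)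
          (by rw [Category.assoc, Over.w, Category.id_comp]) ≫ β := by
    intro r k hr hrk Z x' ω hω hω'
    have hω₂ : (ω ≫ ((piPullback h t).map r).left) ≫ z = x' ≫ v.left := by
      rw [← hω', Category.assoc _ α₀, hα₀]
    obtain ⟨q, hqp, hqx⟩ : ∃ q : Z ⟶ pullback z v.left,
        q ≫ p = ω ≫ ((piPullback h t).map r).left ∧ q ≫ x = x' :=
      ⟨pullback.lift _ _ hω₂, pullback.lift_fst _ _ _, pullback.lift_snd _ _ _⟩
    have hqfam : q ≫ fam = x' ≫ y ≫ ((piPullback h t).map k).left := by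
      refine dY.hom_ext ?_ ?_
      · rw [Category.assoc, hfam, hs, Category.assoc, Category.assoc, Over.w, ← hqx,
          Category.assoc]
      · intro Z' w' b hx hy
        have h₁ : (w' ≫ q) ≫ s = b ≫ h := by
          rw [← hx]; simp only [Category.assoc, hfam]
        have h₂ : (w' ≫ x' ≫ y) ≫ Over.hom _ = b ≫ h := by
          rw [← hy]; simp only [Category.assoc, Over.w]
        have h₃ : (w' ≫ ω) ≫ ((piPullback h t).obj W).hom = b ≫ h := by
          rw [← h₂, hω, hv]; simp only [Category.assoc, Over.w]
        have h₄ : dW.app (w' ≫ ω) b h₃ = dK.app (w' ≫ x' ≫ y) b h₂ ≫ v.left := by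
          refine Eq.trans (dW.app_congr ?_ rfl _) (DepProd.ofAdj_map (piPullbackAdj h t) v
            (w' ≫ x' ≫ y) b (by rw [Category.assoc _ _ (Over.hom _), Over.w, h₂]))
          rw [hω, hv, Category.assoc, Category.assoc]
        have h₅ : ((w' ≫ ω) ≫ ((piPullback h t).map r).left) ≫ Over.hom _ = b ≫ h := by
          rw [Category.assoc _ _ (Over.hom _), Over.w, h₃]
        refine (dY.app_congr (Category.assoc _ _ _).symm rfl hx).trans
          ((dY.app_lam _ _ _ _ _ (by rw [Category.assoc, hfam, h₁])).trans ?_)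
        refine (d.comp_app _ _ _ _).trans ?_
        refine Eq.trans (d.app_congr (y := dW.app (w' ≫ ω) b h₃ ≫ r.left)
          (β := dK.app (w' ≫ x' ≫ y) b h₂) ?_ ?_ _) ((hrk _ _ h₄ ?_).trans ?_)
        · refine (dX.comp_app _ _ _ _).trans (Eq.trans (dX.app_congr ?_ ?_ _)
            (DepProd.ofAdj_map (piPullbackAdj h t) r (w' ≫ ω) b h₅))
          · rw [pullback.lift_fst_assoc, Category.assoc, hqp, Category.assoc]
          · rw [pullback.lift_snd]
        · refine (dK.comp_app _ _ _ _).trans (dK.app_congr ?_ ?_ _)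
          · rw [pullback.lift_fst_assoc, Category.assoc, ← Category.assoc q, hqx]
          · rw [pullback.lift_snd]
        · rw [Category.assoc, hr, Category.comp_id, h₄]
        · refine (DepProd.ofAdj_map (piPullbackAdj h t) k (w' ≫ x' ≫ y) b (by
            rw [Category.assoc _ _ (Over.hom _), Over.w, h₂])).symm.trans (dY.app_congr ?_ rfl _)
          rw [Category.assoc, Category.assoc]
    refine (d.app_lam _ _ _ _ _ _).trans ?_
    have hq : pullback.lift (ω ≫ ((piPullback h t).map r).left) x' hω₂ = q := by
      apply pullback.hom_ext
      · rw [pullback.lift_fst]; exact hqp.symm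
      · rw [pullback.lift_snd]; exact hqx.symm
    refine (congrArg (· ≫ κ') hq).trans ?_
    refine (Category.assoc _ _ _).symm.trans (Eq.trans (congrArg (· ≫ β) ?_) (Category.assoc _ _ _))
    apply pullback.hom_ext
    · rw [Category.assoc, pullback.lift_fst, hqx, Category.assoc, pullback.lift_fst,
        Category.comp_id]
    · rw [Category.assoc, pullback.lift_snd, hqfam, Category.assoc, pullback.lift_snd]
  have hwa' : ∀ r : W ⟶ X, a ≫ r = (piPullback h t ⋙ Over.map u).map r ≫ α ↔
      r.left = (w ≫ ((piPullback h t).map r).left) ≫ α₀ := by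
    intro r
    constructor
    · intro hr
      have : a.left ≫ r.left = ((piPullback h t).map r).left ≫ α₀ := congrArg Over.Hom.left hr
      rw [Category.assoc, ← this, ← Category.assoc, hwa, Category.id_comp]
    · intro hr
      ext
      change a.left ≫ r.left = ((piPullback h t).map r).left ≫ α₀
      conv_lhs => rw [hr]
      rw [← Category.assoc, ← Category.assoc, haw, Category.id_comp]
  obtain ⟨r, hr, huniq⟩ := ha X α
  have hr' : r.left = (w ≫ ((piPullback h t).map r).left) ≫ α₀ := (hwa' r).mp hr
  have hαπ : α ≫ π = (piPullback h t ⋙ Over.map u).map π ≫ a := by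
    ext
    exact hα₀
  have hrπ : r ≫ π = 𝟙 W := by
    refine (ha W a).unique ?_ ?_
    · rw [← Category.assoc]
      rw [hr, Category.assoc, hαπ, Functor.map_comp, Category.assoc]
    · exact (Category.comp_id _).trans ((Category.id_comp _).symm.trans
        (congrArg (· ≫ a) ((piPullback h t ⋙ Over.map u).map_id W).symm))
  have hr₀ : r.left ≫ Ξ.hom = 𝟙 _ := congrArg Over.Hom.left hrπ
  have hvr : (v.left ≫ r.left) ≫ Ξ.hom = 𝟙 _ ≫ v.left := by
    rw [Category.assoc, hr₀, Category.comp_id, Category.id_comp]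
  let k : K ⟶ Y := Over.homMk (d.app (v.left ≫ r.left) (𝟙 _) hvr) (by
    rw [d.app_hom, Category.id_comp, Over.w])
  have hk : ∀ {Z : C} (x : Z ⟶ K.left) (ω : Z ⟶ W.left) (hω : ω = x ≫ v.left)
        (hω' : (ω ≫ r.left) ≫ Ξ.hom = x ≫ v.left), d.app (ω ≫ r.left) x hω' = x ≫ k.left := by
    intro Z x ω hω hω'
    refine Eq.trans (d.app_congr ?_ ?_ _) (d.comp_app x _ _ hvr).symm
    · rw [hω, Category.assoc]
    · rw [Category.comp_id]
  refine ⟨k, ?_, ?_⟩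
  · have h₀ : v.left ≫ r.left = ((v.left ≫ w) ≫ ((piPullback h t).map r).left) ≫ α₀ := by
      conv_lhs => rw [hr']
      simp only [Category.assoc]
    refine (d.app_congr h₀ rfl hvr).trans ((star r k hr₀ hk (𝟙 _) (v.left ≫ w)
      (Category.id_comp _).symm _).trans (Category.id_comp _))
  · intro k' hk'
    let r₀ : W.left ⟶ Ξ.left := d.lam (𝟙 _) (pullback.snd _ _ ≫ k'.left) (by
      rw [Category.assoc, Over.w, Over.w])
    have hr₀' : r₀ ≫ Ξ.hom = 𝟙 _ := d.lam_hom _ _ _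
    let r' : W ⟶ X := Over.homMk r₀ (by
      change r₀ ≫ Ξ.hom ≫ W.hom = _
      rw [← Category.assoc, hr₀', Category.id_comp])
    have hrk : ∀ {Z : C} (x : Z ⟶ K.left) (ω : Z ⟶ W.left) (hω : ω = x ≫ v.left)
        (hω' : (ω ≫ r'.left) ≫ Ξ.hom = x ≫ v.left),
        d.app (ω ≫ r'.left) x hω' = x ≫ k'.left := by
      intro Z x ω hω hω'
      refine (d.app_lam _ _ _ _ _ _).trans ?_
      rw [pullback.lift_snd_assoc]
    have : r' = r := by
      refine huniq r' ((hwa' r').mpr ?_)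
      refine d.hom_ext ?_ ?_
      · rw [Category.assoc _ α₀, hα₀]
        refine hr₀'.trans ?_
        change 𝟙 _ = (w ≫ ((piPullback h t).map r').left) ≫ ((piPullback h t).map π).left ≫ a.left
        rw [Category.assoc, ← Category.assoc _ _ a.left, ← Over.comp_left, ← Functor.map_comp,
          show r' ≫ π = 𝟙 W from Over.OverMorphism.ext hr₀', CategoryTheory.Functor.map_id]
        refine Eq.symm ((congrArg (w ≫ ·) (Category.id_comp _)).trans hwa)
      · intro Z ω x hx hy
        have hω : ω = x ≫ v.left := by
          rw [← hx, Category.assoc]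
          exact ((congrArg (ω ≫ ·) hr₀').trans (Category.comp_id _)).symm
        refine (hrk x ω hω hx).trans ?_
        refine Eq.trans ?_ (d.app_congr (x := ((ω ≫ w) ≫ ((piPullback h t).map r').left) ≫ α₀)
          (by simp only [Category.assoc]) rfl (by rw [← hy]; simp only [Category.assoc]))
        refine Eq.trans ?_ (star r' k' hr₀' hrk x (ω ≫ w) (by rw [hω, Category.assoc]) _).symm
        exact congrArg (x ≫ ·) hk'
    ext
    refine (Category.id_comp _).symm.trans ((hrk (𝟙 _) v.left (Category.id_comp _).symm (by
      rw [Category.assoc]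
      exact (congrArg (v.left ≫ ·) hr₀').trans ((Category.comp_id _).trans
        (Category.id_comp _).symm))).symm.trans ?_)
    exact d.app_congr (by rw [this]) rfl _

end

/-! ### Initial algebras and terminal coalgebras in Mathlib's sense -/

theorem IsInitAlg.isIso {D : Type u₁} [Category.{v₁} D] {H : D ⥤ D} {X : D} {a : H.obj X ⟶ X}
    (h : IsInitAlg H X a) : IsIso a := by
  obtain ⟨c, hc, -⟩ := h (H.obj X) (H.map a)
  have : c ≫ a = 𝟙 X := (h X a).unique (by
    rw [← Category.assoc]
    rw [hc, Category.assoc, ← H.map_comp_assoc]) (by simp)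
  exact ⟨c, by rw [hc, ← H.map_comp, this, H.map_id], this⟩

theorem IsTermCoalg.isIso {D : Type u₁} [Category.{v₁} D] {H : D ⥤ D} {X : D} {c : X ⟶ H.obj X}
    (h : IsTermCoalg H X c) : IsIso c := by
  obtain ⟨a, ha, -⟩ := h (H.obj X) (H.map c)
  have : c ≫ a = 𝟙 X := (h X c).unique (by
    rw [Category.assoc, ha, ← H.map_comp]) (by simp)
  exact ⟨a, this, by rw [ha, ← H.map_comp, this, H.map_id]⟩

theorem IsInitAlg.of_isInitial {D : Type u₁} [Category.{v₁} D] {H : D ⥤ D}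
    {A : Endofunctor.Algebra H} (h : IsInitial A) : IsInitAlg H A.a A.str := by
  intro Y b
  refine ⟨(h.to ⟨Y, b⟩).f, (h.to ⟨Y, b⟩).h.symm, ?_⟩
  intro f hf
  exact congrArg Endofunctor.Algebra.Hom.f
    (h.hom_ext (⟨f, hf.symm⟩ : A ⟶ (⟨Y, b⟩ : Endofunctor.Algebra H)) _)

theorem IsTermCoalg.of_isTerminal {D : Type u₁} [Category.{v₁} D] {H : D ⥤ D}
    {A : Endofunctor.Coalgebra H} (h : IsTerminal A) : IsTermCoalg H A.V A.str := by
  intro Y b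
  refine ⟨(h.from ⟨Y, b⟩).f, (h.from ⟨Y, b⟩).h.symm, ?_⟩
  intro f hf
  exact congrArg Endofunctor.Coalgebra.Hom.f
    (h.hom_ext (⟨f, hf.symm⟩ : (⟨Y, b⟩ : Endofunctor.Coalgebra H) ⟶ A) _)

theorem IsInitAlg.isInitial {D : Type u₁} [Category.{v₁} D] {H : D ⥤ D} {X : D} {a : H.obj X ⟶ X}
    (h : IsInitAlg H X a) : Nonempty (IsInitial (⟨X, a⟩ : Endofunctor.Algebra H)) :=
  ⟨IsInitial.ofUniqueHom (fun Y => ⟨(h Y.a Y.str).choose, (h Y.a Y.str).choose_spec.1.symm⟩)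
    (fun Y m => by
      ext
      exact (h Y.a Y.str).choose_spec.2 m.f m.h.symm)⟩

theorem IsTermCoalg.isTerminal {D : Type u₁} [Category.{v₁} D] {H : D ⥤ D} {X : D}
    {c : X ⟶ H.obj X} (h : IsTermCoalg H X c) :
    Nonempty (IsTerminal (⟨X, c⟩ : Endofunctor.Coalgebra H)) :=
  ⟨IsTerminal.ofUniqueHom (fun Y => ⟨(h Y.V Y.str).choose, (h Y.V Y.str).choose_spec.1.symm⟩)
    (fun Y m => by
      ext
      exact (h Y.V Y.str).choose_spec.2 m.f m.h.symm)⟩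

/-! ### Universal properties of decorated trees -/

/-- The endofunctor `H (x, -)`. -/
@[simps]
def fixFst {A : Type u₂} [Category.{v₂} A] {D : Type u₁} [Category.{v₁} D] (H : A × D ⥤ D)
    (x : A) : D ⥤ D where
  obj Y := H.obj (x, Y)
  map g := H.map ((𝟙 x, g) : (x, _) ⟶ (x, _))
  map_id Y := H.map_id (x, Y)
  map_comp f g := by
    rw [← H.map_comp]
    exact congrArg _ (Prod.ext (Category.comp_id _).symm rfl)

namespace Trees

variable {C : Type u} [Category.{v} C] [HasFiniteLimits C] [LocallyCartesianClosed C]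
  {S U B : C} {u : S ⟶ U} {h : B ⟶ S} {t : B ⟶ U} (τ : Trees u h t)

/-- The structure of a coalgebra on the object of trees. -/
abbrev str : τ.W ⟶ (piPullback h t ⋙ Over.map u).obj τ.W := Over.homMk τ.w (by
  refine Eq.trans ?_ τ.w_hom
  exact (Category.assoc _ _ _).symm)

/-- Decorated trees are a terminal coalgebra of `step u h t (N, -)` when the undecorated trees are
one of `Σ_u Π_h t^*`: forgetting decorations, a coalgebra has exactly one map to the trees. -/
theorem isTermCoalg_dec (hτ : IsTermCoalg (piPullback h t ⋙ Over.map u) τ.W τ.str) (N : Over S) :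
    IsTermCoalg (fixFst (step u h t) N) (τ.dec.obj N) (τ.decStr N) := by
  intro V γ
  let γ' : V ⟶ (step u h t).obj (N, V) := γ
  have hc : ∀ (v : V ⟶ τ.W) (b : V ⟶ (piPullback h t ⋙ Over.map u).obj V)
      (_ : b.left = γ'.left ≫ stepSnd u h t N V),
      v ≫ τ.str = b ≫ (piPullback h t ⋙ Over.map u).map v ↔ v.left ≫ τ.w =
        (γ'.left ≫ stepSnd u h t N V) ≫ ((piPullback h t).map v).left := by
    intro v b hb
    rw [← hb]
    exact ⟨fun e => congrArg Over.Hom.left e, fun e => Over.OverMorphism.ext e⟩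
  let b : V ⟶ (piPullback h t ⋙ Over.map u).obj V :=
    Over.homMk (γ'.left ≫ stepSnd u h t N V) (by
      change _ ≫ _ ≫ u = _
      rw [Category.assoc, ← Category.assoc (stepSnd u h t N V), ← step_condition, ← step_hom,
        Over.w])
  obtain ⟨v, hv, hvu⟩ := hτ V b
  obtain ⟨k, ⟨hk₁, hk₂⟩, hku⟩ := τ.existsUnique_dec γ' v ((hc v b rfl).mp hv)
  refine ⟨k, hk₂, ?_⟩
  intro k' hk'
  have := hvu _ ((hc (k' ≫ τ.decTreeHom N) b rfl).mpr (τ.comp_decTree γ' k' hk'))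
  exact hku k' ⟨congrArg Over.Hom.left this, hk'⟩

/-- Decorated trees are an initial algebra of `step u h t (N, -)` when the undecorated trees are
one of `Σ_u Π_h t^*`: algebra maps out of them are the solutions of a recursion over the trees. -/
theorem isInitAlg_dec {a : (piPullback h t ⋙ Over.map u).obj τ.W ⟶ τ.W}
    (hτ : IsInitAlg (piPullback h t ⋙ Over.map u) τ.W a) (h₁ : a ≫ τ.str = 𝟙 _)
    (h₂ : τ.str ≫ a = 𝟙 _) (N : Over S) (a' : (step u h t).obj (N, τ.dec.obj N) ⟶ τ.dec.obj N)
    (ha₁ : a' ≫ τ.decStr N = 𝟙 _) (ha₂ : τ.decStr N ≫ a' = 𝟙 _) :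
    IsInitAlg (fixFst (step u h t) N) (τ.dec.obj N) a' := by
  intro Y b
  -- the same morphism, typed by `step` rather than by `fixFst`
  let b' : (step u h t).obj (N, Y) ⟶ Y := b
  let y := τ.decFamily N
  have hy : y ≫ Over.hom _ = τ.decRoot N ≫ N.hom :=
    (τ.decFamily_hom N).trans (τ.decRoot_hom N).symm
  have hβ₀ : (pullback.fst (y ≫ Over.hom _) ((piPullback h t).obj Y).hom ≫ τ.decRoot N) ≫ N.hom =
      pullback.snd (y ≫ Over.hom _) ((piPullback h t).obj Y).hom ≫ Over.hom _ := by
    rw [Category.assoc, ← hy, pullback.condition]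
  let β : pullback (y ≫ Over.hom _) ((piPullback h t).obj Y).hom ⟶ Y.left :=
    stepMk u h t _ _ hβ₀ ≫ b'.left
  obtain ⟨k, hk, hku⟩ := existsUnique_rec hτ τ.w (congrArg Over.Hom.left h₂)
    (congrArg Over.Hom.left h₁) (τ.decTreeHom N) y (τ.decFamily_map_decTree N).symm β (by
      rw [Category.assoc, Over.w, step_hom, ← Category.assoc, ← Category.assoc, stepMk_fst,
        Category.assoc _ _ N.hom, decRoot_hom, Category.assoc]
      refine congrArg _ ?_
      refine (Category.assoc _ _ _).trans ?_
      exact congrArg (τ.decTree N ≫ ·) τ.w_hom)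
  have key : ∀ k : τ.dec.obj N ⟶ Y, a' ≫ k = (fixFst (step u h t) N).map k ≫ b ↔
      k.left = pullback.lift (𝟙 _) (y ≫ ((piPullback h t).map k).left)
        (by rw [Category.assoc, Over.w, Category.id_comp]) ≫ β := by
    intro k
    obtain ⟨m, hm⟩ : ∃ m : (step u h t).obj (N, τ.dec.obj N) ⟶ (step u h t).obj (N, Y),
        m = (fixFst (step u h t) N).map k := ⟨_, rfl⟩
    have hm₁ : m.left ≫ stepFst u h t _ _ = stepFst u h t _ _ := by
      rw [hm]
      exact (step_map_fst _ _).trans (Category.comp_id _)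
    have hm₂ : m.left ≫ stepSnd u h t _ _ = stepSnd u h t _ _ ≫ ((piPullback h t).map k).left := by
      rw [hm]
      exact step_map_snd _ _
    have : pullback.lift (𝟙 _) (y ≫ ((piPullback h t).map k).left)
        (by rw [Category.assoc, Over.w, Category.id_comp]) ≫ β = (τ.decStr N ≫ m ≫ b').left := by
      refine (Category.assoc _ _ _).symm.trans (Eq.trans (congrArg (· ≫ b'.left)
        (step_hom_ext (y := (τ.decStr N).left ≫ m.left) ?_ ?_)) (Category.assoc _ _ _))
      · rw [Category.assoc, stepMk_fst, pullback.lift_fst_assoc, Category.id_comp, Category.assoc,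
          hm₁, decStr_fst]
      · rw [Category.assoc, stepMk_snd, pullback.lift_snd, Category.assoc, hm₂, ← Category.assoc,
          decStr_snd]
    rw [this]
    change a' ≫ k = (fixFst (step u h t) N).map k ≫ b' ↔ _
    rw [← hm]
    constructor
    · intro e
      refine congrArg Over.Hom.left (?_ : k = _)
      exact (Category.id_comp k).symm.trans ((congrArg (· ≫ k) ha₂.symm).trans
        ((Category.assoc _ _ _).trans (congrArg (τ.decStr N ≫ ·) e)))
    · intro e
      have e' : k = τ.decStr N ≫ m ≫ b' := Over.OverMorphism.ext e
      exact (congrArg (a' ≫ ·) e').trans ((Category.assoc _ _ _).symm.trans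
        ((congrArg (· ≫ m ≫ b') ha₁).trans (Category.id_comp _)))
  exact ⟨k, (key k).mpr hk, fun k' hk' => hku k' ((key k').mp hk')⟩

end Trees

/-! ### Extremal fixed points -/

/-- `a : H X ≅ X` is an initial algebra (for `true`) or a terminal coalgebra (for `false`). -/
def IsExtremal (b : Bool) {D : Type u₁} [Category.{v₁} D] (H : D ⥤ D) (X : D) (a : H.obj X ≅ X) :
    Prop :=
  match b with
  | true => IsInitAlg H X a.hom
  | false => IsTermCoalg H X a.inv

/-- Extremal fixed points are transported along equivalences. -/
theorem IsExtremal.of_equiv {b : Bool} {D : Type u₁} [Category.{v₁} D] {D' : Type u₂}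
    [Category.{v₂} D'] {H : D ⥤ D} {H' : D' ⥤ D'} (e : D' ⥤ D) [e.IsEquivalence]
    (θ : H' ⋙ e ≅ e ⋙ H) {X : D} {X' : D'} (i : e.obj X' ≅ X) {a : H.obj X ≅ X}
    {a' : H'.obj X' ≅ X'} (h : e.map a'.hom = θ.hom.app X' ≫ H.map i.hom ≫ a.hom ≫ i.inv)
    (ha : IsExtremal b H X a) : IsExtremal b H' X' a' := by
  cases b
  · have h' : e.map a'.inv = i.hom ≫ a.inv ≫ H.map i.inv ≫ θ.inv.app X' := by
      rw [← cancel_epi (e.map a'.hom), ← e.map_comp, a'.hom_inv_id, h]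
      simp [← H.map_comp_assoc]
    intro Y c
    have key : ∀ f : Y ⟶ X', f ≫ a'.inv = c ≫ H'.map f ↔ (e.map f ≫ i.hom) ≫ a.inv =
        (e.map c ≫ θ.hom.app Y) ≫ H.map (e.map f ≫ i.hom) := by
      intro f
      have hn : e.map (H'.map f) ≫ θ.hom.app X' = θ.hom.app Y ≫ H.map (e.map f) :=
        θ.hom.naturality f
      rw [← e.map_injective.eq_iff, e.map_comp, e.map_comp, h', H.map_comp, Category.assoc,
        Category.assoc, ← reassoc_of% hn]
      rw [← cancel_mono (θ.hom.app X' ≫ H.map i.hom)]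
      simp [← H.map_comp]
    obtain ⟨f, hf, hu⟩ := ha (e.obj Y) (e.map c ≫ θ.hom.app Y)
    refine ⟨e.preimage (f ≫ i.inv), (key _).mpr (by simpa using hf), ?_⟩
    intro f' hf'
    apply e.map_injective
    rw [e.map_preimage, Iso.eq_comp_inv]
    exact hu _ ((key f').mp hf')
  · intro Y c
    have key : ∀ f : X' ⟶ Y, a'.hom ≫ f = H'.map f ≫ c ↔ a.hom ≫ i.inv ≫ e.map f =
        H.map (i.inv ≫ e.map f) ≫ θ.inv.app Y ≫ e.map c := by
      intro f
      have hn : H.map (e.map f) ≫ θ.inv.app Y = θ.inv.app X' ≫ e.map (H'.map f) :=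
        θ.inv.naturality f
      rw [← e.map_injective.eq_iff, e.map_comp, e.map_comp, h, H.map_comp]
      simp only [Category.assoc]
      rw [reassoc_of% hn]
      rw [← cancel_epi (θ.hom.app X' ≫ H.map i.hom)]
      simp only [Category.assoc, ← H.map_comp_assoc, i.hom_inv_id, CategoryTheory.Functor.map_id,
        Category.id_comp, Iso.hom_inv_id_app_assoc]
    obtain ⟨f, hf, hu⟩ := ha (e.obj Y) (θ.inv.app Y ≫ e.map c)
    refine ⟨e.preimage (i.hom ≫ f), (key _).mpr (by simpa using hf), ?_⟩
    intro f' hf'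
    apply e.map_injective
    rw [e.map_preimage, ← Iso.inv_comp_eq]
    exact hu _ ((key f').mp hf')

/-- `K` is a parametric fixed point: `κ_x : H (x, K x) ≅ K x` is natural in `x` and extremal for
every `x`. -/
def IsParamFix (b : Bool) {A : Type u₂} [Category.{v₂} A] {D : Type u₁} [Category.{v₁} D]
    (H : A × D ⥤ D) (K : A ⥤ D) : Prop :=
  ∃ κ : Functor.prod' (𝟭 A) K ⋙ H ≅ K, ∀ x, IsExtremal b (fixFst H x) (K.obj x) (κ.app x)

/-- Parametric fixed points are transported along reindexings of the parameter and along
equivalences. -/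
theorem IsParamFix.of_equiv {b : Bool} {A : Type*} [Category* A] {A' : Type*} [Category* A']
    {D : Type*} [Category* D] {D' : Type*} [Category* D'] {H : A × D ⥤ D} {H' : A' × D' ⥤ D'}
    (F : A' ⥤ A) (e : D' ⥤ D) [e.IsEquivalence] (θ : H' ⋙ e ≅ F.prod e ⋙ H) {K : A ⥤ D}
    (hK : IsParamFix b H K) : IsParamFix b H' (F ⋙ K ⋙ e.inv) := by
  obtain ⟨κ, hκ⟩ := hK
  let i : (F ⋙ K ⋙ e.inv) ⋙ e ≅ F ⋙ K := Functor.isoWhiskerLeft (F ⋙ K) e.asEquivalence.counitIso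
  let ψ : Functor.prod' (𝟭 A') (F ⋙ K ⋙ e.inv) ⋙ F.prod e ≅ F ⋙ Functor.prod' (𝟭 A) K :=
    NatIso.ofComponents (fun x => Iso.prod (Iso.refl (F.obj x)) (i.app x)) (fun {x y} f => by
      refine Prod.ext ?_ (i.hom.naturality f)
      exact (Category.comp_id _).trans (Category.id_comp _).symm)
  let φ : (Functor.prod' (𝟭 A') (F ⋙ K ⋙ e.inv) ⋙ H') ⋙ e ≅ (F ⋙ K ⋙ e.inv) ⋙ e :=
    Functor.isoWhiskerLeft (Functor.prod' (𝟭 A') (F ⋙ K ⋙ e.inv)) θ ≪≫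
      Functor.isoWhiskerRight ψ H ≪≫ Functor.isoWhiskerLeft F κ ≪≫ i.symm
  refine ⟨NatIso.ofComponents (fun x => e.preimageIso (φ.app x)) ?_, ?_⟩
  · intro x y f
    apply e.map_injective
    rw [e.map_comp, e.map_comp]
    refine (congrArg (_ ≫ ·) (e.map_preimage _)).trans
      (Eq.trans ?_ (congrArg (· ≫ _) (e.map_preimage _)).symm)
    exact φ.hom.naturality f
  · intro x
    let θ' : fixFst H' x ⋙ e ≅ e ⋙ fixFst H (F.obj x) :=
      NatIso.ofComponents (fun Y => θ.app (x, Y)) (fun {Y Z} g => by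
        refine (θ.hom.naturality ((𝟙 x, g) : (x, Y) ⟶ (x, Z))).trans (congrArg (_ ≫ ·) ?_)
        exact congrArg H.map (Prod.ext (F.map_id x) rfl))
    refine (hκ (F.obj x)).of_equiv e θ' (i.app x) ?_
    refine (e.map_preimage _).trans ?_
    rfl

/-! ### Parametric fixed points of `step` -/

section

variable {C : Type u} [Category.{v} C] [HasFiniteLimits C] [LocallyCartesianClosed C]
  {S U B : C} {u : S ⟶ U} {h : B ⟶ S} {t : B ⟶ U} (τ : Trees u h t)

/-- If the trees are an initial algebra or a terminal coalgebra then the decorated trees are a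
parametric fixed point, with the decorations as the parameter. -/
theorem Trees.isParamFix_dec {b : Bool} {a : (piPullback h t ⋙ Over.map u).obj τ.W ≅ τ.W}
    (ha : a.inv = τ.str) (hτ : IsExtremal b (piPullback h t ⋙ Over.map u) τ.W a) :
    IsParamFix b (step u h t) τ.dec := by
  have hw : τ.w ≫ a.hom.left = 𝟙 _ := by
    have := congrArg Over.Hom.left a.inv_hom_id
    rwa [ha] at this
  have hw' : a.hom.left ≫ τ.w = 𝟙 _ := by
    have := congrArg Over.Hom.left a.hom_inv_id
    rwa [ha] at this
  have : IsIso τ.w := ⟨a.hom.left, hw, hw'⟩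
  have := fun N => τ.isIso_decStr N
  let κ : τ.dec ≅ Functor.prod' (𝟭 _) τ.dec ⋙ step u h t :=
    NatIso.ofComponents (fun N => @asIso _ _ _ _ (τ.decStr N) (this N))
      (fun g => τ.decStr_naturality g)
  refine ⟨κ.symm, fun N => ?_⟩
  cases b
  · have h : IsTermCoalg _ τ.W a.inv := hτ
    rw [ha] at h
    exact τ.isTermCoalg_dec h N
  · exact τ.isInitAlg_dec hτ (by rw [← ha, a.hom_inv_id]) (by rw [← ha, a.inv_hom_id]) N _
      (κ.inv_hom_id_app N) (κ.hom_inv_id_app N)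

/-- `step` has parametric fixed points, and they are polynomial. -/
theorem exists_isParamFix_step [FinitaryExtensive C] [HasDependentWTypes C] [HasDependentMTypes C]
    (b : Bool) (u : S ⟶ U) (h : B ⟶ S) (t : B ⟶ U) :
    ∃ (W Q : C) (q : Q ⟶ W) (l : Q ⟶ S) (w : W ⟶ U),
      IsParamFix b (step u h t) (piPullback q l ⋙ Over.map w) := by
  obtain ⟨W, a, ha⟩ : ∃ (W : Over U) (a : (piPullback h t ⋙ Over.map u).obj W ≅ W),
      IsExtremal b (piPullback h t ⋙ Over.map u) W a := by
    let D : DepContainer C U U := ⟨B, S, t, h, u⟩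
    cases b
    · have := HasDependentMTypes.hasTerminal U D
      have h := IsTermCoalg.of_isTerminal (terminalIsTerminal (C := Endofunctor.Coalgebra D.functor))
      have := h.isIso
      exact ⟨_, (asIso (⊤_ Endofunctor.Coalgebra D.functor).str).symm, h⟩
    · have := HasDependentWTypes.hasInitial U D
      have h := IsInitAlg.of_isInitial (initialIsInitial (C := Endofunctor.Algebra D.functor))
      have := h.isIso
      exact ⟨_, @asIso _ _ _ _ _ this, h⟩
  obtain ⟨τ, rfl, hw⟩ := Trees.exists (u := u) (h := h) (t := t) W a.inv.left (by
    rw [← Over.w a.inv]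
    exact Category.assoc _ _ _)
  exact ⟨_, _, _, _, _, τ.isParamFix_dec (Over.OverMorphism.ext (eq_of_heq hw).symm) ha⟩

end

/-! ### Polynomial functors and their left adjoints -/

section

variable {C : Type u} [Category.{v} C] [HasPullbacks C]

/-- The Beck–Chevalley isomorphism for `Σ` and pullback. -/
def mapPullbackIso {W Q S A P T : C} (q : Q ⟶ W) (l : Q ⟶ S) (h : A ⟶ S) (t : A ⟶ T) {pQ : P ⟶ Q}
    {pA : P ⟶ A} (hP : IsPullback pQ pA l h) :
    (Over.pullback q ⋙ Over.map l) ⋙ Over.pullback h ⋙ Over.map t ≅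
      Over.pullback (pQ ≫ q) ⋙ Over.map (pA ≫ t) :=
  NatIso.ofComponents (fun Z => by
    let fw : pullback (pullback.snd Z.hom q ≫ l) h ⟶ pullback Z.hom (pQ ≫ q) :=
      pullback.lift (pullback.fst _ _ ≫ pullback.fst _ _)
        (hP.lift (pullback.fst _ _ ≫ pullback.snd _ _) (pullback.snd _ _)
          (by rw [Category.assoc, pullback.condition]))
        (by rw [hP.lift_fst_assoc, Category.assoc, Category.assoc, pullback.condition])
    let bw : pullback Z.hom (pQ ≫ q) ⟶ pullback (pullback.snd Z.hom q ≫ l) h :=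
      pullback.lift (pullback.lift (pullback.fst _ _) (pullback.snd _ _ ≫ pQ)
        (by rw [Category.assoc, pullback.condition])) (pullback.snd _ _ ≫ pA)
        (by rw [pullback.lift_snd_assoc, Category.assoc, hP.w, Category.assoc])
    refine Over.isoMk ⟨fw, bw, ?_, ?_⟩ ?_
    · change fw ≫ bw = 𝟙 _
      ext <;> simp [fw, bw]
    · change bw ≫ fw = 𝟙 _
      apply pullback.hom_ext
      · simp [fw, bw]
      · apply hP.hom_ext <;> simp [fw, bw]
    · change fw ≫ pullback.snd _ _ ≫ pA ≫ t = pullback.snd _ _ ≫ t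
      simp [fw]) (by
    intro Z Z' f
    ext
    apply pullback.hom_ext
    · change (pullback.lift (pullback.fst _ _ ≫ pullback.lift (pullback.fst _ _ ≫ f.left) _ _) _ _ ≫
        pullback.lift _ _ _) ≫ pullback.fst _ _ =
        (pullback.lift _ _ _ ≫ pullback.lift _ _ _) ≫ pullback.fst _ _
      simp
    · apply hP.hom_ext
      · change ((pullback.lift (pullback.fst _ _ ≫ pullback.lift (pullback.fst _ _ ≫ f.left) _ _) _ _ ≫
          pullback.lift _ _ _) ≫ pullback.snd _ _) ≫ pQ =
          ((pullback.lift _ _ _ ≫ pullback.lift _ _ _) ≫ pullback.snd _ _) ≫ pQ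
        simp
      · change ((pullback.lift (pullback.fst _ _ ≫ pullback.lift (pullback.fst _ _ ≫ f.left) _ _) _ _ ≫
          pullback.lift _ _ _) ≫ pullback.snd _ _) ≫ pA =
          ((pullback.lift _ _ _ ≫ pullback.lift _ _ _) ≫ pullback.snd _ _) ≫ pA
        simp)

/-- The functor `Y ↦ (Σ_{t i} (h i)^* Y)_i`. -/
def polyLeft {ι : Type} {I : ι → C} {S : C} {A : ι → C} (h : ∀ i, A i ⟶ S) (t : ∀ i, A i ⟶ I i) :
    Over S ⥤ ∀ i, Over (I i) :=
  Functor.pi' fun i => Over.pullback (h i) ⋙ Over.map (t i)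

/-- The Beck–Chevalley isomorphism, for families. -/
def mapPullbackPolyLeft {ι : Type} {I : ι → C} {W Q S : C} {A P : ι → C} (q : Q ⟶ W) (l : Q ⟶ S)
    (h : ∀ i, A i ⟶ S) (t : ∀ i, A i ⟶ I i) {pQ : ∀ i, P i ⟶ Q} {pA : ∀ i, P i ⟶ A i}
    (hP : ∀ i, IsPullback (pQ i) (pA i) l (h i)) :
    (Over.pullback q ⋙ Over.map l) ⋙ polyLeft h t ≅
      polyLeft (fun i => pQ i ≫ q) (fun i => pA i ≫ t i) :=
  NatIso.pi' fun i => mapPullbackIso q l (h i) (t i) (hP i)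

/-- The product of two adjunctions. -/
def prodAdj {A₁ A₂ B₁ B₂ : Type*} [Category* A₁] [Category* A₂] [Category* B₁] [Category* B₂]
    {L₁ : A₁ ⥤ B₁} {R₁ : B₁ ⥤ A₁} {L₂ : A₂ ⥤ B₂} {R₂ : B₂ ⥤ A₂} (adj₁ : L₁ ⊣ R₁) (adj₂ : L₂ ⊣ R₂) :
    L₁.prod L₂ ⊣ R₁.prod R₂ :=
  Adjunction.mkOfHomEquiv
    { homEquiv := fun X Y => Equiv.prodCongr (adj₁.homEquiv X.1 Y.1) (adj₂.homEquiv X.2 Y.2)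
      homEquiv_naturality_left_symm := fun f g => Prod.ext
        (adj₁.homEquiv_naturality_left_symm f.1 g.1) (adj₂.homEquiv_naturality_left_symm f.2 g.2)
      homEquiv_naturality_right := fun f g => Prod.ext
        (adj₁.homEquiv_naturality_right f.1 g.1) (adj₂.homEquiv_naturality_right f.2 g.2) }

/-- The diagonal of a slice category is left adjoint to the binary product. -/
def diagSliceProdAdj (S : C) : Functor.prod' (𝟭 (Over S)) (𝟭 (Over S)) ⊣ sliceProd S :=
  Adjunction.mkOfHomEquiv
    { homEquiv := fun Y X =>
        { toFun := fun f => Over.homMk (pullback.lift f.1.left f.2.left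
            ((Over.w f.1).trans (Over.w f.2).symm)) (by
              change pullback.lift _ _ _ ≫ pullback.fst _ _ ≫ _ = _
              rw [pullback.lift_fst_assoc]
              exact Over.w f.1)
          invFun := fun g => (Over.homMk (g.left ≫ pullback.fst _ _)
              ((Category.assoc _ _ _).trans (Over.w g)),
            Over.homMk (g.left ≫ pullback.snd _ _)
              ((Category.assoc _ _ _).trans ((congrArg (g.left ≫ ·)
                pullback.condition.symm).trans (Over.w g))))
          left_inv := fun f => Prod.ext (Over.OverMorphism.ext (pullback.lift_fst _ _ _))
            (Over.OverMorphism.ext (pullback.lift_snd _ _ _))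
          right_inv := fun g => by
            ext
            exact pullback.hom_ext (pullback.lift_fst _ _ _) (pullback.lift_snd _ _ _) }
      homEquiv_naturality_left_symm := fun f g => Prod.ext
        (Over.OverMorphism.ext (Category.assoc _ _ _)) (Over.OverMorphism.ext (Category.assoc _ _ _))
      homEquiv_naturality_right := fun f g => by
        ext
        apply pullback.hom_ext
        · refine (pullback.lift_fst _ _ _).trans (Eq.symm ?_)
          refine (Category.assoc _ _ _).trans ((congrArg (_ ≫ ·) (pullback.lift_fst _ _ _)).trans ?_)
          exact pullback.lift_fst_assoc _ _ _ _
        · refine (pullback.lift_snd _ _ _).trans (Eq.symm ?_)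
          refine (Category.assoc _ _ _).trans ((congrArg (_ ≫ ·) (pullback.lift_snd _ _ _)).trans ?_)
          exact pullback.lift_snd_assoc _ _ _ _ }

end

section

variable {C : Type u} [Category.{v} C] [HasFiniteLimits C] [LocallyCartesianClosed C]

/-- The right adjoint sends `X` to the fibre product over `S` of the objects `Π_{h i} (t i)^* (X i)`. -/
theorem polyLeft_isLeftAdjoint {ι : Type} [Finite ι] {I : ι → C} {S : C} {A : ι → C}
    (h : ∀ i, A i ⟶ S) (t : ∀ i, A i ⟶ I i) : (polyLeft h t).IsLeftAdjoint := by
  have : HasFiniteProducts (Over S) :=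
    Over.ConstructProducts.over_finiteProducts_of_finiteWidePullbacks
  let e : ∀ (Y : Over S) (X : ∀ i, Over (I i)), ((polyLeft h t).obj Y ⟶ X) ≃
      (Y ⟶ ∏ᶜ fun i => (piPullback (h i) (t i)).obj (X i)) := fun Y X =>
    (Equiv.piCongrRight fun i => (piPullbackAdj (h i) (t i)).homEquiv Y (X i)).trans
      { toFun := fun f => Pi.lift f
        invFun := fun g i => g ≫ Pi.π _ i
        left_inv := fun f => by ext; simp
        right_inv := fun g => by ext; simp }
  refine (Adjunction.adjunctionOfEquivRight e ?_).isLeftAdjoint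
  intro Y' Y X f g
  refine Pi.hom_ext _ _ fun i => ?_
  rw [Category.assoc]
  refine (Pi.lift_π _ _).trans (Eq.trans ?_ (congrArg (f ≫ ·)
    (Pi.lift_π (fun i => (piPullbackAdj (h i) (t i)).homEquiv Y (X i) (g i)) i).symm))
  exact (piPullbackAdj (h i) (t i)).homEquiv_naturality_left f (g i)

end

section

variable {C : Type u} [Category.{v} C]

/-- Split off the last component of a family. -/
def splitLast {k : ℕ} (J : Fin (k + 1) → C) :
    (∀ i, Over (J i)) ⥤ (∀ j : Fin k, Over (J j.castSucc)) × Over (J (Fin.last k)) :=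
  Functor.prod' (Functor.pi' fun j => Pi.eval (fun i => Over (J i)) j.castSucc)
    (Pi.eval (fun i => Over (J i)) (Fin.last k))

theorem splitLast_isEquivalence {k : ℕ} (J : Fin (k + 1) → C) : (splitLast J).IsEquivalence where
  faithful := ⟨fun {X Y f g} h => by
    funext i
    refine Fin.lastCases ?_ (fun j => ?_) i
    · exact congrArg Prod.snd h
    · exact congrFun (congrArg Prod.fst h) j⟩
  full := ⟨fun {X Y} f => ⟨fun i => Fin.lastCases (motive := fun i => X i ⟶ Y i) f.2 f.1 i, by
    refine Prod.ext (funext fun j => ?_) ?_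
    · exact Fin.lastCases_castSucc (motive := fun i => X i ⟶ Y i) _
    · exact Fin.lastCases_last (motive := fun i => X i ⟶ Y i)⟩⟩
  essSurj := ⟨fun X => ⟨fun i => Fin.lastCases (motive := fun i => Over (J i)) X.2 X.1 i,
    ⟨eqToIso (Prod.ext
      (funext fun j => Fin.lastCases_castSucc (motive := fun i => Over (J i)) _)
      (Fin.lastCases_last (motive := fun i => Over (J i))))⟩⟩⟩

end

section

variable {C : Type u} [Category.{v} C] [FinitaryExtensive C] {ι : Type} [Finite ι]

theorem isPullback_sigmaMap {A I : ι → C} (t : ∀ i, A i ⟶ I i) (i : ι) :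
    IsPullback (Sigma.ι A i) (t i) (Limits.Sigma.map t) (Sigma.ι I i) := by
  have := FinitaryExtensive.isVanKampen_finiteCoproducts (colimit.isColimit (Discrete.functor I))
    (colimit.cocone (Discrete.functor A)) (Discrete.natTrans fun i => t i.as) (Limits.Sigma.map t)
    (by
      ext ⟨i⟩
      exact (Sigma.ι_map (f := A) t i).symm) (NatTrans.Equifibered.of_discrete _)
  exact this.mp ⟨colimit.isColimit _⟩ ⟨i⟩

variable [HasFiniteLimits C]

theorem isIso_sigmaDesc_pullback {I : ι → C} (Y : Over (∐ I)) :
    IsIso (Sigma.desc fun i => pullback.fst Y.hom (Sigma.ι I i)) := by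
  have := FinitaryExtensive.isVanKampen_finiteCoproducts (colimit.isColimit (Discrete.functor I))
    (Cofan.mk Y.left fun i => pullback.fst Y.hom (Sigma.ι I i))
    (Discrete.natTrans fun i => pullback.snd Y.hom (Sigma.ι I i.as)) Y.hom
    (by
      ext ⟨i⟩
      exact pullback.condition.symm) (NatTrans.Equifibered.of_discrete _)
  exact (Cofan.nonempty_isColimit_iff_isIso_sigmaDesc _).mp
    (this.mpr fun ⟨i⟩ => IsPullback.of_hasPullback Y.hom (Sigma.ι I i))

/-- Extensivity: pulling back along the coproduct inclusions is inverse to `overSigma`. -/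
def overSigmaAdj (I : ι → C) :
    polyLeft (fun i => Sigma.ι I i) (fun i => 𝟙 (I i)) ⊣ overSigma I := by
  let η : 𝟭 _ ≅ overSigma I ⋙ polyLeft (fun i => Sigma.ι I i) (fun i => 𝟙 (I i)) :=
    NatIso.pi' fun i => NatIso.ofComponents (fun X => Over.isoMk
      (isPullback_sigmaMap (fun i => (X i).hom) i).isoPullback (by
        refine (congrArg (_ ≫ ·) (Category.comp_id _)).trans ?_
        exact IsPullback.isoPullback_hom_snd _)) (by
        intro X Y f
        ext
        apply pullback.hom_ext
        · refine (Category.assoc _ _ _).trans ((congrArg (_ ≫ ·)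
            (IsPullback.isoPullback_hom_fst _)).trans (Eq.symm ?_))
          refine (Category.assoc _ _ _).trans ((congrArg (_ ≫ ·) (pullback.lift_fst _ _ _)).trans ?_)
          refine (Category.assoc _ _ _).symm.trans ((congrArg (· ≫ _)
            (IsPullback.isoPullback_hom_fst _)).trans ?_)
          exact Sigma.ι_map (fun i => (f i).left) i
        · refine (Category.assoc _ _ _).trans ((congrArg (_ ≫ ·)
            (IsPullback.isoPullback_hom_snd _)).trans (Eq.symm ?_))
          refine (Category.assoc _ _ _).trans ((congrArg (_ ≫ ·) (pullback.lift_snd _ _ _)).trans ?_)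
          exact (IsPullback.isoPullback_hom_snd _).trans (Over.w (f i)).symm)
  let ε : polyLeft (fun i => Sigma.ι I i) (fun i => 𝟙 (I i)) ⋙ overSigma I ≅ 𝟭 _ :=
    NatIso.ofComponents (fun Y => Over.isoMk
      (@asIso _ _ _ _ _ (isIso_sigmaDesc_pullback Y)) (by
        apply Sigma.hom_ext
        intro i
        change Sigma.ι _ i ≫ Sigma.desc (fun i => pullback.fst Y.hom (Sigma.ι I i)) ≫ Y.hom =
          Sigma.ι _ i ≫ Limits.Sigma.map fun i => pullback.snd Y.hom (Sigma.ι I i) ≫ 𝟙 (I i)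
        rw [Sigma.ι_desc_assoc, Sigma.ι_map, Category.comp_id, pullback.condition])) (by
        intro X Y f
        ext
        apply Sigma.hom_ext
        intro i
        let m : ∀ i, pullback X.hom (Sigma.ι I i) ⟶ pullback Y.hom (Sigma.ι I i) := fun i =>
          ((polyLeft (fun i => Sigma.ι I i) (fun i => 𝟙 (I i))).map f i).left
        have hm : m i ≫ pullback.fst _ _ = pullback.fst _ _ ≫ f.left := pullback.lift_fst _ _ _
        change Sigma.ι (fun i => pullback X.hom (Sigma.ι I i)) i ≫ Limits.Sigma.map m ≫
            (Sigma.desc fun i => pullback.fst Y.hom (Sigma.ι I i)) =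
          Sigma.ι (fun i => pullback X.hom (Sigma.ι I i)) i ≫
            (Sigma.desc fun i => pullback.fst X.hom (Sigma.ι I i)) ≫ f.left
        rw [Sigma.ι_map_assoc, Sigma.ι_desc, Sigma.ι_desc_assoc, hm])
  exact (CategoryTheory.Equivalence.mk _ _ η ε).symm.toAdjunction

variable [LocallyCartesianClosed C]

/-- A functor is polynomial iff, up to the map `Σ_u`, it has a left adjoint of the form
`polyLeft h t`. -/
theorem isPolynomialFibre_iff {I : ι → C} {J : C} (G : (∀ i, Over (I i)) ⥤ Over J) :
    IsPolynomialFibre G ↔ ∃ (S : C) (u : S ⟶ J) (A : ι → C) (h : ∀ i, A i ⟶ S)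
      (t : ∀ i, A i ⟶ I i) (R : (∀ i, Over (I i)) ⥤ Over S) (_ : polyLeft h t ⊣ R),
      Nonempty (G ≅ R ⋙ Over.map u) := by
  constructor
  · rintro ⟨⟨A, S, a, p, u⟩, ⟨e⟩⟩
    have adj := ((piPullbackAdj p a).comp (overSigmaAdj I)).ofNatIsoLeft
      (mapPullbackPolyLeft p a _ _ (fun i => IsPullback.of_hasPullback a (Sigma.ι I i)))
    exact ⟨S, u, _, _, _, _, adj, ⟨e⟩⟩
  · rintro ⟨S, u, A, h, t, R, adj, ⟨e⟩⟩
    let a : ∐ A ⟶ ∐ I := Limits.Sigma.map t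
    let p : ∐ A ⟶ S := Sigma.desc h
    have adj' := ((piPullbackAdj p a).comp (overSigmaAdj I)).ofNatIsoLeft
      (mapPullbackPolyLeft p a _ _ (fun i => isPullback_sigmaMap t i))
    have h₁ : (fun i => Sigma.ι A i ≫ p) = h := funext fun i => Sigma.ι_desc _ _
    have h₂ : (fun i => t i ≫ 𝟙 (I i)) = t := funext fun i => Category.comp_id _
    rw [h₁, h₂] at adj'
    exact ⟨⟨∐ A, S, a, p, u⟩, ⟨e ≪≫
      Functor.isoWhiskerRight (Adjunction.rightAdjointUniq adj adj') (Over.map u)⟩⟩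

theorem IsPolynomialFibre.of_iso {I : ι → C} {J : C} {G G' : (∀ i, Over (I i)) ⥤ Over J}
    (hG : IsPolynomialFibre G) (e : G' ≅ G) : IsPolynomialFibre G' := by
  obtain ⟨D, ⟨i⟩⟩ := hG
  exact ⟨D, ⟨e ≪≫ i⟩⟩

theorem IsPolynomialFibre.comp_map {I : ι → C} {J J' : C} {G : (∀ i, Over (I i)) ⥤ Over J}
    (hG : IsPolynomialFibre G) (m : J ⟶ J') : IsPolynomialFibre (G ⋙ Over.map m) := by
  obtain ⟨⟨A, S, a, p, u⟩, ⟨i⟩⟩ := hG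
  exact ⟨⟨A, S, a, p, u ≫ m⟩, ⟨Functor.isoWhiskerRight i (Over.map m) ≪≫
    Functor.isoWhiskerLeft (overSigma I ⋙ Over.pullback a ⋙ internalPi p) (Over.mapComp u m).symm⟩⟩

/-- A polynomial functor has parametric fixed points, and they are polynomial. The fixed point is taken
in the last variable; `H` is the functor `G` with this variable split off. -/
theorem exists_isParamFix_of_isPolynomialFibre [HasDependentWTypes C] [HasDependentMTypes C]
    (b : Bool) {k : ℕ} {J : Fin (k + 1) → C}
    {G : (∀ i, Over (J i)) ⥤ Over (J (Fin.last k))} (hG : IsPolynomialFibre G) :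
    ∃ K : (∀ j : Fin k, Over (J j.castSucc)) ⥤ Over (J (Fin.last k)), IsPolynomialFibre K ∧
      ∀ H : (∀ j : Fin k, Over (J j.castSucc)) × Over (J (Fin.last k)) ⥤ Over (J (Fin.last k)),
        Nonempty (splitLast J ⋙ H ≅ G) → IsParamFix b H K := by
  obtain ⟨S, u, A, h, t, R, adj, ⟨e⟩⟩ := (isPolynomialFibre_iff G).mp hG
  have := splitLast_isEquivalence J
  let h₀ := fun j : Fin k => h j.castSucc
  let t₀ := fun j : Fin k => t j.castSucc
  have := polyLeft_isLeftAdjoint h₀ t₀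
  -- the factor of `R` which depends only on the parameters
  let N := (polyLeft h₀ t₀).rightAdjoint
  let adjN : polyLeft h₀ t₀ ⊣ N := Adjunction.ofIsLeftAdjoint _
  let h₁ := h (Fin.last k)
  let t₁ := t (Fin.last k)
  obtain ⟨W, Q, q, l, w, hK⟩ := exists_isParamFix_step b u h₁ t₁
  -- the inverse of the identity is the form in which `IsParamFix.of_equiv` gives the fixed point
  refine ⟨N ⋙ (piPullback q l ⋙ Over.map w) ⋙ (𝟭 _ : _ ⥤ Over (J (Fin.last k))).inv, ?_, ?_⟩
  · have adj' := ((piPullbackAdj q l).comp adjN).ofNatIsoLeft (mapPullbackPolyLeft q l h₀ t₀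
      (fun j => IsPullback.of_hasPullback l (h₀ j)))
    exact (isPolynomialFibre_iff _).mpr ⟨W, w, _, _, _, N ⋙ piPullback q l, adj',
      ⟨Functor.isoWhiskerLeft (N ⋙ piPullback q l ⋙ Over.map w)
        (𝟭 (Over (J (Fin.last k)))).asEquivalence.counitIso⟩⟩
  · rintro H ⟨i⟩
    let E := (splitLast J).asEquivalence
    -- `R` is the fibre product of `N` and `Π_{h₁} t₁^*`, having the same left adjoint
    have adj₁ : polyLeft h t ⋙ splitLast J ⊣ E.inverse ⋙ R := adj.comp E.toAdjunction
    have adj₂ : polyLeft h t ⋙ splitLast J ⊣ N.prod (piPullback h₁ t₁) ⋙ sliceProd S :=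
      (diagSliceProdAdj S).comp (prodAdj adjN (piPullbackAdj h₁ t₁))
    have j : H ≅ N.prod (𝟭 _) ⋙ step u h₁ t₁ :=
      (Functor.isoWhiskerRight E.counitIso H).symm ≪≫ Functor.isoWhiskerLeft E.inverse (i ≪≫ e) ≪≫
        Functor.isoWhiskerRight (Adjunction.rightAdjointUniq adj₁ adj₂) (Over.map u)
    exact hK.of_equiv N (𝟭 _) j

end

/-! ### Morphisms of containers over a given map of shapes -/

section

variable {C : Type u} [Category.{v} C] [HasPullbacks C]

namespace Container.Hom

variable {P Q R : Container C}

/-- The backward map of `f` on generalized elements. -/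
def bk (f : P ⟶ Q) {Z : C} (q : Z ⟶ Q.dir) (i : Z ⟶ P.shape) (h : q ≫ Q.hom = i ≫ f.fwd) :
    Z ⟶ P.dir :=
  pullback.lift q i h ≫ f.back

theorem bk_hom (f : P ⟶ Q) {Z : C} (q : Z ⟶ Q.dir) (i : Z ⟶ P.shape)
    (h : q ≫ Q.hom = i ≫ f.fwd) : bk f q i h ≫ P.hom = i := by
  simp [bk, f.w]

theorem comp_bk (f : P ⟶ Q) {Y Z : C} (w : Y ⟶ Z) (q : Z ⟶ Q.dir) (i : Z ⟶ P.shape)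
    (h : q ≫ Q.hom = i ≫ f.fwd) :
    w ≫ bk f q i h = bk f (w ≫ q) (w ≫ i) (by simp [h]) := by
  unfold bk
  rw [← Category.assoc]
  congr 1
  ext <;> simp

theorem bk_congr {f g : P ⟶ Q} (hf : f = g) {Z : C} {q q' : Z ⟶ Q.dir} {i i' : Z ⟶ P.shape}
    (hq : q = q') (hi : i = i') (h : q ≫ Q.hom = i ≫ f.fwd) :
    bk f q i h = bk g q' i' (by rw [← hf, ← hq, ← hi, h]) := by
  subst hf hq hi
  rfl

theorem id_bk {Z : C} (q : Z ⟶ P.dir) (i : Z ⟶ P.shape)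
    (h : q ≫ P.hom = i ≫ Container.Hom.fwd (𝟙 P)) : bk (𝟙 P) q i h = q :=
  pullback.lift_fst _ _ _

theorem bk_comp (f : P ⟶ Q) (g : Q ⟶ R) {Z : C} (r : Z ⟶ R.dir) (i : Z ⟶ P.shape)
    (h : r ≫ R.hom = i ≫ (f ≫ g).fwd) :
    bk (f ≫ g) r i h = bk f (bk g r (i ≫ f.fwd) (by simpa using h)) i (bk_hom _ _ _ _) := by
  refine (Category.assoc _ _ _).symm.trans (congrArg (· ≫ f.back) ?_)
  apply pullback.hom_ext
  · refine (Category.assoc _ _ _).trans ((congrArg (_ ≫ ·) (pullback.lift_fst _ _ _)).trans ?_)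
    refine (Category.assoc _ _ _).symm.trans (Eq.trans ?_ (pullback.lift_fst _ _ _).symm)
    refine congrArg (· ≫ g.back) ?_
    apply pullback.hom_ext
    · refine (Category.assoc _ _ _).trans ((congrArg (_ ≫ ·) (pullback.lift_fst _ _ _)).trans ?_)
      exact (pullback.lift_fst _ _ _).trans (pullback.lift_fst _ _ _).symm
    · refine (Category.assoc _ _ _).trans ((congrArg (_ ≫ ·) (pullback.lift_snd _ _ _)).trans ?_)
      exact (pullback.lift_snd_assoc _ _ _ _).trans (pullback.lift_snd _ _ _).symm
  · refine (Category.assoc _ _ _).trans ((congrArg (_ ≫ ·) (pullback.lift_snd _ _ _)).trans ?_)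
    exact (pullback.lift_snd _ _ _).trans (pullback.lift_snd _ _ _).symm

theorem bk_eq_back (f : P ⟶ Q) : bk f (pullback.fst Q.hom f.fwd) (pullback.snd _ _)
    pullback.condition = f.back := by
  refine Eq.trans (congrArg (· ≫ f.back) ?_) (Category.id_comp _)
  apply pullback.hom_ext <;> simp

theorem hom_ext {f g : P ⟶ Q} (h₁ : f.fwd = g.fwd)
    (h₂ : ∀ {Z : C} (q : Z ⟶ Q.dir) (i : Z ⟶ P.shape) (h : q ≫ Q.hom = i ≫ f.fwd),
      bk f q i h = bk g q i (by rw [← h₁, h])) : f = g := by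
  refine Container.Hom.ext_lift h₁ ?_
  exact (h₂ _ _ _).symm.trans (bk_eq_back f)

theorem isIso_back (f : P ⟶ Q) [IsIso f] : IsIso f.back := by
  have hfi : f.fwd ≫ (inv f).fwd = 𝟙 _ := by rw [← comp_fwd, IsIso.hom_inv_id]; rfl
  have hif : (inv f).fwd ≫ f.fwd = 𝟙 _ := by rw [← comp_fwd, IsIso.inv_hom_id]; rfl
  have h₁ : 𝟙 _ ≫ P.hom = (P.hom ≫ f.fwd) ≫ (inv f).fwd := by
    rw [Category.assoc, hfi, Category.comp_id, Category.id_comp]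
  let b : P.dir ⟶ pullback Q.hom f.fwd := pullback.lift (bk (inv f) (𝟙 _) (P.hom ≫ f.fwd) h₁) P.hom
    (bk_hom _ _ _ _)
  refine ⟨b, ?_, ?_⟩
  · apply pullback.hom_ext
    · refine (Category.assoc _ _ _).trans ((congrArg (f.back ≫ ·) (pullback.lift_fst _ _ _)).trans ?_)
      refine (comp_bk _ _ _ _ _).trans ?_
      have h₂ : pullback.fst Q.hom f.fwd ≫ Q.hom =
          (pullback.fst Q.hom f.fwd ≫ Q.hom) ≫ (inv f ≫ f).fwd := by
        rw [IsIso.inv_hom_id]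
        exact (Category.comp_id _).symm
      refine Eq.trans ?_ ((bk_comp (inv f) f (pullback.fst Q.hom f.fwd)
        (pullback.fst _ _ ≫ Q.hom) h₂).symm.trans ?_)
      · refine bk_congr rfl ?_ ?_ _
        · rw [Category.comp_id, ← bk_eq_back]
          refine bk_congr rfl rfl ?_ _
          rw [pullback.condition, Category.assoc, hfi, Category.comp_id]
        · rw [← Category.assoc, f.w, pullback.condition]
      · refine (bk_congr (IsIso.inv_hom_id f) rfl rfl _).trans ((id_bk _ _ _).trans ?_)
        exact (Category.id_comp _).symm
    · refine (Category.assoc _ _ _).trans ((congrArg (f.back ≫ ·) (pullback.lift_snd _ _ _)).trans ?_)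
      rw [f.w, Category.id_comp]
  · have h₂ : 𝟙 P.dir ≫ P.hom = P.hom ≫ (f ≫ inv f).fwd := by
      rw [IsIso.hom_inv_id, Category.id_comp]
      exact (Category.comp_id _).symm
    refine (bk_comp f (inv f) (𝟙 _) P.hom h₂).symm.trans ?_
    exact (bk_congr (IsIso.hom_inv_id f) rfl rfl _).trans (id_bk _ _ _)

end Container.Hom

open Container.Hom

theorem IsCartesian.of_isIso {P Q : Container C} (f : P ⟶ Q) [IsIso f] : IsCartesian f :=
  isIso_back f

theorem IsCartesian.comp {P Q R : Container C} {f : P ⟶ Q} {g : Q ⟶ R} (hf : IsCartesian f)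
    (hg : IsCartesian g) : IsCartesian (f ≫ g) := by
  have : IsIso f.back := hf
  have : IsIso g.back := hg
  let l : pullback R.hom (f ≫ g).fwd ⟶ pullback Q.hom f.fwd := pullback.lift
    (bk g (pullback.fst _ _) (pullback.snd R.hom (f ≫ g).fwd ≫ f.fwd)
      (by rw [pullback.condition, comp_fwd, Category.assoc])) (pullback.snd _ _) (bk_hom _ _ _ _)
  have hb : (f ≫ g).back = l ≫ f.back := (bk_eq_back _).symm.trans (bk_comp _ _ _ _ _)
  have hg' : inv g.back ≫ pullback.snd _ _ = Q.hom := by rw [← g.w, IsIso.inv_hom_id_assoc]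
  let m : pullback Q.hom f.fwd ⟶ pullback R.hom (f ≫ g).fwd := pullback.lift
    (pullback.fst _ _ ≫ inv g.back ≫ pullback.fst _ _) (pullback.snd _ _) (by
      rw [Category.assoc, Category.assoc, pullback.condition, reassoc_of% hg',
        pullback.condition_assoc]
      rfl)
  have : IsIso l := by
    refine ⟨m, ?_, ?_⟩
    · apply pullback.hom_ext
      · rw [Category.assoc, pullback.lift_fst, pullback.lift_fst_assoc, bk, Category.assoc,
          IsIso.hom_inv_id_assoc, pullback.lift_fst, Category.id_comp]
      · rw [Category.assoc, pullback.lift_snd, pullback.lift_snd, Category.id_comp]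
    · apply pullback.hom_ext
      · rw [Category.assoc, pullback.lift_fst, Category.id_comp, comp_bk]
        have : pullback.lift (f := R.hom) (g := g.fwd) (m ≫ pullback.fst _ _)
            (m ≫ pullback.snd _ _ ≫ f.fwd) (by
              rw [Category.assoc, pullback.condition, Category.assoc, Category.assoc]
              rfl) =
            pullback.fst _ _ ≫ inv g.back := by
          apply pullback.hom_ext
          · rw [pullback.lift_fst, pullback.lift_fst, Category.assoc]
          · rw [pullback.lift_snd, pullback.lift_snd_assoc, Category.assoc, hg',
              pullback.condition]
        rw [bk, this, Category.assoc, IsIso.inv_hom_id, Category.comp_id]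
      · rw [Category.assoc, pullback.lift_snd, pullback.lift_snd, Category.id_comp]
  change IsIso (f ≫ g).back
  rw [hb]
  infer_instance

/-- The morphism of containers over `m` with the given backward map. -/
def overHom {I J : C} (m : I ⟶ J) {X : Over I} {Y : Over J} (k : (Over.pullback m).obj Y ⟶ X) :
    (fibreIncl I).obj (op X) ⟶ (fibreIncl J).obj (op Y) where
  fwd := m
  back := k.left
  w := Over.w k

section

variable {I J : C} {m : I ⟶ J} {X X' : Over I} {Y Y' : Over J}

theorem exists_overHom (f : (fibreIncl I).obj (op X) ⟶ (fibreIncl J).obj (op Y)) (h : f.fwd = m) :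
    ∃ k, f = overHom m k := by
  subst h
  exact ⟨Over.homMk f.back f.w, rfl⟩

theorem overHom_injective {k k' : (Over.pullback m).obj Y ⟶ X} (h : overHom m k = overHom m k') :
    k = k' := by
  have := (Container.Hom.mk.injEq ..).mp h
  exact Over.OverMorphism.ext (eq_of_heq this.2)

theorem isCartesian_overHom (k : (Over.pullback m).obj Y ⟶ X) [IsIso k] :
    IsCartesian (overHom m k) :=
  inferInstanceAs (IsIso ((Over.forget _).map k))

theorem isIso_of_isCartesian_overHom {k : (Over.pullback m).obj Y ⟶ X}
    (h : IsCartesian (overHom m k)) : IsIso k := by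
  have : IsIso ((Over.forget _).map k) := h
  exact isIso_of_reflects_iso k (Over.forget _)

theorem bk_fibreIncl (k : X' ⟶ X) {Z : C} (q : Z ⟶ X'.left) (i : Z ⟶ I)
    (h : q ≫ X'.hom = i ≫ 𝟙 I) :
    bk ((fibreIncl I).map k.op) q i h = q ≫ k.left :=
  pullback.lift_fst_assoc _ _ _ _

theorem fibreIncl_comp_overHom (k : X' ⟶ X) (l : (Over.pullback m).obj Y ⟶ X') :
    (fibreIncl I).map k.op ≫ overHom m l = overHom m (l ≫ k) := by
  refine hom_ext (Category.id_comp _) fun q i h => ?_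
  have h' : q ≫ Y.hom = i ≫ m := h.trans (congrArg (i ≫ ·) (Category.id_comp m))
  refine (bk_comp _ _ q i h).trans ((bk_fibreIncl k _ i _).trans ?_)
  refine Eq.trans (congrArg (· ≫ k.left) (congrArg (· ≫ l.left) ?_))
    (Category.assoc (pullback.lift q i h') _ _)
  apply pullback.hom_ext
  · exact (pullback.lift_fst _ _ _).trans (pullback.lift_fst _ _ _).symm
  · exact (pullback.lift_snd _ _ _).trans
      ((Category.comp_id i).trans (pullback.lift_snd _ _ _).symm)

theorem overHom_comp_fibreIncl (k : Y' ⟶ Y) (l : (Over.pullback m).obj Y ⟶ X) :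
    overHom m l ≫ (fibreIncl J).map k.op = overHom m ((Over.pullback m).map k ≫ l) := by
  refine hom_ext (Category.comp_id _) fun q i h => ?_
  have h' : q ≫ Y'.hom = i ≫ m := h.trans (congrArg (i ≫ ·) (Category.comp_id m))
  refine (bk_comp _ _ q i h).trans (Eq.trans (congrArg (· ≫ l.left) ?_)
    (Category.assoc (pullback.lift q i h') _ _))
  apply pullback.hom_ext
  · refine (pullback.lift_fst _ _ _).trans ((bk_fibreIncl k _ _ _).trans (Eq.symm ?_))
    refine (Category.assoc _ _ _).trans ((congrArg (_ ≫ ·) (pullback.lift_fst _ _ _)).trans ?_)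
    exact pullback.lift_fst_assoc _ _ _ _
  · refine (pullback.lift_snd _ _ _).trans (Eq.symm ?_)
    refine (Category.assoc _ _ _).trans ((congrArg (_ ≫ ·) (pullback.lift_snd _ _ _)).trans ?_)
    exact pullback.lift_snd _ _ _

variable (m) in
/-- The cartesian lift of `m`. -/
def cart (Y : Over J) :
    (fibreIncl I).obj (op ((Over.pullback m).obj Y)) ⟶ (fibreIncl J).obj (op Y) :=
  overHom m (𝟙 _)

theorem isCartesian_cart (Y : Over J) : IsCartesian (cart m Y) := isCartesian_overHom _

theorem exists_comp_cart (f : (fibreIncl I).obj (op X) ⟶ (fibreIncl J).obj (op Y))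
    (h : f.fwd = m) :
    ∃ k : (Over.pullback m).obj Y ⟶ X, f = (fibreIncl I).map k.op ≫ cart m Y := by
  obtain ⟨k, rfl⟩ := exists_overHom f h
  exact ⟨k, by rw [cart, fibreIncl_comp_overHom, Category.id_comp]⟩

theorem comp_cart_injective {k k' : (Over.pullback m).obj Y ⟶ X}
    (h : (fibreIncl I).map k.op ≫ cart m Y = (fibreIncl I).map k'.op ≫ cart m Y) : k = k' := by
  rw [cart, fibreIncl_comp_overHom, fibreIncl_comp_overHom, Category.id_comp, Category.id_comp] at h
  exact overHom_injective h

theorem isCartesian_comp_cart (k : (Over.pullback m).obj Y ⟶ X) [IsIso k] :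
    IsCartesian ((fibreIncl I).map k.op ≫ cart m Y) := by
  rw [cart, fibreIncl_comp_overHom, Category.id_comp]
  exact isCartesian_overHom k

theorem isIso_of_isCartesian_comp_cart {k : (Over.pullback m).obj Y ⟶ X}
    (h : IsCartesian ((fibreIncl I).map k.op ≫ cart m Y)) : IsIso k := by
  rw [cart, fibreIncl_comp_overHom, Category.id_comp] at h
  exact isIso_of_isCartesian_overHom h

theorem cart_naturality (k : Y' ⟶ Y) : cart m Y ≫ (fibreIncl J).map k.op =
    (fibreIncl I).map ((Over.pullback m).map k).op ≫ cart m Y' := by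
  rw [cart, cart, overHom_comp_fibreIncl, fibreIncl_comp_overHom, Category.id_comp,
    Category.comp_id]

variable [LocallyCartesianClosed C]

variable (m) in
/-- The opcartesian lift of `m`. -/
def opcart (X : Over I) :
    (fibreIncl I).obj (op X) ⟶ (fibreIncl J).obj (op ((internalPi m).obj X)) :=
  overHom m ((Adjunction.ofIsLeftAdjoint (Over.pullback m)).counit.app X)

theorem opcart_comp (k : Y ⟶ (internalPi m).obj X) : opcart m X ≫ (fibreIncl J).map k.op =
    overHom m (((Adjunction.ofIsLeftAdjoint (Over.pullback m)).homEquiv Y X).symm k) := by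
  exact (overHom_comp_fibreIncl k _).trans (congrArg (overHom m)
    ((Adjunction.ofIsLeftAdjoint (Over.pullback m)).homEquiv_counit Y X k).symm)

theorem exists_opcart_comp (f : (fibreIncl I).obj (op X) ⟶ (fibreIncl J).obj (op Y))
    (h : f.fwd = m) :
    ∃ k : Y ⟶ (internalPi m).obj X, f = opcart m X ≫ (fibreIncl J).map k.op := by
  obtain ⟨k, rfl⟩ := exists_overHom f h
  exact ⟨(Adjunction.ofIsLeftAdjoint (Over.pullback m)).homEquiv Y X k, Eq.symm
    ((opcart_comp _).trans (congrArg (overHom m) (Equiv.symm_apply_apply _ k)))⟩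

theorem opcart_comp_injective {k k' : Y ⟶ (internalPi m).obj X}
    (h : opcart m X ≫ (fibreIncl J).map k.op = opcart m X ≫ (fibreIncl J).map k'.op) : k = k' := by
  have h' := (opcart_comp k).symm.trans (h.trans (opcart_comp k'))
  exact (Equiv.injective _) (overHom_injective h')

end

/-- A functor into containers of constant shape lies, up to isomorphism, in a fibre. -/
def toFibreIso {D : Type u₁} [Category.{v₁} D] (K : Dᵒᵖ ⥤ Container C) (B : C)
    (e : ∀ X, (K.obj X).shape ≅ B)
    (he : ∀ {X Y : Dᵒᵖ} (g : X ⟶ Y), (K.map g).fwd ≫ (e Y).hom = (e X).hom) :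
    K ≅ (toFibre K B e he).op ⋙ fibreIncl B :=
  NatIso.ofComponents (fun X =>
    { hom :=
        { fwd := (e X).hom
          back := pullback.fst ((K.obj X).hom ≫ (e X).hom) (e X).hom
          w := by
            refine (cancel_mono (e X).hom).mp ?_
            exact (Category.assoc _ _ _).trans
              (pullback.condition (f := (K.obj X).hom ≫ (e X).hom) (g := (e X).hom)) }
      inv :=
        { fwd := (e X).inv
          back := pullback.fst (K.obj X).hom (e X).inv
          w := by
            change _ ≫ (K.obj X).hom ≫ (e X).hom = _
            exact (pullback.condition_assoc (f := (K.obj X).hom) (g := (e X).inv) _).trans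
              ((congrArg (_ ≫ ·) (e X).inv_hom_id).trans (Category.comp_id _)) }
      hom_inv_id := hom_ext (e X).hom_inv_id fun q i h => by
        refine (bk_comp _ _ q i h).trans (Eq.trans ?_ (id_bk q i _).symm)
        exact (pullback.lift_fst _ _ _).trans (pullback.lift_fst _ _ _)
      inv_hom_id := hom_ext (e X).inv_hom_id fun q i h => by
        refine (bk_comp _ _ q i h).trans (Eq.trans ?_ (id_bk q i _).symm)
        exact (pullback.lift_fst _ _ _).trans (pullback.lift_fst _ _ _) })
    (fun {X Y} g => by
      refine hom_ext ((he g).trans (Category.comp_id _).symm) fun q i h => ?_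
      refine (bk_comp _ _ q i h).trans (Eq.trans ?_ (bk_comp _ _ q i _).symm)
      refine Eq.trans ?_ (pullback.lift_fst _ _ _).symm
      have hs := toFibre_aux K e he g
      have h' : q ≫ (K.obj Y).hom = i ≫ (K.map g).fwd := by
        refine (cancel_mono (e Y).hom).mp ?_
        exact (Category.assoc _ _ _).trans (h.trans (Category.assoc _ _ _).symm)
      have h₁ : 𝟙 _ ≫ (K.obj Y).hom = ((K.obj Y).hom ≫ (e Y).hom ≫ (e X).inv) ≫ (K.map g).fwd := by
        rw [Category.assoc, hs, Category.comp_id, Category.id_comp]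
      refine Eq.trans (bk_congr rfl (pullback.lift_fst _ _ _) rfl _) (Eq.trans ?_
        (bk_fibreIncl ((toFibre K B e he).map g.unop) q (i ≫ (e X).hom) ?_).symm)
      · refine Eq.trans ?_ (comp_bk (K.map g) q (𝟙 _) _ h₁).symm
        refine bk_congr rfl (Category.comp_id _).symm ?_ _
        have h₂ : (K.map g).fwd ≫ (e Y).hom ≫ (e X).inv = 𝟙 _ := by
          rw [reassoc_of% he g, Iso.hom_inv_id]
        exact Eq.symm ((Category.assoc _ _ _).symm.trans ((reassoc_of% h') _ |>.trans
          ((congrArg (i ≫ ·) h₂).trans (Category.comp_id i))))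
      · refine Eq.trans ?_ (Category.comp_id _).symm
        change q ≫ (K.obj Y).hom ≫ (e Y).hom = _
        exact (Category.assoc _ _ _).symm.trans (((reassoc_of% h') _).trans
          (congrArg (i ≫ ·) (he g))))

end

/-! ### Gluing fixed points in the fibres over a fixed point in the base -/

section

variable {C : Type u} [Category.{v} C] [HasPullbacks C] {A : Type u₁} [Category.{v₁} A]
  {B : Type u₂} [Category.{v₂} B] {F : A × Container C ⥤ Container C} {π : A ⥤ B}
  {F₀ : B × C ⥤ C} (s : F ⋙ shapeFunctor C ≅ π.prod (shapeFunctor C) ⋙ F₀) {G₀ : B ⥤ C}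
  (c : Functor.prod' (𝟭 B) G₀ ⋙ F₀ ≅ G₀)

theorem map_fwd_comp {a a' : A} (φ : a ⟶ a') {P Q : Container C} (g : P ⟶ Q) :
    (F.map ((φ, g) : (a, P) ⟶ (a', Q))).fwd ≫ s.hom.app (a', Q) = s.hom.app (a, P) ≫
      F₀.map ((π.map φ, g.fwd) : (π.obj a, P.shape) ⟶ (π.obj a', Q.shape)) :=
  s.hom.naturality ((φ, g) : (a, P) ⟶ (a', Q))

theorem map_fwd_comp_of_eq {a a' : A} (φ : a ⟶ a') {P Q : Container C} (g : P ⟶ Q)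
    {m : P.shape ⟶ Q.shape} {ψ : π.obj a ⟶ π.obj a'} (hψ : π.map φ = ψ) (hm : g.fwd = m) :
    (F.map ((φ, g) : (a, P) ⟶ (a', Q))).fwd ≫ s.hom.app (a', Q) = s.hom.app (a, P) ≫
      F₀.map ((ψ, m) : (π.obj a, P.shape) ⟶ (π.obj a', Q.shape)) := by
  rw [map_fwd_comp, hψ, hm]

/-- The shape of `F (a, Y)`, for `Y` over the base fixed point `G₀ (π a)`. -/
def fibreShapeIso (a : A) (Y : (Over (G₀.obj (π.obj a)))ᵒᵖ) :
    ((fibreIncl (G₀.obj (π.obj a)) ⋙ fixFst F a).obj Y).shape ≅ G₀.obj (π.obj a) :=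
  s.app (a, (fibreIncl _).obj Y) ≪≫ c.app (π.obj a)

theorem fibreShapeIso_naturality (a : A) {Y Z : (Over (G₀.obj (π.obj a)))ᵒᵖ} (g : Y ⟶ Z) :
    ((fibreIncl (G₀.obj (π.obj a)) ⋙ fixFst F a).map g).fwd ≫ (fibreShapeIso s c a Z).hom =
      (fibreShapeIso s c a Y).hom := by
  refine (Category.assoc _ _ _).symm.trans (congrArg (· ≫ c.hom.app (π.obj a)) ?_)
  refine (map_fwd_comp_of_eq s (𝟙 a) ((fibreIncl _).map g) (π.map_id a) rfl).trans ?_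
  exact (congrArg (_ ≫ ·) (F₀.map_id (π.obj a, G₀.obj (π.obj a)))).trans (Category.comp_id _)

/-- The endofunctor induced by `F (a, -)` on the fibre over the base fixed point `G₀ (π a)`. -/
def fibreEnd (a : A) : Over (G₀.obj (π.obj a)) ⥤ Over (G₀.obj (π.obj a)) :=
  toFibre (fibreIncl (G₀.obj (π.obj a)) ⋙ fixFst F a) (G₀.obj (π.obj a)) (fibreShapeIso s c a)
    (fibreShapeIso_naturality s c a)

/-- The fibre of `F (a, -)` is computed, up to isomorphism, by `fibreEnd`. -/
def fibreEndIso (a : A) (Y : Over (G₀.obj (π.obj a))) :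
    (fixFst F a).obj ((fibreIncl _).obj (op Y)) ≅
      (fibreIncl _).obj (op ((fibreEnd s c a).obj Y)) :=
  (toFibreIso (fibreIncl (G₀.obj (π.obj a)) ⋙ fixFst F a) (G₀.obj (π.obj a)) (fibreShapeIso s c a)
    (fibreShapeIso_naturality s c a)).app (op Y)

theorem fibreEndIso_naturality (a : A) {Y Z : Over (G₀.obj (π.obj a))} (g : Y ⟶ Z) :
    (fixFst F a).map ((fibreIncl _).map g.op) ≫ (fibreEndIso s c a Y).hom =
      (fibreEndIso s c a Z).hom ≫ (fibreIncl _).map ((fibreEnd s c a).map g).op :=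
  (toFibreIso (fibreIncl (G₀.obj (π.obj a)) ⋙ fixFst F a) (G₀.obj (π.obj a)) (fibreShapeIso s c a)
    (fibreShapeIso_naturality s c a)).hom.naturality g.op

/-- The isomorphism of containers given by a fixed point of `fibreEnd`. -/
def totalIso {a : A} {X : Over (G₀.obj (π.obj a))} (κ : (fibreEnd s c a).obj X ≅ X) :
    (fixFst F a).obj ((fibreIncl _).obj (op X)) ≅ (fibreIncl _).obj (op X) :=
  fibreEndIso s c a X ≪≫ (fibreIncl _).mapIso κ.symm.op

theorem totalIso_hom_fwd {a : A} {X : Over (G₀.obj (π.obj a))}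
    (κ : (fibreEnd s c a).obj X ≅ X) :
    (totalIso s c κ).hom.fwd = s.hom.app (a, (fibreIncl _).obj (op X)) ≫ c.hom.app (π.obj a) :=
  Category.comp_id (fibreEndIso s c a X).hom.fwd

theorem totalIso_inv_fwd {a : A} {X : Over (G₀.obj (π.obj a))}
    (κ : (fibreEnd s c a).obj X ≅ X) :
    (totalIso s c κ).inv.fwd = c.inv.app (π.obj a) ≫ s.inv.app (a, (fibreIncl _).obj (op X)) :=
  Category.id_comp (fibreEndIso s c a X).inv.fwd

/-- A morphism over `m` factors through the cartesian lift of `m`, and being an algebra morphism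
turns into being a coalgebra morphism, in the slice, out of `m^* Y`. -/
theorem existsUnique_algHom_aux {a : A} {X : Over (G₀.obj (π.obj a))}
    {κ : (fibreEnd s c a).obj X ≅ X} (hκ : IsTermCoalg (fibreEnd s c a) X κ.inv) {J : C}
    (Y : Over J) (β : (fixFst F a).obj ((fibreIncl J).obj (op Y)) ⟶ (fibreIncl J).obj (op Y))
    (m : G₀.obj (π.obj a) ⟶ J)
    (hm : c.hom.app (π.obj a) ≫ m =
      F₀.map ((𝟙 _, m) : (π.obj a, G₀.obj (π.obj a)) ⟶ (π.obj a, J)) ≫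
        s.inv.app (a, (fibreIncl J).obj (op Y)) ≫ β.fwd) :
    ∃! g : (fibreIncl _).obj (op X) ⟶ (fibreIncl J).obj (op Y),
      g.fwd = m ∧ (totalIso s c κ).hom ≫ g = (fixFst F a).map g ≫ β := by
  have hs : ((fixFst F a).map (cart m Y)).fwd = s.hom.app (a, _) ≫
      F₀.map ((𝟙 _, m) : (π.obj a, G₀.obj (π.obj a)) ⟶ (π.obj a, J)) ≫ s.inv.app (a, _) := by
    have h := map_fwd_comp_of_eq s (𝟙 a) (cart m Y) (π.map_id a) rfl
    refine ((Category.comp_id _).symm.trans (congrArg (_ ≫ ·)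
      (s.hom_inv_id_app (a, (fibreIncl J).obj (op Y))).symm)).trans ?_
    exact (Category.assoc _ _ _).symm.trans ((congrArg (· ≫ _) h).trans (Category.assoc _ _ _))
  obtain ⟨y, hy⟩ := exists_comp_cart (m := m)
    ((fibreEndIso s c a ((Over.pullback m).obj Y)).inv ≫ (fixFst F a).map (cart m Y) ≫ β) (by
      refine Eq.trans (congrArg (fun t => (c.inv.app (π.obj a) ≫ s.inv.app
        (a, (fibreIncl _).obj (op ((Over.pullback m).obj Y)))) ≫ t ≫ β.fwd) hs) ?_
      refine (Category.assoc _ _ _).trans (Eq.trans (congrArg (c.inv.app (π.obj a) ≫ ·) ?_)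
        (c.inv_hom_id_app_assoc (π.obj a) m))
      refine Eq.trans ?_ hm.symm
      refine (congrArg (_ ≫ ·) (Category.assoc _ _ _)).trans ?_
      refine (s.inv_hom_id_app_assoc _ _).trans (Category.assoc _ _ _))
  have key : ∀ k : (Over.pullback m).obj Y ⟶ X,
      (totalIso s c κ).hom ≫ (fibreIncl _).map k.op ≫ cart m Y =
        (fixFst F a).map ((fibreIncl _).map k.op ≫ cart m Y) ≫ β ↔
      k ≫ κ.inv = y ≫ (fibreEnd s c a).map k := by
    intro k
    have h₁ : (totalIso s c κ).hom ≫ (fibreIncl _).map k.op ≫ cart m Y =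
        (fibreEndIso s c a X).hom ≫ (fibreIncl _).map (k ≫ κ.inv).op ≫ cart m Y := by
      rw [op_comp, (fibreIncl _).map_comp]
      simp [totalIso]
    have h₂ : (fixFst F a).map ((fibreIncl _).map k.op ≫ cart m Y) ≫ β =
        (fibreEndIso s c a X).hom ≫ (fibreIncl _).map (y ≫ (fibreEnd s c a).map k).op ≫
          cart m Y := by
      rw [op_comp, (fibreIncl _).map_comp, Category.assoc, ← hy,
        ← reassoc_of% fibreEndIso_naturality s c a k, Iso.hom_inv_id_assoc,
        (fixFst F a).map_comp, Category.assoc]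
    rw [h₁, h₂, cancel_epi]
    exact ⟨comp_cart_injective, fun h => by rw [h]⟩
  obtain ⟨k, hk, hu⟩ := hκ _ y
  refine ⟨(fibreIncl _).map k.op ≫ cart m Y, ⟨Category.id_comp m, (key k).mpr hk⟩, ?_⟩
  rintro g ⟨hg, hg'⟩
  obtain ⟨k', rfl⟩ := exists_comp_cart g hg
  rw [hu k' ((key k').mp hg')]

/-- If the fixed point in the fibre is a terminal coalgebra then, the fibres being opposite slices,
algebra morphisms out of it are determined by their forward maps. -/
theorem existsUnique_algHom {a : A} {X : Over (G₀.obj (π.obj a))}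
    {κ : (fibreEnd s c a).obj X ≅ X} (hκ : IsTermCoalg (fibreEnd s c a) X κ.inv) (Q : Container C)
    (β : (fixFst F a).obj Q ⟶ Q) (m : G₀.obj (π.obj a) ⟶ Q.shape)
    (hm : c.hom.app (π.obj a) ≫ m =
      F₀.map ((𝟙 _, m) : (π.obj a, G₀.obj (π.obj a)) ⟶ (π.obj a, Q.shape)) ≫
        s.inv.app (a, Q) ≫ β.fwd) :
    ∃! g : (fibreIncl _).obj (op X) ⟶ Q,
      g.fwd = m ∧ (totalIso s c κ).hom ≫ g = (fixFst F a).map g ≫ β :=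
  existsUnique_algHom_aux s c hκ (Over.mk Q.hom) β m hm

/-- A morphism over `m` factors through the opcartesian lift of `m`, and being a coalgebra morphism
turns into being an algebra morphism, in the slice, into `Π_m Y`. -/
theorem existsUnique_coalgHom_aux [LocallyCartesianClosed C] {a : A} {X : Over (G₀.obj (π.obj a))}
    {κ : (fibreEnd s c a).obj X ≅ X} (hκ : IsInitAlg (fibreEnd s c a) X κ.hom) {J : C}
    (Y : Over J) (β : (fibreIncl J).obj (op Y) ⟶ (fixFst F a).obj ((fibreIncl J).obj (op Y)))
    (m : J ⟶ G₀.obj (π.obj a))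
    (hm : m ≫ c.inv.app (π.obj a) = β.fwd ≫ s.hom.app (a, (fibreIncl J).obj (op Y)) ≫
      F₀.map ((𝟙 _, m) : (π.obj a, J) ⟶ (π.obj a, G₀.obj (π.obj a)))) :
    ∃! g : (fibreIncl J).obj (op Y) ⟶ (fibreIncl _).obj (op X),
      g.fwd = m ∧ g ≫ (totalIso s c κ).inv = β ≫ (fixFst F a).map g := by
  obtain ⟨y, hy⟩ := exists_opcart_comp (m := m)
    (β ≫ (fixFst F a).map (opcart m Y) ≫ (fibreEndIso s c a ((internalPi m).obj Y)).hom) (by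
      change β.fwd ≫ ((fixFst F a).map (opcart m Y)).fwd ≫ (s.hom.app _ ≫ c.hom.app _) = m
      have h := map_fwd_comp_of_eq s (𝟙 a) (opcart m Y) (π.map_id a) rfl
      refine (congrArg (_ ≫ ·) (Category.assoc _ _ _).symm).trans
        ((congrArg (fun t => _ ≫ t ≫ _) h).trans ?_)
      refine (Category.assoc _ _ _).symm.trans ((congrArg (· ≫ _) hm.symm).trans ?_)
      exact (Category.assoc _ _ _).trans ((congrArg (_ ≫ ·) (c.inv_hom_id_app _)).trans
        (Category.comp_id _)))
  have key : ∀ k : X ⟶ (internalPi m).obj Y,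
      (opcart m Y ≫ (fibreIncl _).map k.op) ≫ (totalIso s c κ).inv =
        β ≫ (fixFst F a).map (opcart m Y ≫ (fibreIncl _).map k.op) ↔
      κ.hom ≫ k = (fibreEnd s c a).map k ≫ y := by
    intro k
    have h₁ : (opcart m Y ≫ (fibreIncl _).map k.op) ≫ (totalIso s c κ).inv =
        (opcart m Y ≫ (fibreIncl _).map (κ.hom ≫ k).op) ≫ (fibreEndIso s c a X).inv := by
      rw [op_comp, (fibreIncl _).map_comp]
      simp [totalIso]
    have h₂ : β ≫ (fixFst F a).map (opcart m Y ≫ (fibreIncl _).map k.op) =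
        (opcart m Y ≫ (fibreIncl _).map ((fibreEnd s c a).map k ≫ y).op) ≫
          (fibreEndIso s c a X).inv := by
      rw [op_comp, (fibreIncl _).map_comp, Iso.eq_comp_inv, ← reassoc_of% hy,
        ← fibreEndIso_naturality s c a k, (fixFst F a).map_comp]
      simp only [Category.assoc]
    rw [h₁, h₂, cancel_mono]
    exact ⟨opcart_comp_injective, fun h => by rw [h]⟩
  obtain ⟨k, hk, hu⟩ := hκ _ y
  refine ⟨opcart m Y ≫ (fibreIncl _).map k.op, ⟨Category.comp_id m, (key k).mpr hk⟩, ?_⟩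
  rintro g ⟨hg, hg'⟩
  obtain ⟨k', rfl⟩ := exists_opcart_comp g hg
  rw [hu k' ((key k').mp hg')]

/-- If the fixed point in the fibre is an initial algebra then, the fibres being opposite slices,
coalgebra morphisms into it are determined by their forward maps. -/
theorem existsUnique_coalgHom [LocallyCartesianClosed C] {a : A} {X : Over (G₀.obj (π.obj a))}
    {κ : (fibreEnd s c a).obj X ≅ X} (hκ : IsInitAlg (fibreEnd s c a) X κ.hom) (Q : Container C)
    (β : Q ⟶ (fixFst F a).obj Q) (m : Q.shape ⟶ G₀.obj (π.obj a))
    (hm : m ≫ c.inv.app (π.obj a) = β.fwd ≫ s.hom.app (a, Q) ≫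
      F₀.map ((𝟙 _, m) : (π.obj a, Q.shape) ⟶ (π.obj a, G₀.obj (π.obj a)))) :
    ∃! g : Q ⟶ (fibreIncl _).obj (op X),
      g.fwd = m ∧ g ≫ (totalIso s c κ).inv = β ≫ (fixFst F a).map g :=
  existsUnique_coalgHom_aux s c hκ (Over.mk Q.hom) β m hm

end

/-! ### The parametric fixed point as a functor -/

section

variable {A : Type u₁} [Category.{v₁} A] {D : Type u₂} [Category.{v₂} D]

/-- The action of a bifunctor on a pair of morphisms. -/
def mapPair (F : A × D ⥤ D) {a a' : A} (φ : a ⟶ a') {P Q : D} (g : P ⟶ Q) :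
    (fixFst F a).obj P ⟶ (fixFst F a').obj Q :=
  F.map ((φ, g) : (a, P) ⟶ (a', Q))

theorem mapPair_comp (F : A × D ⥤ D) {a a' a'' : A} (φ : a ⟶ a') (ψ : a' ⟶ a'') {P Q R : D}
    (g : P ⟶ Q) (h : Q ⟶ R) :
    mapPair F (φ ≫ ψ) (g ≫ h) = mapPair F φ g ≫ mapPair F ψ h :=
  F.map_comp ((φ, g) : (a, P) ⟶ (a', Q)) ((ψ, h) : (a', Q) ⟶ (a'', R))

theorem mapPair_id (F : A × D ⥤ D) (a : A) (P : D) : mapPair F (𝟙 a) (𝟙 P) = 𝟙 _ :=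
  F.map_id (a, P)

theorem fixFst_map_comp_mapPair (F : A × D ⥤ D) {a a' : A} (φ : a ⟶ a') {P Q R : D} (g : P ⟶ Q)
    (h : Q ⟶ R) : (fixFst F a).map g ≫ mapPair F φ h = mapPair F φ (g ≫ h) := by
  refine (mapPair_comp F (𝟙 a) φ g h).symm.trans ?_
  rw [Category.id_comp]

theorem mapPair_comp_fixFst_map (F : A × D ⥤ D) {a a' : A} (φ : a ⟶ a') {P Q R : D} (g : P ⟶ Q)
    (h : Q ⟶ R) : mapPair F φ g ≫ (fixFst F a').map h = mapPair F φ (g ≫ h) := by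
  refine (mapPair_comp F φ (𝟙 a') g h).symm.trans ?_
  rw [Category.comp_id]

end

section

variable {C : Type u} [Category.{v} C] {B : Type u₂} [Category.{v₂} B] {F₀ : B × C ⥤ C}
  {G₀ : B ⥤ C} (c : Functor.prod' (𝟭 B) G₀ ⋙ F₀ ≅ G₀)

/-- The structure isomorphism of the base fixed point at `x`. -/
def baseIso (x : B) : (fixFst F₀ x).obj (G₀.obj x) ≅ G₀.obj x :=
  c.app x

theorem baseIso_naturality {x y : B} (ψ : x ⟶ y) :
    mapPair F₀ ψ (G₀.map ψ) ≫ (baseIso c y).hom = (baseIso c x).hom ≫ G₀.map ψ :=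
  c.hom.naturality ψ

end

section

variable {C : Type u} [Category.{v} C] [HasPullbacks C] {A : Type u₁} [Category.{v₁} A]
  {B : Type u₂} [Category.{v₂} B] {F : A × Container C ⥤ Container C} {π : A ⥤ B}
  {F₀ : B × C ⥤ C} (s : F ⋙ shapeFunctor C ≅ π.prod (shapeFunctor C) ⋙ F₀) {G₀ : B ⥤ C}
  (c : Functor.prod' (𝟭 B) G₀ ⋙ F₀ ≅ G₀)

/-- The shape of `F (a, Q)`. -/
def shapeAt (a : A) (Q : Container C) :
    ((fixFst F a).obj Q).shape ≅ (fixFst F₀ (π.obj a)).obj Q.shape :=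
  s.app (a, Q)

theorem mapPair_fwd {a a' : A} (φ : a ⟶ a') {P Q : Container C} (g : P ⟶ Q) :
    (mapPair F φ g).fwd ≫ (shapeAt s a' Q).hom =
      (shapeAt s a P).hom ≫ mapPair F₀ (π.map φ) g.fwd :=
  map_fwd_comp s φ g

theorem shapeAt_conj {a a' : A} (φ : a ⟶ a') (Q : Container C) {Z : C}
    (t : (fixFst F₀ (π.obj a')).obj Q.shape ⟶ Z) :
    (shapeAt s a Q).inv ≫ (mapPair F φ (𝟙 Q)).fwd ≫ (shapeAt s a' Q).hom ≫ t =
      mapPair F₀ (π.map φ) (𝟙 Q.shape) ≫ t := by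
  rw [reassoc_of% mapPair_fwd, Iso.inv_hom_id_assoc]
  rfl

variable [LocallyCartesianClosed C] {b : Bool} {X : ∀ a, Over (G₀.obj (π.obj a))}
  {κ : ∀ a, (fibreEnd s c a).obj (X a) ≅ X a}

/-- Whichever universal property the fixed points in the fibres have, a morphism of parameters
induces a unique morphism of fixed points over the one in the base. -/
theorem existsUnique_fixMap (hκ : ∀ a, IsExtremal b (fibreEnd s c a) (X a) (κ a)) {a a' : A}
    (φ : a ⟶ a') : ∃! g : (fibreIncl _).obj (op (X a)) ⟶ (fibreIncl _).obj (op (X a')),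
      g.fwd = G₀.map (π.map φ) ∧
        (totalIso s c (κ a)).hom ≫ g = mapPair F φ g ≫ (totalIso s c (κ a')).hom := by
  have hc := baseIso_naturality c (π.map φ)
  cases b
  · have hF : ∀ g : (fibreIncl _).obj (op (X a)) ⟶ (fibreIncl _).obj (op (X a')),
        mapPair F φ g ≫ (totalIso s c (κ a')).hom =
          (fixFst F a).map g ≫ mapPair F φ (𝟙 _) ≫ (totalIso s c (κ a')).hom := fun g => by
      rw [← Category.assoc, fixFst_map_comp_mapPair, Category.comp_id]
    simp only [hF]
    refine existsUnique_algHom s c (hκ a) _ _ _ ?_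
    change (baseIso c (π.obj a)).hom ≫ _ = mapPair F₀ (𝟙 _) _ ≫ (shapeAt s a _).inv ≫
      (mapPair F φ (𝟙 _)).fwd ≫ (totalIso s c (κ a')).hom.fwd
    refine hc.symm.trans (Eq.trans ?_ (congrArg (mapPair F₀ (𝟙 _) _ ≫ ·)
      ((congrArg (fun t => _ ≫ _ ≫ t) (totalIso_hom_fwd s c (κ a'))).trans
        (shapeAt_conj s φ ((fibreIncl _).obj (op (X a'))) (baseIso c (π.obj a')).hom)).symm))
    refine (congrArg (· ≫ _) ?_).trans (Category.assoc _ _ _)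
    exact Eq.symm ((fixFst_map_comp_mapPair F₀ (π.map φ) (G₀.map (π.map φ)) (𝟙 _)).trans
      (congrArg (mapPair F₀ (π.map φ)) (Category.comp_id _)))
  · have hF : ∀ g : (fibreIncl _).obj (op (X a)) ⟶ (fibreIncl _).obj (op (X a')),
        (totalIso s c (κ a)).hom ≫ g = mapPair F φ g ≫ (totalIso s c (κ a')).hom ↔
        g ≫ (totalIso s c (κ a')).inv = ((totalIso s c (κ a)).inv ≫ mapPair F φ (𝟙 _)) ≫
            (fixFst F a').map g := by
      intro g
      rw [Iso.comp_inv_eq, Category.assoc, Category.assoc, Iso.eq_inv_comp, ← Category.assoc,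
        mapPair_comp_fixFst_map, Category.id_comp]
    simp only [hF]
    refine existsUnique_coalgHom s c (hκ a') _ _ _ ?_
    change _ ≫ (baseIso c (π.obj a')).inv = ((totalIso s c (κ a)).inv.fwd ≫
      (mapPair F φ (𝟙 _)).fwd) ≫ (shapeAt s a' _).hom ≫ mapPair F₀ (𝟙 _) _
    refine Eq.symm ((congrArg (fun t => (t ≫ _) ≫ _) (totalIso_inv_fwd s c (κ a))).trans ?_)
    refine (Category.assoc _ _ _).trans ((Category.assoc _ _ _).trans ?_)
    refine (congrArg ((baseIso c (π.obj a)).inv ≫ ·) ((shapeAt_conj s φ _ _).trans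
      ((mapPair_comp_fixFst_map F₀ (π.map φ) (𝟙 _) (G₀.map (π.map φ))).trans
        (congrArg (mapPair F₀ (π.map φ)) (Category.id_comp _))))).trans ?_
    exact (Iso.inv_comp_eq _).mpr
      (((Iso.eq_comp_inv (baseIso c (π.obj a'))).mpr hc).trans (Category.assoc _ _ _))

/-- The fixed points in the fibres, as a functor of the parameters: morphisms act by the unique
morphisms of `existsUnique_fixMap`. -/
def fixFunctor (hκ : ∀ a, IsExtremal b (fibreEnd s c a) (X a) (κ a)) : A ⥤ Container C where
  obj a := (fibreIncl _).obj (op (X a))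
  map φ := (existsUnique_fixMap s c hκ φ).choose
  map_id a := by
    refine ((existsUnique_fixMap s c hκ (𝟙 a)).choose_spec.2 _ ⟨?_, ?_⟩).symm
    · exact ((congrArg G₀.map (π.map_id a)).trans (G₀.map_id _)).symm
    · rw [mapPair_id, Category.comp_id, Category.id_comp]
  map_comp {a a' a''} φ ψ := by
    obtain ⟨h₁, h₁'⟩ := (existsUnique_fixMap s c hκ φ).choose_spec.1
    obtain ⟨h₂, h₂'⟩ := (existsUnique_fixMap s c hκ ψ).choose_spec.1
    refine ((existsUnique_fixMap s c hκ (φ ≫ ψ)).choose_spec.2 _ ⟨?_, ?_⟩).symm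
    · refine (congrArg₂ (· ≫ ·) h₁ h₂).trans ?_
      exact ((congrArg G₀.map (π.map_comp φ ψ)).trans (G₀.map_comp _ _)).symm
    · rw [mapPair_comp, Category.assoc, ← h₂', reassoc_of% h₁']

variable (hκ : ∀ a, IsExtremal b (fibreEnd s c a) (X a) (κ a))

theorem fixFunctor_map_fwd {a a' : A} (φ : a ⟶ a') :
    ((fixFunctor s c hκ).map φ).fwd = G₀.map (π.map φ) :=
  (existsUnique_fixMap s c hκ φ).choose_spec.1.1

theorem totalIso_comp_fixFunctor_map {a a' : A} (φ : a ⟶ a') :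
    (totalIso s c (κ a)).hom ≫ (fixFunctor s c hκ).map φ =
      mapPair F φ ((fixFunctor s c hκ).map φ) ≫ (totalIso s c (κ a')).hom :=
  (existsUnique_fixMap s c hκ φ).choose_spec.1.2

theorem fixFunctor_map_eq {a a' : A} (φ : a ⟶ a')
    {g : (fibreIncl _).obj (op (X a)) ⟶ (fibreIncl _).obj (op (X a'))}
    (hg : g.fwd = G₀.map (π.map φ))
    (hg' : (totalIso s c (κ a)).hom ≫ g = mapPair F φ g ≫ (totalIso s c (κ a')).hom) :
    (fixFunctor s c hκ).map φ = g :=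
  ((existsUnique_fixMap s c hκ φ).choose_spec.2 g ⟨hg, hg'⟩).symm

theorem fixFunctor_comp_shapeFunctor : fixFunctor s c hκ ⋙ shapeFunctor C = π ⋙ G₀ :=
  CategoryTheory.Functor.ext (fun _ => rfl) fun _ _ φ => by
    refine (fixFunctor_map_fwd s c hκ φ).trans ?_
    exact ((Category.id_comp _).trans (Category.comp_id _)).symm

/-- The structure isomorphisms of the glued fixed points are natural. -/
def fixFunctorIso : Functor.prod' (𝟭 A) (fixFunctor s c hκ) ⋙ F ≅ fixFunctor s c hκ :=
  NatIso.ofComponents (fun a => totalIso s c (κ a))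
    fun φ => (totalIso_comp_fixFunctor_map s c hκ φ).symm

end

/-! ### Cartesian morphisms -/

section

variable {D : Type u₁} [Category.{v₁} D] {D' : Type u₂} [Category.{v₂} D'] {h : D ⥤ D}
  {h' : D' ⥤ D'}

/-- A right adjoint which commutes with the endofunctors preserves terminal coalgebras. -/
theorem IsTermCoalg.map_rightAdjoint {L : D ⥤ D'} {R : D' ⥤ D} (adj : L ⊣ R)
    (θ : h' ⋙ R ≅ R ⋙ h) {X : D'} {c : X ⟶ h'.obj X} (hX : IsTermCoalg h' X c) :
    IsTermCoalg h (R.obj X) (R.map c ≫ θ.hom.app X) := by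
  intro V γ
  let γ' : L.obj V ⟶ h'.obj (L.obj V) := (adj.homEquiv _ _).symm
    (γ ≫ h.map (adj.unit.app V) ≫ θ.inv.app (L.obj V))
  have key : ∀ f : L.obj V ⟶ X, f ≫ c = γ' ≫ h'.map f ↔
      adj.homEquiv _ _ f ≫ R.map c ≫ θ.hom.app X = γ ≫ h.map (adj.homEquiv _ _ f) := by
    intro f
    have hn : θ.inv.app (L.obj V) ≫ R.map (h'.map f) = h.map (R.map f) ≫ θ.inv.app X :=
      (θ.inv.naturality f).symm
    rw [← (adj.homEquiv _ _).injective.eq_iff, adj.homEquiv_naturality_right,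
      adj.homEquiv_naturality_right, Equiv.apply_symm_apply, Category.assoc, Category.assoc, hn,
      ← h.map_comp_assoc, ← adj.homEquiv_unit, ← Category.assoc, ← Category.assoc]
    exact Iso.eq_comp_inv (θ.app X)
  obtain ⟨f, hf, hu⟩ := hX _ γ'
  refine ⟨adj.homEquiv _ _ f, (key f).mp hf, fun g hg => ?_⟩
  rw [← Equiv.symm_apply_eq]
  exact hu _ ((key _).mpr (by rw [Equiv.apply_symm_apply]; exact hg))

/-- A left adjoint which commutes with the endofunctors preserves initial algebras. -/
theorem IsInitAlg.map_leftAdjoint {L : D' ⥤ D} {R : D ⥤ D'} (adj : L ⊣ R)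
    (θ : h' ⋙ L ≅ L ⋙ h) {X : D'} {c : h'.obj X ⟶ X} (hX : IsInitAlg h' X c) :
    IsInitAlg h (L.obj X) (θ.inv.app X ≫ L.map c) := by
  intro V γ
  let γ' : h'.obj (R.obj V) ⟶ R.obj V := adj.homEquiv _ _
    (θ.hom.app (R.obj V) ≫ h.map (adj.counit.app V) ≫ γ)
  have key : ∀ f : X ⟶ R.obj V, c ≫ f = h'.map f ≫ γ' ↔
      (θ.inv.app X ≫ L.map c) ≫ (adj.homEquiv _ _).symm f =
        h.map ((adj.homEquiv _ _).symm f) ≫ γ := by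
    intro f
    have hn : L.map (h'.map f) ≫ θ.hom.app (R.obj V) = θ.hom.app X ≫ h.map (L.map f) :=
      θ.hom.naturality f
    have hc : (adj.homEquiv X V).symm f = L.map f ≫ adj.counit.app V := adj.homEquiv_counit X V f
    rw [← (adj.homEquiv _ _).symm.injective.eq_iff, adj.homEquiv_naturality_left_symm,
      adj.homEquiv_naturality_left_symm, Equiv.symm_apply_apply, reassoc_of% hn,
      ← h.map_comp_assoc, hc, Category.assoc]
    exact (Iso.inv_comp_eq (θ.app X)).symm
  obtain ⟨f, hf, hu⟩ := hX _ γ'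
  refine ⟨(adj.homEquiv _ _).symm f, (key f).mp hf, fun g hg => ?_⟩
  rw [Equiv.eq_symm_apply]
  exact hu _ ((key _).mpr (by rw [Equiv.symm_apply_apply]; exact hg))

theorem IsTermCoalg.isIso_of_hom {X Y : D} {c : X ⟶ h.obj X} {d : Y ⟶ h.obj Y}
    (hX : IsTermCoalg h X c) (hY : IsTermCoalg h Y d) {f : X ⟶ Y} (hf : f ≫ d = c ≫ h.map f) :
    IsIso f := by
  obtain ⟨g, hg, -⟩ := hX Y d
  refine ⟨g, (hX X c).unique ?_ ?_, (hY Y d).unique ?_ ?_⟩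
  · rw [Category.assoc, hg, reassoc_of% hf, h.map_comp]
  · rw [Category.id_comp, CategoryTheory.Functor.map_id, Category.comp_id]
  · rw [Category.assoc, hf, reassoc_of% hg, h.map_comp]
  · rw [Category.id_comp, CategoryTheory.Functor.map_id, Category.comp_id]

theorem IsInitAlg.isIso_of_hom {X Y : D} {c : h.obj X ⟶ X} {d : h.obj Y ⟶ Y}
    (hX : IsInitAlg h X c) (hY : IsInitAlg h Y d) {f : X ⟶ Y} (hf : c ≫ f = h.map f ≫ d) :
    IsIso f := by
  obtain ⟨g, hg, -⟩ := hY X c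
  refine ⟨g, (hX X c).unique ?_ ?_, (hY Y d).unique ?_ ?_⟩
  · rw [reassoc_of% hf, hg, h.map_comp, Category.assoc]
  · rw [CategoryTheory.Functor.map_id, Category.id_comp, Category.comp_id]
  · rw [reassoc_of% hg, hf, h.map_comp, Category.assoc]
  · rw [CategoryTheory.Functor.map_id, Category.id_comp, Category.comp_id]

end

section

variable {C : Type u} [Category.{v} C] [HasPullbacks C] {A : Type u₁} [Category.{v₁} A]
  {B : Type u₂} [Category.{v₂} B] {F : A × Container C ⥤ Container C} {π : A ⥤ B}
  {F₀ : B × C ⥤ C} (s : F ⋙ shapeFunctor C ≅ π.prod (shapeFunctor C) ⋙ F₀) {G₀ : B ⥤ C}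
  (c : Functor.prod' (𝟭 B) G₀ ⋙ F₀ ≅ G₀)

theorem fibreEndIso_conj_fwd {a a' : A} (φ : a ⟶ a') (Y : Over (G₀.obj (π.obj a'))) :
    ((fibreEndIso s c a ((Over.pullback (G₀.map (π.map φ))).obj Y)).inv ≫
      mapPair F φ (cart (G₀.map (π.map φ)) Y) ≫ (fibreEndIso s c a' Y).hom).fwd =
        G₀.map (π.map φ) := by
  have h₁ := mapPair_fwd s φ (cart (G₀.map (π.map φ)) Y)
  have h₂ := baseIso_naturality c (π.map φ)
  refine (Iso.inv_comp_eq (shapeAt s a ((fibreIncl _).obj (op ((Over.pullback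
    (G₀.map (π.map φ))).obj Y))) ≪≫ baseIso c (π.obj a) :
      ((fixFst F a).obj ((fibreIncl _).obj (op ((Over.pullback (G₀.map (π.map φ))).obj Y)))).shape
        ≅ G₀.obj (π.obj a))).mpr ?_
  refine (Category.assoc _ _ _).symm.trans ((congrArg (· ≫ _) h₁).trans ?_)
  exact (Category.assoc _ _ _).trans ((congrArg (_ ≫ ·) h₂).trans (Category.assoc _ _ _).symm)

/-- When `F (φ, -)` preserves cartesian morphisms, the endofunctors on the fibres commute with
pullback along the base fixed point. -/
theorem exists_pullbackFibreEndIso {a a' : A} (φ : a ⟶ a')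
    (hφ : ∀ {P Q : Container C} (g : P ⟶ Q), IsCartesian g → IsCartesian (mapPair F φ g)) :
    ∃ θ : fibreEnd s c a' ⋙ Over.pullback (G₀.map (π.map φ)) ≅
      Over.pullback (G₀.map (π.map φ)) ⋙ fibreEnd s c a,
      ∀ Y, mapPair F φ (cart (G₀.map (π.map φ)) Y) ≫ (fibreEndIso s c a' Y).hom =
        (fibreEndIso s c a _).hom ≫ (fibreIncl _).map (θ.hom.app Y).op ≫
          cart (G₀.map (π.map φ)) _ := by
  let m := G₀.map (π.map φ)
  choose θ hθ using fun Y => exists_comp_cart (m := m) _ (fibreEndIso_conj_fwd s c φ Y)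
  have hθ' : ∀ Y, mapPair F φ (cart m Y) ≫ (fibreEndIso s c a' Y).hom =
      (fibreEndIso s c a _).hom ≫ (fibreIncl _).map (θ Y).op ≫ cart m _ :=
    fun Y => (Iso.inv_comp_eq _).mp (hθ Y)
  have hi : ∀ Y, IsIso (θ Y) := fun Y => by
    refine isIso_of_isCartesian_comp_cart (m := m) ?_
    rw [← hθ]
    exact (IsCartesian.of_isIso _).comp ((hφ _ (isCartesian_cart _)).comp (IsCartesian.of_isIso _))
  refine ⟨NatIso.ofComponents (fun Y => asIso (θ Y)) fun {Y Z} g => ?_, hθ'⟩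
  refine comp_cart_injective (m := m) ?_
  have h₁ : mapPair F φ (cart m Z) ≫ (fibreEndIso s c a' Z).hom ≫
      (fibreIncl _).map ((fibreEnd s c a').map g).op =
      (fixFst F a).map ((fibreIncl _).map ((Over.pullback m).map g).op) ≫
        mapPair F φ (cart m Y) ≫ (fibreEndIso s c a' Y).hom := by
    rw [← fibreEndIso_naturality, ← Category.assoc, ← Category.assoc, mapPair_comp_fixFst_map,
      fixFst_map_comp_mapPair, cart_naturality]
  rw [← Category.assoc, hθ', hθ', Category.assoc, Category.assoc, cart_naturality,
    reassoc_of% fibreEndIso_naturality s c a ((Over.pullback m).map g), cancel_epi,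
    ← Category.assoc, ← Category.assoc, ← Functor.map_comp, ← Functor.map_comp] at h₁
  exact h₁

variable [LocallyCartesianClosed C] {b : Bool} {X : ∀ a, Over (G₀.obj (π.obj a))}
  {κ : ∀ a, (fibreEnd s c a).obj (X a) ≅ X a}
  (hκ : ∀ a, IsExtremal b (fibreEnd s c a) (X a) (κ a))

/-- Pulled back along the map of shapes, the fixed point over the target is extremal for the
endofunctor over the source, because pullback has adjoints on both sides. So the comparison with the
fixed point over the source, a morphism of extremal fixed points, is invertible. -/
theorem isCartesian_fixFunctor_map {a a' : A} (φ : a ⟶ a')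
    (hφ : ∀ {P Q : Container C} (g : P ⟶ Q), IsCartesian g → IsCartesian (mapPair F φ g)) :
    IsCartesian ((fixFunctor s c hκ).map φ) := by
  let m := G₀.map (π.map φ)
  obtain ⟨θ, hθ⟩ := exists_pullbackFibreEndIso s c φ hφ
  obtain ⟨v, hv⟩ := exists_comp_cart (m := m) _ (fixFunctor_map_fwd s c hκ φ)
  have key : v ≫ (κ a).inv =
      ((Over.pullback m).map (κ a').inv ≫ θ.hom.app (X a')) ≫ (fibreEnd s c a).map v := by
    have h : (totalIso s c (κ a)).hom ≫ (fibreIncl _).map v.op ≫ cart m (X a') =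
        mapPair F φ ((fibreIncl _).map v.op ≫ cart m (X a')) ≫ (totalIso s c (κ a')).hom := by
      have h := totalIso_comp_fixFunctor_map s c hκ φ
      rw [hv] at h
      exact h
    refine comp_cart_injective (m := m) ((cancel_epi (fibreEndIso s c a (X a)).hom).mp ?_)
    calc _ = (totalIso s c (κ a)).hom ≫ (fibreIncl _).map v.op ≫ cart m (X a') := by
          rw [op_comp, Functor.map_comp]
          simp [totalIso]
      _ = (fixFst F a).map ((fibreIncl _).map v.op) ≫
          (mapPair F φ (cart m (X a')) ≫ (fibreEndIso s c a' (X a')).hom) ≫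
            (fibreIncl _).map (κ a').inv.op := by
          rw [h, ← fixFst_map_comp_mapPair]
          simp only [totalIso, Iso.trans_hom, Functor.mapIso_hom, Iso.op_hom, Iso.symm_hom,
            Category.assoc]
      _ = _ := by
          rw [hθ, Category.assoc, Category.assoc, cart_naturality,
            reassoc_of% fibreEndIso_naturality s c a v]
          simp only [op_comp, Functor.map_comp, Category.assoc]
          rfl
  have hvi : IsIso v := by
    cases b
    · exact (IsTermCoalg.map_rightAdjoint (Over.mapPullbackAdj m) θ (hκ a')).isIso_of_hom (hκ a) key
    · refine (IsInitAlg.map_leftAdjoint (Adjunction.ofIsLeftAdjoint (Over.pullback m)) θ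
        (hκ a')).isIso_of_hom (hκ a) ?_
      have h₁ := (Iso.comp_inv_eq _).mp key
      have h₂ : (Over.pullback m).map (κ a').hom ≫ (Over.pullback m).map (κ a').inv = 𝟙 _ := by
        rw [← Functor.map_comp, Iso.hom_inv_id, CategoryTheory.Functor.map_id]
      refine (congrArg (_ ≫ ·) h₁).trans ?_
      simp only [Category.assoc, reassoc_of% h₂]
      exact θ.inv_hom_id_app_assoc _ _
  rw [hv]
  exact isCartesian_comp_cart v

end

/-! ### Fixed points of the total functor -/

namespace FixKind

/-- Whether the shape of a fixed point is an initial algebra. -/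
def base : FixKind → Bool
  | .mu => true
  | .nu => false
  | .zeta => false

/-- Whether a fixed point is an initial algebra in the slice over its shape. The slices being
opposite to the fibres, this is the dual property for `μ` and `ν`. -/
def fibre : FixKind → Bool
  | .mu => false
  | .nu => true
  | .zeta => false

end FixKind

theorem IsTermCoalg.of_natIso {D : Type u₁} [Category.{v₁} D] {h h' : D ⥤ D} (θ : h ≅ h') {X : D}
    {c : X ⟶ h.obj X} (hX : IsTermCoalg h X c) : IsTermCoalg h' X (c ≫ θ.hom.app X) := by
  intro V γ
  have key : ∀ f : V ⟶ X, f ≫ c = (γ ≫ θ.inv.app V) ≫ h.map f ↔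
      f ≫ c ≫ θ.hom.app X = γ ≫ h'.map f := by
    intro f
    rw [Category.assoc, ← θ.inv.naturality, ← Category.assoc, ← Category.assoc]
    exact Iso.eq_comp_inv (θ.app X)
  obtain ⟨f, hf, hu⟩ := hX V (γ ≫ θ.inv.app V)
  exact ⟨f, (key f).mp hf, fun g hg => hu g ((key g).mpr hg)⟩

section

variable {C : Type u} [Category.{v} C] [HasPullbacks C]

theorem backAlong_eq_of_eq {P Q : Container C} (f : P ⟶ Q) {i j : Q.shape ⟶ P.shape} (h : i = j)
    (hi : i ≫ f.fwd = 𝟙 _) : backAlong f i hi = backAlong f j (h ▸ hi) := by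
  subst h
  rfl

/-- Pulling back along the inverse of an isomorphism is composing with the isomorphism. -/
def pullbackInvIsoMap {M N : C} (β : N ≅ M) : Over.pullback β.inv ≅ Over.map β.hom :=
  NatIso.ofComponents (fun Y => Over.isoMk (asIso (pullback.fst Y.hom β.inv)) (by
      change pullback.fst Y.hom β.inv ≫ Y.hom ≫ β.hom = pullback.snd Y.hom β.inv
      rw [pullback.condition_assoc, Iso.inv_hom_id, Category.comp_id]))
    fun {Y Z} g => by
      ext
      exact pullback.lift_fst _ _ _

/-- The slice functor attached to a functor of constant shape, under a change of that shape. -/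
def toFibreCompMap {D : Type u₁} [Category.{v₁} D] (K : Dᵒᵖ ⥤ Container C) {B B' : C}
    (e : ∀ X, (K.obj X).shape ≅ B)
    (he : ∀ {X Y : Dᵒᵖ} (g : X ⟶ Y), (K.map g).fwd ≫ (e Y).hom = (e X).hom) (β : B ≅ B')
    (e' : ∀ X, (K.obj X).shape ≅ B')
    (he' : ∀ {X Y : Dᵒᵖ} (g : X ⟶ Y), (K.map g).fwd ≫ (e' Y).hom = (e' X).hom)
    (h : ∀ X, (e X).hom ≫ β.hom = (e' X).hom) :
    toFibre K B e he ⋙ Over.map β.hom ≅ toFibre K B' e' he' :=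
  NatIso.ofComponents (fun X => Over.isoMk (Iso.refl _) (by
      refine (Category.id_comp _).trans (Eq.trans ?_ (Category.assoc _ _ _).symm)
      exact congrArg ((K.obj (op X)).hom ≫ ·) (h (op X)).symm))
    fun {X Y} g => by
      ext
      refine (Category.comp_id _).trans (Eq.trans ?_ (Category.id_comp _).symm)
      refine backAlong_eq_of_eq _ ?_ (toFibre_aux K e he g.op)
      have h' : ∀ X, e' X = e X ≪≫ β := fun X => Iso.ext (h X).symm
      rw [h', h']
      simp

end

section

variable {C : Type u} [Category.{v} C] [HasPullbacks C] {A : Type u₁} [Category.{v₁} A]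
  {B : Type u₂} [Category.{v₂} B] {F : A × Container C ⥤ Container C} {π : A ⥤ B}
  {F₀ : B × C ⥤ C} (s : F ⋙ shapeFunctor C ≅ π.prod (shapeFunctor C) ⋙ F₀) {G₀ : B ⥤ C}
  (c : Functor.prod' (𝟭 B) G₀ ⋙ F₀ ≅ G₀)

theorem fixFst_map_fwd (a : A) {P Q : Container C} (g : P ⟶ Q) :
    ((fixFst F a).map g).fwd =
      (shapeAt s a P).hom ≫ (fixFst F₀ (π.obj a)).map g.fwd ≫ (shapeAt s a Q).inv := by
  have h := map_fwd_comp_of_eq s (𝟙 a) g (π.map_id a) rfl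
  exact ((Iso.eq_comp_inv (shapeAt s a Q)).mpr h).trans (Category.assoc _ _ _)

theorem isInitAlg_totalIso {a : A} {X : Over (G₀.obj (π.obj a))}
    {κ : (fibreEnd s c a).obj X ≅ X} (hκ : IsTermCoalg (fibreEnd s c a) X κ.inv)
    (hc : IsInitAlg (fixFst F₀ (π.obj a)) (G₀.obj (π.obj a)) (c.hom.app (π.obj a))) :
    IsInitAlg (fixFst F a) ((fibreIncl _).obj (op X)) (totalIso s c κ).hom := by
  intro Q β
  obtain ⟨m, hm, hu⟩ := hc Q.shape ((shapeAt s a Q).inv ≫ β.fwd)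
  obtain ⟨g, ⟨-, hg⟩, hu'⟩ := existsUnique_algHom s c hκ Q β m hm
  refine ⟨g, hg, fun g' hg' => hu' g' ⟨hu _ ?_, hg'⟩⟩
  have h : (totalIso s c κ).hom.fwd ≫ g'.fwd = ((fixFst F a).map g').fwd ≫ β.fwd :=
    congrArg Container.Hom.fwd hg'
  refine (cancel_epi (shapeAt s a ((fibreIncl _).obj (op X))).hom).mp ?_
  refine (Category.assoc _ _ _).symm.trans (((congrArg (· ≫ g'.fwd)
    (totalIso_hom_fwd s c κ).symm).trans h).trans ?_)
  refine (congrArg (· ≫ β.fwd) (fixFst_map_fwd s a g')).trans ?_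
  simp only [Category.assoc]
  rfl

theorem isTermCoalg_totalIso [LocallyCartesianClosed C] {a : A} {X : Over (G₀.obj (π.obj a))}
    {κ : (fibreEnd s c a).obj X ≅ X} (hκ : IsInitAlg (fibreEnd s c a) X κ.hom)
    (hc : IsTermCoalg (fixFst F₀ (π.obj a)) (G₀.obj (π.obj a)) (c.inv.app (π.obj a))) :
    IsTermCoalg (fixFst F a) ((fibreIncl _).obj (op X)) (totalIso s c κ).inv := by
  intro Q β
  obtain ⟨m, hm, hu⟩ := hc Q.shape (β.fwd ≫ (shapeAt s a Q).hom)
  obtain ⟨g, ⟨-, hg⟩, hu'⟩ := existsUnique_coalgHom s c hκ Q β m (hm.trans (Category.assoc _ _ _))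
  refine ⟨g, hg, fun g' hg' => hu' g' ⟨hu _ ?_, hg'⟩⟩
  have h : g'.fwd ≫ (totalIso s c κ).inv.fwd = β.fwd ≫ ((fixFst F a).map g').fwd :=
    congrArg Container.Hom.fwd hg'
  refine (cancel_mono (shapeAt s a ((fibreIncl _).obj (op X))).inv).mp ?_
  refine (Category.assoc _ _ _).trans (((congrArg (g'.fwd ≫ ·)
    (totalIso_inv_fwd s c κ).symm).trans h).trans ?_)
  refine (congrArg (β.fwd ≫ ·) (fixFst_map_fwd s a g')).trans ?_
  exact ((Category.assoc _ _ _).trans (Category.assoc _ _ _)).symm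

/-- For the base fixed point, `fibreEnd` is the endofunctor of the slice in the definition of a
`ζ`-fixpoint. -/
def fibreEndofunctorIso {a : A}
    (e : fixFst F a ⋙ shapeFunctor C ≅ shapeFunctor C ⋙ fixFst F₀ (π.obj a))
    (he : ∀ Q, e.app Q = shapeAt s a Q) :
    fibreEndofunctor e (baseIso c (π.obj a)).inv ≅ fibreEnd s c a :=
  Functor.isoWhiskerLeft _ (pullbackInvIsoMap (baseIso c (π.obj a))) ≪≫
    toFibreCompMap _ _
      (fun g => (e.hom.naturality ((fibreIncl _).map g)).trans
        ((congrArg (_ ≫ ·) ((fixFst F₀ (π.obj a)).map_id _)).trans (Category.comp_id _)))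
      (baseIso c (π.obj a)) _ (fibreShapeIso_naturality s c a)
      (fun _ => congrArg (fun i => Iso.hom i ≫ (baseIso c (π.obj a)).hom) (he _))

theorem fibreEndofunctorIso_hom_app_left {a : A}
    (e : fixFst F a ⋙ shapeFunctor C ≅ shapeFunctor C ⋙ fixFst F₀ (π.obj a))
    (he : ∀ Q, e.app Q = shapeAt s a Q) (Y : Over (G₀.obj (π.obj a))) :
    ((fibreEndofunctorIso s c e he).hom.app Y).left =
      pullback.fst (((fixFst F a).obj ((fibreIncl _).obj (op Y))).hom ≫
        (e.app ((fibreIncl _).obj (op Y))).hom) (baseIso c (π.obj a)).inv :=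
  Category.comp_id _

theorem backAlong_totalIso {a : A} {X : Over (G₀.obj (π.obj a))}
    (κ : (fibreEnd s c a).obj X ≅ X) :
    backAlong (totalIso s c κ).hom (totalIso s c κ).inv.fwd
      (by rw [← comp_fwd, Iso.inv_hom_id, id_fwd]) = κ.inv.left := by
  have h₁ : 𝟙 X.left ≫ X.hom = (X.hom ≫ (totalIso s c κ).inv.fwd) ≫ (totalIso s c κ).hom.fwd := by
    refine (Category.id_comp _).trans (Eq.symm ((Category.assoc _ _ _).trans
      ((congrArg (X.hom ≫ ·) (congrArg Container.Hom.fwd (totalIso s c κ).inv_hom_id)).trans ?_)))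
    exact Category.comp_id _
  refine (Container.Hom.bk_comp (fibreEndIso s c a X).hom ((fibreIncl _).map κ.inv.op) _ _ h₁).trans
    ?_
  refine (pullback.lift_fst _ _ _).trans ?_
  exact (bk_fibreIncl κ.inv _ _ _).trans (Category.id_comp _)

theorem isTermCoalg_fibreEndofunctor {a : A} {X : Over (G₀.obj (π.obj a))}
    {κ : (fibreEnd s c a).obj X ≅ X} (hκ : IsTermCoalg (fibreEnd s c a) X κ.inv)
    (e : fixFst F a ⋙ shapeFunctor C ≅ shapeFunctor C ⋙ fixFst F₀ (π.obj a))
    (he : ∀ Q, e.app Q = shapeAt s a Q)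
    {m : G₀.obj (π.obj a) ⟶ (fixFst F₀ (π.obj a)).obj (G₀.obj (π.obj a))}
    (hm : m = (baseIso c (π.obj a)).inv) (w : X ⟶ (fibreEndofunctor e m).obj X)
    (hw : w.left ≫ pullback.fst (((fixFst F a).obj ((fibreIncl _).obj (op X))).hom ≫
        (e.app ((fibreIncl _).obj (op X))).hom) m = κ.inv.left) :
    IsTermCoalg (fibreEndofunctor e m) X w := by
  subst hm
  have hw' : w = κ.inv ≫ (fibreEndofunctorIso s c e he).inv.app X := by
    refine (Iso.eq_comp_inv ((fibreEndofunctorIso s c e he).app X)).mpr ?_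
    ext
    exact (congrArg (w.left ≫ ·) (fibreEndofunctorIso_hom_app_left s c e he X)).trans hw
  rw [hw']
  exact hκ.of_natIso (fibreEndofunctorIso s c e he).symm

/-- The structure map on shapes in the definition of a `ζ`-fixpoint is the inverse of `baseIso`. -/
theorem baseStr_totalIso {a : A} {X : Over (G₀.obj (π.obj a))} (κ : (fibreEnd s c a).obj X ≅ X)
    (e : fixFst F a ⋙ shapeFunctor C ≅ shapeFunctor C ⋙ fixFst F₀ (π.obj a))
    (he : ∀ Q, e.app Q = shapeAt s a Q) :
    baseStr e (totalIso s c κ) = (baseIso c (π.obj a)).inv := by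
  have h := congrArg Iso.hom (he ((fibreIncl _).obj (op X)))
  refine (congrArg₂ (· ≫ ·) (totalIso_inv_fwd s c κ) h).trans ?_
  refine (Category.assoc _ _ _).trans ?_
  exact (congrArg (c.inv.app (π.obj a) ≫ ·)
    (shapeAt s a ((fibreIncl _).obj (op X))).inv_hom_id).trans (Category.comp_id _)

theorem isTermCoalg_fibreStr {a : A} {X : Over (G₀.obj (π.obj a))}
    {κ : (fibreEnd s c a).obj X ≅ X} (hκ : IsTermCoalg (fibreEnd s c a) X κ.inv)
    (e : fixFst F a ⋙ shapeFunctor C ≅ shapeFunctor C ⋙ fixFst F₀ (π.obj a))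
    (he : ∀ Q, e.app Q = shapeAt s a Q) :
    IsTermCoalg (fibreEndofunctor e (baseStr e (totalIso s c κ))) X
      (fibreStr e (totalIso s c κ)) :=
  isTermCoalg_fibreEndofunctor s c hκ e he (baseStr_totalIso s c κ e he) _
    ((pullback.lift_fst _ _ _).trans (backAlong_totalIso s c κ))

/-- A fixed point in a fibre with the property `γ.fibre`, over one in the base with the property
`γ.base`, is a fixpoint of kind `γ` of the total functor. -/
theorem isFixpoint_totalIso [LocallyCartesianClosed C] (γ : FixKind) {a : A}
    {X : Over (G₀.obj (π.obj a))} {κ : (fibreEnd s c a).obj X ≅ X}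
    (hκ : IsExtremal γ.fibre (fibreEnd s c a) X κ)
    (hc : IsExtremal γ.base (fixFst F₀ (π.obj a)) (G₀.obj (π.obj a)) (baseIso c (π.obj a)))
    (h : fixFst F a ⋙ shapeFunctor C = shapeFunctor C ⋙ fixFst F₀ (π.obj a))
    (he : ∀ Q, (eqToIso h).app Q = shapeAt s a Q) :
    IsFixpoint γ (fixFst F a) ((fibreIncl _).obj (op X)) (totalIso s c κ) := by
  cases γ
  · exact (isInitAlg_totalIso s c hκ hc).isInitial
  · exact (isTermCoalg_totalIso s c hκ hc).isTerminal
  · refine ⟨fixFst F₀ (π.obj a), h, ?_, (isTermCoalg_fibreStr s c hκ _ he).isTerminal⟩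
    have hc' : IsTermCoalg (fixFst F₀ (π.obj a)) (G₀.obj (π.obj a))
        (baseStr (eqToIso h) (totalIso s c κ)) := by
      rw [baseStr_totalIso s c κ _ he]
      exact hc
    exact hc'.isTerminal

end

/-! ### The base fixed point -/

section

theorem snocFunctor_comp_eval_castSucc (D : Type u₁) [Category.{v₁} D] (k : ℕ) (j : Fin k) :
    snocFunctor D k ⋙ Pi.eval (fun _ => D) j.castSucc =
      CategoryTheory.Prod.fst (Fin k → D) D ⋙ Pi.eval (fun _ => D) j := by
  rw [snocFunctor, Functor.pi'_eval, Fin.lastCases_castSucc]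

theorem snocFunctor_comp_eval_last (D : Type u₁) [Category.{v₁} D] (k : ℕ) :
    snocFunctor D k ⋙ Pi.eval (fun _ => D) (Fin.last k) =
      CategoryTheory.Prod.snd (Fin k → D) D := by
  rw [snocFunctor, Functor.pi'_eval, Fin.lastCases_last]

variable (C : Type u) [Category.{v} C] [HasFiniteLimits C]

/-- The equivalence between a category and its slice over the terminal object. -/
abbrev overTerminal : C ⥤ Over (⊤_ C) :=
  (Over.equivalenceOfIsTerminal terminalIsTerminal).inverse

/-- The equivalence between a power of the category and the power of its slice over the terminal
object. -/
abbrev powOverTerminal (ι : Type) : (ι → C) ⥤ (ι → Over (⊤_ C)) :=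
  Functor.pi (fun _ => overTerminal C)

theorem powOverTerminal_comp_splitLast (k : ℕ) :
    snocFunctor C k ⋙ powOverTerminal C (Fin (k + 1)) ⋙ splitLast (fun _ => ⊤_ C) =
      (powOverTerminal C (Fin k)).prod (overTerminal C) := by
  have h₁ : snocFunctor C k ⋙ powOverTerminal C (Fin (k + 1)) ⋙
      Functor.pi' (fun j : Fin k => Pi.eval (fun _ => Over (⊤_ C)) j.castSucc) =
      CategoryTheory.Prod.fst (Fin k → C) C ⋙ powOverTerminal C (Fin k) :=
    Functor.pi_ext _ _ fun j =>
      congrArg (· ⋙ overTerminal C) (snocFunctor_comp_eval_castSucc C k j)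
  have h₂ : snocFunctor C k ⋙ powOverTerminal C (Fin (k + 1)) ⋙
      Pi.eval (fun _ => Over (⊤_ C)) (Fin.last k) =
      CategoryTheory.Prod.snd (Fin k → C) C ⋙ overTerminal C :=
    congrArg (· ⋙ overTerminal C) (snocFunctor_comp_eval_last C k)
  exact congrArg₂ (Functor.prod' (A := (Fin k → C) × C)) h₁ h₂

variable {C} [FinitaryExtensive C] [LocallyCartesianClosed C] [HasDependentWTypes C]
  [HasDependentMTypes C]

/-- A polynomial functor `C^{k+1} ⥤ C` has parametric fixed points, and they are polynomial: the case
of slices over the terminal object. -/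
theorem exists_isParamFix_of_isPolynomialBase (b : Bool) {k : ℕ} {F₀ : (Fin (k + 1) → C) ⥤ C}
    (hF₀ : IsPolynomialBase F₀) :
    ∃ K : (Fin k → C) ⥤ C, IsPolynomialBase K ∧ IsParamFix b (snocFunctor C k ⋙ F₀) K := by
  obtain ⟨D, ⟨i⟩⟩ := hF₀
  let T := Over.equivalenceOfIsTerminal (terminalIsTerminal (C := C))
  let J : Fin (k + 1) → C := fun _ => ⊤_ C
  have := splitLast_isEquivalence J
  obtain ⟨K, ⟨D', ⟨i'⟩⟩, hK⟩ := exists_isParamFix_of_isPolynomialFibre (J := J) b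
    (G := overSigma J ⋙ D.functor) ⟨D, ⟨Iso.refl _⟩⟩
  let Ψ := (splitLast J).asEquivalence
  let θ : (snocFunctor C k ⋙ F₀) ⋙ overTerminal C ≅
      (powOverTerminal C (Fin k)).prod (overTerminal C) ⋙ Ψ.inverse ⋙ overSigma J ⋙ D.functor :=
    Functor.isoWhiskerRight (Functor.isoWhiskerLeft (snocFunctor C k) i) (overTerminal C) ≪≫
      Functor.isoWhiskerLeft (snocFunctor C k ⋙ powSigma C (Fin (k + 1)) ⋙ D.functor)
        T.unitIso.symm ≪≫
      Functor.isoWhiskerLeft (snocFunctor C k ⋙ powOverTerminal C (Fin (k + 1)))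
        (Functor.isoWhiskerRight Ψ.unitIso (overSigma J ⋙ D.functor)) ≪≫
      Functor.isoWhiskerRight (eqToIso (powOverTerminal_comp_splitLast C k))
        (Ψ.inverse ⋙ overSigma J ⋙ D.functor)
  let i₁ : (overTerminal C).inv ≅ Over.forget (⊤_ C) :=
    Functor.isoWhiskerRight T.unitIso (overTerminal C).inv ≪≫
      Functor.isoWhiskerLeft (Over.forget (⊤_ C)) (overTerminal C).asEquivalence.unitIso.symm
  refine ⟨_, ⟨D', ⟨?_⟩⟩, (hK (Ψ.inverse ⋙ overSigma J ⋙ D.functor)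
    ⟨(Functor.isoWhiskerRight Ψ.unitIso (overSigma J ⋙ D.functor)).symm⟩).of_equiv
      (powOverTerminal C (Fin k)) (overTerminal C) θ⟩
  exact Functor.isoWhiskerLeft (powOverTerminal C (Fin k)) (Functor.isoWhiskerLeft K i₁ ≪≫
    Functor.isoWhiskerRight i' (Over.forget (⊤_ C)))

end

/-! ### The fixed points in the fibres -/

section

variable {C : Type u} [Category.{v} C] [HasPullbacks C] {ι : Type}

/-- The inclusion of the fibre of `Container(C)^ι × Container(C)` over `(I, M)`. -/
abbrev fibreInclPair (I : ι → C) (M : C) :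
    ((∀ i, Over (I i)) × Over M)ᵒᵖ ⥤ (ι → Container C) × Container C :=
  Functor.prod' ((CategoryTheory.Prod.fst _ _).op ⋙ fibreInclPow I)
    ((CategoryTheory.Prod.snd _ _).op ⋙ fibreIncl M)

section

variable {F : (ι → Container C) × Container C ⥤ Container C} {F₀ : (ι → C) × C ⥤ C}
  (s : F ⋙ shapeFunctor C ≅ (shapePow C ι).prod (shapeFunctor C) ⋙ F₀) {G₀ : (ι → C) ⥤ C}
  (c : Functor.prod' (𝟭 (ι → C)) G₀ ⋙ F₀ ≅ G₀)

theorem fibreInclPair_shape_naturality (I : ι → C)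
    {p q : ((∀ i, Over (I i)) × Over (G₀.obj I))ᵒᵖ} (g : p ⟶ q) :
    ((fibreInclPair I (G₀.obj I) ⋙ F).map g).fwd ≫
      (s.app ((fibreInclPair I (G₀.obj I)).obj q) ≪≫ c.app I).hom =
      (s.app ((fibreInclPair I (G₀.obj I)).obj p) ≪≫ c.app I).hom := by
  refine (Category.assoc _ _ _).symm.trans (congrArg (· ≫ c.hom.app I) ?_)
  refine (s.hom.naturality ((fibreInclPair I (G₀.obj I)).map g)).trans ?_
  exact (congrArg (_ ≫ ·) (F₀.map_id (I, G₀.obj I))).trans (Category.comp_id _)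

/-- The functor induced by `F` on the fibres over `(I, G₀ I)`. -/
def fibrePair (I : ι → C) : (∀ i, Over (I i)) × Over (G₀.obj I) ⥤ Over (G₀.obj I) :=
  toFibre (fibreInclPair I (G₀.obj I) ⋙ F) (G₀.obj I) (fun _ => s.app _ ≪≫ c.app I)
    (fibreInclPair_shape_naturality s c I)

/-- The family of slice objects underlying a family of containers. -/
abbrev overPow (a : ι → Container C) : ∀ i, Over ((shapePow C ι).obj a i) :=
  fun i => Over.mk (a i).hom

/-- Fixing the parameters on the fibres, or fixing the containers before passing to the fibre, gives
the same endofunctor of the slice. -/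
theorem fixFst_fibrePair (a : ι → Container C) :
    fixFst (fibrePair s c ((shapePow C ι).obj a)) (overPow a) = fibreEnd s c a := by
  refine CategoryTheory.Functor.ext (fun _ => rfl) fun Y Z g => ?_
  refine Eq.trans ?_ ((Category.id_comp _).trans (Category.comp_id _)).symm
  ext
  refine backAlong_congr ?_ _ (toFibre_aux (fibreInclPair _ _ ⋙ F) _
    (fibreInclPair_shape_naturality s c _)
    (Quiver.Hom.op (X := (overPow a, Y)) (Y := (overPow a, Z)) (𝟙 _, g)))
  refine congrArg F.map (Prod.ext ?_ rfl)
  exact (fibreInclPow _).map_id (op (overPow a))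

theorem IsExtremal.congr {b : Bool} {D : Type u₁} [Category.{v₁} D] {H H' : D ⥤ D} (h : H = H')
    {X : D} {a : H.obj X ≅ X} {a' : H'.obj X ≅ X} (ha : a ≍ a') (hX : IsExtremal b H X a) :
    IsExtremal b H' X a' := by
  subst h
  cases ha
  exact hX

/-- A fixed point of `fibreEnd` from a parametric fixed point of `fibrePair`. -/
abbrev fibreFix {I : ι → C} {K : (∀ i, Over (I i)) ⥤ Over (G₀.obj I)}
    (κ : Functor.prod' (𝟭 _) K ⋙ fibrePair s c I ≅ K) (Y : ∀ i, Over (I i)) :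
    (fibreEnd s c ((fibreInclPow I).obj (op Y))).obj (K.obj Y) ≅ K.obj Y :=
  κ.app Y

end

end

section

variable {C : Type u} [Category.{v} C] [HasPullbacks C]

/-- Equal functors of constant shape have isomorphic slice functors. -/
theorem nonempty_toFibre_iso {D : Type u₁} [Category.{v₁} D] {K K' : Dᵒᵖ ⥤ Container C} {B : C}
    (hK : K = K') (e : ∀ X, (K.obj X).shape ≅ B)
    (he : ∀ {X Y : Dᵒᵖ} (g : X ⟶ Y), (K.map g).fwd ≫ (e Y).hom = (e X).hom)
    (e' : ∀ X, (K'.obj X).shape ≅ B)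
    (he' : ∀ {X Y : Dᵒᵖ} (g : X ⟶ Y), (K'.map g).fwd ≫ (e' Y).hom = (e' X).hom)
    (h : ∀ X, (e X).hom = eqToHom (by rw [hK]) ≫ (e' X).hom) :
    Nonempty (toFibre K B e he ≅ toFibre K' B e' he') := by
  subst hK
  have : e = e' := funext fun X => Iso.ext ((h X).trans (Category.id_comp _))
  subst this
  exact ⟨Iso.refl _⟩

variable {k : ℕ} {F : (Fin (k + 1) → Container C) ⥤ Container C} {F₀ : (Fin (k + 1) → C) ⥤ C}

theorem splitLast_comp_fibreInclPair (J : Fin (k + 1) → C) :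
    (splitLast J).op ⋙ fibreInclPair (fun j : Fin k => J j.castSucc) (J (Fin.last k)) ⋙
      snocFunctor (Container C) k = fibreInclPow J := by
  refine Functor.pi_ext _ _ fun i => ?_
  refine Fin.lastCases ?_ (fun j => ?_) i
  · exact congrArg (fun K : _ ⥤ Container C => (splitLast J).op ⋙ fibreInclPair _ _ ⋙ K)
      (snocFunctor_comp_eval_last (Container C) k)
  · exact congrArg (fun K : _ ⥤ Container C => (splitLast J).op ⋙ fibreInclPair _ _ ⋙ K)
      (snocFunctor_comp_eval_castSucc (Container C) k j)

end

section

variable {C : Type u} [Category.{v} C] [HasFiniteLimits C] [FinitaryExtensive C]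
  [LocallyCartesianClosed C] [HasDependentWTypes C] [HasDependentMTypes C] {k : ℕ}
  {F : (Fin (k + 1) → Container C) ⥤ Container C} {F₀ : (Fin (k + 1) → C) ⥤ C}

/-- The functors induced on fibres have polynomial parametric fixed points. The family `J` of shapes is
the image of `(I, M)` under `snocFunctor`; the components of such a family are `I` and `M` by
propositional equalities only, which is why `J` and the equalities are kept as variables. -/
theorem exists_isParamFix_fibre (b : Bool) (h : F ⋙ shapeFunctor C = shapePow C (Fin (k + 1)) ⋙ F₀)
    (J : Fin (k + 1) → C) (hJ : IsPolynomialFibre (fibreFunctor (eqToIso h) J)) (I : Fin k → C)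
    (M : C) (hI : (fun j => J (Fin.castSucc j)) = I) (hM : J (Fin.last k) = M)
    (β : F₀.obj J ≅ M)
    (e : ∀ p, ((fibreInclPair I M ⋙ snocFunctor (Container C) k ⋙ F).obj p).shape ≅ M)
    (he : ∀ {p q} (g : p ⟶ q), ((fibreInclPair I M ⋙ snocFunctor (Container C) k ⋙ F).map g).fwd ≫
      (e q).hom = (e p).hom)
    (heβ : ∀ p, ∃ hp, (e p).hom = eqToHom hp ≫ β.hom) :
    ∃ K : (∀ j, Over (I j)) ⥤ Over M, IsPolynomialFibre K ∧
      IsParamFix b (toFibre (fibreInclPair I M ⋙ snocFunctor (Container C) k ⋙ F) M e he) K := by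
  subst hI hM
  obtain ⟨K, hK, hK'⟩ := exists_isParamFix_of_isPolynomialFibre b (hJ.comp_map β.hom)
  refine ⟨K, hK, hK' _ ?_⟩
  let e₁ : ∀ X, ((fibreInclPow J ⋙ F).obj X).shape ≅ J (Fin.last k) :=
    fun X => (eqToIso h).app ((fibreInclPow J).obj X) ≪≫ β
  have he₀ : ∀ {X Y} (g : X ⟶ Y), ((fibreInclPow J ⋙ F).map g).fwd ≫
      ((eqToIso h).app ((fibreInclPow J).obj Y)).hom =
        ((eqToIso h).app ((fibreInclPow J).obj X)).hom := fun g =>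
    ((eqToIso h).hom.naturality ((fibreInclPow J).map g)).trans
      ((congrArg (_ ≫ ·) (F₀.map_id J)).trans (Category.comp_id _))
  have he₁ : ∀ {X Y} (g : X ⟶ Y), ((fibreInclPow J ⋙ F).map g).fwd ≫ (e₁ Y).hom = (e₁ X).hom := by
    intro X Y g
    exact (Category.assoc _ _ _).symm.trans (congrArg (· ≫ β.hom) (he₀ g))
  have hs : ((splitLast J).op ⋙ fibreInclPair (fun j : Fin k => J j.castSucc) (J (Fin.last k)) ⋙
      snocFunctor (Container C) k ⋙ F) = fibreInclPow J ⋙ F :=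
    congrArg (· ⋙ F) (splitLast_comp_fibreInclPair J)
  obtain ⟨i⟩ := nonempty_toFibre_iso hs (fun X => e ((splitLast J).op.obj X))
    (fun g => he ((splitLast J).op.map g)) e₁ he₁ (fun X => by
      obtain ⟨hp, hp'⟩ := heβ ((splitLast J).op.obj X)
      refine hp'.trans (Eq.trans ?_ (congrArg (fun t => eqToHom _ ≫ t ≫ β.hom)
        (eqToHom_app h ((fibreInclPow J).obj X))).symm)
      exact Eq.symm ((Category.assoc _ _ _).symm.trans
        (congrArg (· ≫ β.hom) (eqToHom_trans _ _))))
  refine ⟨?_ ≪≫ i ≪≫ (toFibreCompMap _ _ he₀ β e₁ he₁ fun X => rfl).symm⟩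
  exact Iso.refl _

end

/-! ### Assembling the fibred polynomial fixed point -/

section

variable {C : Type u} [Category.{v} C] [HasPullbacks C]

/-- A functor into a slice is recovered from the containers it gives. -/
def toFibreFibreIncl {D : Type u₁} [Category.{v₁} D] {B : C} (K : D ⥤ Over B)
    (he : ∀ {X Y : Dᵒᵖ} (g : X ⟶ Y),
      ((K.op ⋙ fibreIncl B).map g).fwd ≫ (Iso.refl B).hom = (Iso.refl B).hom) :
    toFibre (K.op ⋙ fibreIncl B) B (fun _ => Iso.refl B) he ≅ K :=
  NatIso.ofComponents (fun X => Over.isoMk (Iso.refl _) (by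
      exact (Category.id_comp _).trans (Category.comp_id _).symm))
    fun {X Y} g => by
      ext
      refine (Category.comp_id _).trans (Eq.trans ?_ (Category.id_comp _).symm)
      exact (bk_fibreIncl (K.map g) _ _ _).trans (Category.id_comp _)

theorem IsCartesian.map_of_eq {A : Type u₁} [Category.{v₁} A] {K K' : A ⥤ Container C}
    (h : K = K') {P Q : A} {f : P ⟶ Q} (hf : IsCartesian (K'.map f)) : IsCartesian (K.map f) := by
  subst h
  exact hf

theorem isCartesian_snocFunctor_map {k : ℕ} {a a' : Fin k → Container C} {P Q : Container C}
    (φ : a ⟶ a') (g : P ⟶ Q) (hφ : ∀ j, IsCartesian (φ j)) (hg : IsCartesian g)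
    (i : Fin (k + 1)) :
    IsCartesian ((snocFunctor (Container C) k).map ((φ, g) : (a, P) ⟶ (a', Q)) i) := by
  refine Fin.lastCases ?_ (fun j => ?_) i
  · exact IsCartesian.map_of_eq (f := ((φ, g) : (a, P) ⟶ (a', Q)))
      (snocFunctor_comp_eval_last (Container C) k) hg
  · exact IsCartesian.map_of_eq (f := ((φ, g) : (a, P) ⟶ (a', Q)))
      (snocFunctor_comp_eval_castSucc (Container C) k j) (hφ j)

theorem snocFunctor_comp_shapePow (k : ℕ) :
    snocFunctor (Container C) k ⋙ shapePow C (Fin (k + 1)) =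
      (shapePow C (Fin k)).prod (shapeFunctor C) ⋙ snocFunctor C k := by
  refine Functor.pi_ext _ _ fun i => ?_
  refine Fin.lastCases ?_ (fun j => ?_) i
  · exact (congrArg (· ⋙ shapeFunctor C) (snocFunctor_comp_eval_last (Container C) k)).trans
      (congrArg ((shapePow C (Fin k)).prod (shapeFunctor C) ⋙ ·)
        (snocFunctor_comp_eval_last C k)).symm
  · exact (congrArg (· ⋙ shapeFunctor C)
      (snocFunctor_comp_eval_castSucc (Container C) k j)).trans
      (congrArg ((shapePow C (Fin k)).prod (shapeFunctor C) ⋙ ·)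
        (snocFunctor_comp_eval_castSucc C k j)).symm

theorem snocFunctor_comp_shapeFunctor {k : ℕ} {F : (Fin (k + 1) → Container C) ⥤ Container C}
    {F₀ : (Fin (k + 1) → C) ⥤ C} (h : F ⋙ shapeFunctor C = shapePow C (Fin (k + 1)) ⋙ F₀) :
    (snocFunctor (Container C) k ⋙ F) ⋙ shapeFunctor C =
      (shapePow C (Fin k)).prod (shapeFunctor C) ⋙ snocFunctor C k ⋙ F₀ :=
  (congrArg (snocFunctor (Container C) k ⋙ ·) h).trans
    (congrArg (· ⋙ F₀) (snocFunctor_comp_shapePow k))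

variable {ι : Type} {F : (ι → Container C) × Container C ⥤ Container C} {F₀ : (ι → C) × C ⥤ C}

theorem fixFst_comp_shapeFunctor
    (h : F ⋙ shapeFunctor C = (shapePow C ι).prod (shapeFunctor C) ⋙ F₀) (a : ι → Container C) :
    fixFst F a ⋙ shapeFunctor C = shapeFunctor C ⋙ fixFst F₀ ((shapePow C ι).obj a) :=
  CategoryTheory.Functor.ext (fun Q => Functor.congr_obj h (a, Q)) fun P Q g =>
    Functor.congr_hom h ((𝟙 a, g) : (a, P) ⟶ (a, Q))

theorem eqToIso_app_eq_shapeAt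
    (h : F ⋙ shapeFunctor C = (shapePow C ι).prod (shapeFunctor C) ⋙ F₀) (a : ι → Container C)
    (Q : Container C) :
    (eqToIso (fixFst_comp_shapeFunctor h a)).app Q = shapeAt (eqToIso h) a Q := by
  refine Iso.ext ((eqToHom_app _ _).trans (eqToHom_app h (a, Q)).symm)

variable (s : F ⋙ shapeFunctor C ≅ (shapePow C ι).prod (shapeFunctor C) ⋙ F₀) {G₀ : (ι → C) ⥤ C}
  (c : Functor.prod' (𝟭 (ι → C)) G₀ ⋙ F₀ ≅ G₀)

/-- The container isomorphisms are natural along the maps given by a parametric fixed point of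
`fibrePair`. -/
theorem totalIso_naturality {I : ι → C} {K : (∀ i, Over (I i)) ⥤ Over (G₀.obj I)}
    (κ : Functor.prod' (𝟭 _) K ⋙ fibrePair s c I ≅ K) {Y Y' : ∀ i, Over (I i)} (g : Y' ⟶ Y) :
    (totalIso s c (fibreFix s c κ Y)).hom ≫ (fibreIncl _).map (K.map g).op =
      mapPair F ((fibreInclPow I).map g.op) ((fibreIncl _).map (K.map g).op) ≫
        (totalIso s c (fibreFix s c κ Y')).hom := by
  have h₁ : mapPair F ((fibreInclPow I).map g.op) ((fibreIncl _).map (K.map g).op) ≫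
      (fibreEndIso s c ((fibreInclPow I).obj (op Y')) (K.obj Y')).hom =
      (fibreEndIso s c ((fibreInclPow I).obj (op Y)) (K.obj Y)).hom ≫
        (fibreIncl _).map ((fibrePair s c I).map
          ((g, K.map g) : (Y', K.obj Y') ⟶ (Y, K.obj Y))).op :=
    (toFibreIso (fibreInclPair I (G₀.obj I) ⋙ F) (G₀.obj I) (fun _ => s.app _ ≪≫ c.app I)
      (fibreInclPair_shape_naturality s c I)).hom.naturality
        (Quiver.Hom.op (X := (Y', K.obj Y')) (Y := (Y, K.obj Y)) (g, K.map g))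
  have h₂ : K.map g ≫ κ.inv.app Y = κ.inv.app Y' ≫ (fibrePair s c I).map
      ((g, K.map g) : (Y', K.obj Y') ⟶ (Y, K.obj Y)) := κ.inv.naturality g
  have h₃ : ∀ Y, (totalIso s c (fibreFix s c κ Y)).hom =
      (fibreEndIso s c ((fibreInclPow I).obj (op Y)) (K.obj Y)).hom ≫
        (fibreIncl _).map (κ.inv.app Y).op := fun _ => rfl
  rw [h₃, h₃]
  refine (Category.assoc _ _ _).trans (Eq.trans ?_
    ((congrArg (· ≫ _) h₁).symm.trans (Category.assoc _ _ _)))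
  refine Eq.trans (congrArg (_ ≫ ·) ?_) (Category.assoc _ _ _).symm
  refine ((fibreIncl _).map_comp (κ.inv.app Y).op (K.map g).op).symm.trans ?_
  refine (congrArg (fun t => (fibreIncl (G₀.obj I)).map (Quiver.Hom.op t)) h₂).trans ?_
  exact (fibreIncl _).map_comp _ _

variable {b : Bool}
  {K : ∀ I : ι → C, (∀ i, Over (I i)) ⥤ Over (G₀.obj I)}
  {κ : ∀ I, Functor.prod' (𝟭 _) (K I) ⋙ fibrePair s c I ≅ K I}

theorem isExtremal_fibreFix (hκ : ∀ I Y, IsExtremal b (fixFst (fibrePair s c I) Y) ((K I).obj Y)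
      ((κ I).app Y)) (a : ι → Container C) :
    IsExtremal b (fibreEnd s c a) ((K ((shapePow C ι).obj a)).obj (overPow a))
      (fibreFix s c (κ _) (overPow a)) :=
  (hκ ((shapePow C ι).obj a) (overPow a)).congr (fixFst_fibrePair s c a) HEq.rfl

variable [LocallyCartesianClosed C]

/-- On fibres, the fixed point functor is the parametric fixed point of `fibrePair`. -/
theorem nonempty_fibreFunctor_fixFunctor_iso
    (hκ : ∀ I Y, IsExtremal b (fixFst (fibrePair s c I) Y) ((K I).obj Y) ((κ I).app Y))
    (I : ι → C) :
    Nonempty (fibreFunctor (eqToIso (fixFunctor_comp_shapeFunctor s c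
      (isExtremal_fibreFix s c hκ))) I ≅ K I) := by
  have h : fibreInclPow I ⋙ fixFunctor s c (isExtremal_fibreFix s c hκ) =
      (K I).op ⋙ fibreIncl (G₀.obj I) := by
    refine CategoryTheory.Functor.ext (fun _ => rfl) fun Y Y' g => ?_
    refine Eq.trans ?_ ((Category.id_comp _).trans (Category.comp_id _)).symm
    refine fixFunctor_map_eq s c (isExtremal_fibreFix s c hκ) ((fibreInclPow I).map g) ?_
      (totalIso_naturality s c (κ I) g.unop)
    exact (G₀.map_id I).symm
  have he : ∀ {X Y} (g : X ⟶ Y), (((K I).op ⋙ fibreIncl (G₀.obj I)).map g).fwd ≫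
      (Iso.refl (G₀.obj I)).hom = (Iso.refl (G₀.obj I)).hom := fun _ => Category.comp_id _
  let e := eqToIso (fixFunctor_comp_shapeFunctor s c (isExtremal_fibreFix s c hκ))
  obtain ⟨i⟩ := nonempty_toFibre_iso (B := G₀.obj I) h
    (fun Y => e.app ((fibreInclPow I).obj Y))
    (fun g => (e.hom.naturality ((fibreInclPow I).map g)).trans
      ((congrArg (_ ≫ ·) (G₀.map_id I)).trans (Category.comp_id _)))
    (fun _ => Iso.refl _) he (fun Y => (eqToHom_app _ _).trans (Category.comp_id _).symm)
  exact ⟨i ≪≫ toFibreFibreIncl (K I) he⟩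

end

section

variable {C : Type u} [Category.{v} C] [HasFiniteLimits C] [FinitaryExtensive C]
  [LocallyCartesianClosed C] [HasDependentWTypes C] [HasDependentMTypes C]

/-- The parametric fixed point on shapes and those on the fibres glue to a fibred polynomial
functor of fixpoints. -/
theorem exists_isFibredPolynomial_isFixpoint {k : ℕ}
    {F : (Fin (k + 1) → Container C) ⥤ Container C} (hF : IsFibredPolynomial F) (γ : FixKind) :
    ∃ (G : (Fin k → Container C) ⥤ Container C) (a : diagApp F G ≅ G), IsFibredPolynomial G ∧
      ∀ f : Fin k → Container C, IsFixpoint γ (partialApp F f) (G.obj f) (a.app f) := by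
  obtain ⟨F₀, h, hcart, hbase, hfib⟩ := hF
  obtain ⟨G₀, hG₀, c, hc⟩ := exists_isParamFix_of_isPolynomialBase γ.base hbase
  let s := eqToIso (snocFunctor_comp_shapeFunctor h)
  have hfix : ∀ I, ∃ K : (∀ j, Over (I j)) ⥤ Over (G₀.obj I), IsPolynomialFibre K ∧
      IsParamFix γ.fibre (fibrePair s c I) K := fun I =>
    exists_isParamFix_fibre γ.fibre h ((snocFunctor C k).obj (I, G₀.obj I)) (hfib _) I (G₀.obj I)
      (funext fun j => Functor.congr_obj (snocFunctor_comp_eval_castSucc C k j) (I, G₀.obj I))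
      (Functor.congr_obj (snocFunctor_comp_eval_last C k) (I, G₀.obj I)) (c.app I)
      (fun _ => s.app _ ≪≫ c.app I) (fibreInclPair_shape_naturality s c I)
      (fun p => ⟨_, congrArg (· ≫ c.hom.app I)
        (eqToHom_app (snocFunctor_comp_shapeFunctor h) ((fibreInclPair I (G₀.obj I)).obj p))⟩)
  choose K hK κ hκ using hfix
  have hκ' := isExtremal_fibreFix s c hκ
  refine ⟨fixFunctor s c hκ', fixFunctorIso s c hκ', ⟨G₀, fixFunctor_comp_shapeFunctor s c hκ', ?_,
    hG₀, fun I => ?_⟩, fun f => ?_⟩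
  · intro P Q f hf
    exact isCartesian_fixFunctor_map s c hκ' f fun g hg =>
      hcart _ (isCartesian_snocFunctor_map f g hf hg)
  · obtain ⟨i⟩ := nonempty_fibreFunctor_fixFunctor_iso s c hκ I
    exact (hK I).of_iso i
  · exact isFixpoint_totalIso s c γ (hκ' f) (hc _) _
      (eqToIso_app_eq_shapeAt (snocFunctor_comp_shapeFunctor h) f)

end

end

end FibCont

theorem mainTheorem2 {C : Type u} [CategoryTheory.Category.{v} C]
    [CategoryTheory.Limits.HasFiniteLimits C] [CategoryTheory.FinitaryExtensive C]
    [FibCont.LocallyCartesianClosed C] [FibCont.HasDependentWTypes C]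
    [FibCont.HasDependentMTypes C] (k : ℕ)
    (F : (Fin (k + 1) → FibCont.Container C) ⥤ FibCont.Container C)
    (hF : FibCont.IsFibredPolynomial F) (γ : FibCont.FixKind) :
    ∃ (G : (Fin k → FibCont.Container C) ⥤ FibCont.Container C)
      (a : FibCont.diagApp F G ≅ G),
      FibCont.IsFibredPolynomial G ∧
      ∀ f : Fin k → FibCont.Container C,
        FibCont.IsFixpoint γ (FibCont.partialApp F f) (G.obj f) (a.app f) := by
  exact FibCont.exists_isFibredPolynomial_isFixpoint hF γ
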